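/- **Setting.** Let $q_1,q_2,q_3\in\mathbb C$ with $q_1q_2q_3=1$ and $g(z,w)=(z-q_1w)(z-q_2w)(z-q_3w)$. Nonzero complex parameters $v_1,\dots,v_m$ are called *generic* if $\prod_i v_i^{j_i}=1$ with $j_i\in\mathbb Z$ implies $j_1=\dots=j_m=0$. Let $\mathcal E$ be the unital associative $\mathbb C$-algebra with generators $e_i,f_i$ ($i\in\mathbb Z$), $\psi^+_i,\psi^-_{-i}$ ($i\ge 0$), $(\psi_0^\pm)^{-1}$ and relations, for $e(z)=\sum_i e_iz^{-i}$, $f(z)=\sum_i f_iz^{-i}$, $\psi^\pm(z)=\sum_{\pm i\ge0}\psi^\pm_iz^{-i}$, $\delta(z)=\sum_{i\in\mathbb Z}z^i$: $$g(z,w)e(z)e(w)=-g(w,z)e(w)e(z),\qquad g(w,z)f(z)f(w)=-g(z,w)f(w)f(z),$$ $$g(z,w)\psi^\pm(z)e(w)=-g(w,z)e(w)\psi^\pm(z),\qquad g(w,z)\psi^\pm(z)f(w)=-g(z,w)f(w)\psi^\pm(z),$$ $$[e(z),f(w)]=\tfrac{\delta(z/w)}{g(1,1)}\,(\psi^+(z)-\psi^-(z)),$$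 all $\psi^\pm_i$ commute, $(\psi_0^\pm)^{-1}$ is a two-sided inverse of $\psi_0^\pm$, $[e_0,[e_1,e_{-1}]]=0$ and $[f_0,[f_1,f_{-1}]]=0$. It is $\mathbb Z$-graded by $\deg e_i=1$, $\deg f_i=-1$, $\deg\psi^\pm_i=0$. An $\mathcal E$-module is *tame* if it is spanned by joint eigenvectors of all $\psi^+_i,\psi^-_{-i}$, $i\ge0$, and all joint eigenspaces have dimension at most $1$. It is a *highest weight module* with highest vector $v\neq0$ and highest weight $\phi^\pm(z)$ if $v$ generates it, $f(z)v=0$ and $\psi^\pm(z)v=\phi^\pm(z)v$. **Fock modules.** Partitions $\lambda=(\lambda_1\ge\lambda_2\ge\cdots)$ are finite, and $\mathbf 1_s$ denotes one box in row $s$. For $u\in\mathbb C^\times$ let $\mathcal F(u)$ have basis $|\lambda\rangle$. Put $\psi^+_\emptyset(x)=\frac{1-q_2x}{1-x}$ and $\psi^-_\emptyset(x)=q_2\frac{1-q_2^{-1}x^{-1}}{1-x^{-1}}$, two expressions of the same rational function, and likewise let $$\psi_{\lambda,j}(z)=\frac{(1-q_1^{\lambda_j}q_3^{j}u/z)(1-q_1^{\lambda_j-1}q_3^{j-2}u/z)}{(1-q_1^{\lambda_j}q_3^{j-1}u/z)(1-q_1^{\lambda_j-1}q_3^{j-1}u/z)}.$$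 Then $\psi^\pm(z)|\lambda\rangle=\psi^\pm_\emptyset(u/z)\prod_{j\ge1}\frac{\psi_{\lambda,j}(z)}{\psi_{\emptyset,j}(z)}\,|\lambda\rangle$, expanded in powers of $z^{\mp1}$, and the only nonzero matrix coefficients of $e(z),f(z)$ are $$\langle\lambda+\mathbf 1_s|e(z)|\lambda\rangle=\frac{\delta(v/z)}{1-q_1}\prod_{j<s}\psi_{\lambda,j}(v),\qquad \langle\lambda|f(z)|\lambda+\mathbf 1_s\rangle=\frac{q_1\,\delta(v/z)}{1-q_1}\,\psi^+_\emptyset(uq_3^s/v)\prod_{j>s}\frac{\psi_{\lambda,j}(v)}{\psi_{\emptyset,j}(v)},$$ where $v=q_1^{\lambda_s}q_3^{s-1}u$. For generic $q_1,q_2,u_1,\dots,u_n$ operators $e(z),f(z),\psi^\pm(z)$ on $\mathcal F(u_1)\otimes\cdots\otimes\mathcal F(u_n)$ are given by the (iterated) comultiplication $\triangle e(z)=e(z)\otimes1+\psi^-(z)\otimes e(z)$, $\triangle f(z)=f(z)\otimes\psi^+(z)+1\otimes f(z)$, $\triangle\psi^\pm(z)=\psi^\pm(z)\otimes\psi^\pm(z)$,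 where a rational function multiplying $\delta(v/z)$ is evaluated at $z=v$. **Theorem.** Let $n\ge1$, let $q_1,q_2,u$ be generic, let $a_i,b_i\in\mathbb Z_{\ge0}$ ($1\le i\le n-1$), and let $u_1=u$ and $u_i=u_{i+1}q_1^{a_i+1}q_3^{b_i+1}$ for $1\le i\le n-1$. Let $\mathcal M_{\mathbf a,\mathbf b}(u)$ be the complex vector space with basis the $|\lambda^{(1)},\dots,\lambda^{(n)}\rangle$ such that $\lambda^{(i)}_s\ge\lambda^{(i+1)}_{s+b_i}-a_i$ for all $s\ge1$ and $1\le i\le n-1$, graded by $\sum_i|\lambda^{(i)}|$. Then: 1. For any two basis vectors of $\mathcal M_{\mathbf a,\mathbf b}(u)$, the matrix coefficients between them of all modes of $e(z),f(z),\psi^\pm(z)$ on $\mathcal F(u_1)\otimes\cdots\otimes\mathcal F(u_n)$ have a limit as generic parameters tend to the given values of $q_1,q_2,u_1,\dots,u_n$. The operators on $\mathcal M_{\mathbf a,\mathbf b}(u)$ with these limits as matrix coefficients are well defined, and they define a unique $\mathcal E$-module structure, which is graded. 2. This $\mathcal E$-module is irreducible and tame, and it is a highest weight module with highest vector $|\emptyset,\dots,\emptyset\rangle$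 and highest weight $\prod_{i=1}^n\psi^\pm_\emptyset(u_i/z)$. -/

import Mathlib

open Filter Topology

noncomputable section

namespace QuantumGl

/-! ## Generic parameters -/

/-- A finite family of nonzero complex parameters is generic if no nontrivial (Laurent) monomial
in them is equal to `1`. -/
def Generic {ι : Type*} [Fintype ι] (v : ι → ℂ) : Prop :=
  (∀ i, v i ≠ 0) ∧ ∀ j : ι → ℤ, ∏ i, v i ^ j i = 1 → j = 0

/-! ## The algebra `E`

Formal distributions `X(z, w) = ∑ X_{i,j} z^{-i} w^{-j}` with coefficients in `A` are functions
`ℤ → ℤ → A`. -/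

/-- The generators: `e_i`, `f_i` (`i ∈ ℤ`), `ψ⁺_i`, `ψ⁻_{-i}` (`i ≥ 0`), `(ψ⁺_0)⁻¹`, `(ψ⁻_0)⁻¹`. -/
inductive Gen : Type
  | e (i : ℤ)
  | f (i : ℤ)
  | psiPlus (i : ℕ)
  | psiMinus (i : ℕ)
  | psiPlusInv
  | psiMinusInv

section Distributions

variable {A : Type*} [Ring A] [Algebra ℂ A]

/-- Multiplication of a distribution in `z, w` by `z - c w`. -/
def mulZsubW (c : ℂ) (X : ℤ → ℤ → A) : ℤ → ℤ → A :=
  fun i j => X (i + 1) j - c • X i (j + 1)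

/-- Multiplication of a distribution in `z, w` by `w - c z`. -/
def mulWsubZ (c : ℂ) (X : ℤ → ℤ → A) : ℤ → ℤ → A :=
  fun i j => X i (j + 1) - c • X (i + 1) j

/-- Multiplication by `g(z,w) = (z - q₁ w)(z - q₂ w)(z - q₃ w)`. -/
def mulGzw (q₁ q₂ q₃ : ℂ) (X : ℤ → ℤ → A) : ℤ → ℤ → A :=
  mulZsubW q₁ (mulZsubW q₂ (mulZsubW q₃ X))

/-- Multiplication by `g(w,z) = (w - q₁ z)(w - q₂ z)(w - q₃ z)`. -/
def mulGwz (q₁ q₂ q₃ : ℂ) (X : ℤ → ℤ → A) : ℤ → ℤ → A :=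
  mulWsubZ q₁ (mulWsubZ q₂ (mulWsubZ q₃ X))

/-- The distribution `a(z) b(w)`. -/
def prodZW (a b : ℤ → A) : ℤ → ℤ → A := fun i j => a i * b j

/-- The distribution `b(w) a(z)`. -/
def prodWZ (a b : ℤ → A) : ℤ → ℤ → A := fun i j => b j * a i

end Distributions

/-- The free algebra on the generators. -/
abbrev FreeE : Type := FreeAlgebra ℂ Gen

/-- Coefficients (of `z^{-i}`) of the series `e(z)`. -/
def eSer (i : ℤ) : FreeE := FreeAlgebra.ι ℂ (Gen.e i)

/-- Coefficients (of `z^{-i}`) of the series `f(z)`. -/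
def fSer (i : ℤ) : FreeE := FreeAlgebra.ι ℂ (Gen.f i)

/-- Coefficients (of `z^{-i}`) of the series `ψ⁺(z) = ∑_{i ≥ 0} ψ⁺_i z^{-i}`. -/
def psiPlusSer (i : ℤ) : FreeE :=
  if 0 ≤ i then FreeAlgebra.ι ℂ (Gen.psiPlus i.toNat) else 0

/-- Coefficients (of `z^{-i}`) of the series `ψ⁻(z) = ∑_{i ≤ 0} ψ⁻_i z^{-i}`. -/
def psiMinusSer (i : ℤ) : FreeE :=
  if i ≤ 0 then FreeAlgebra.ι ℂ (Gen.psiMinus (-i).toNat) else 0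

/-- The defining relations, coefficient by coefficient. -/
inductive Rel (q₁ q₂ q₃ : ℂ) : FreeE → FreeE → Prop
  | e_e (i j : ℤ) : Rel q₁ q₂ q₃
      (mulGzw q₁ q₂ q₃ (prodZW eSer eSer) i j) (-mulGwz q₁ q₂ q₃ (prodWZ eSer eSer) i j)
  | f_f (i j : ℤ) : Rel q₁ q₂ q₃
      (mulGwz q₁ q₂ q₃ (prodZW fSer fSer) i j) (-mulGzw q₁ q₂ q₃ (prodWZ fSer fSer) i j)
  | psiPlus_e (i j : ℤ) : Rel q₁ q₂ q₃
      (mulGzw q₁ q₂ q₃ (prodZW psiPlusSer eSer) i j)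
      (-mulGwz q₁ q₂ q₃ (prodWZ psiPlusSer eSer) i j)
  | psiMinus_e (i j : ℤ) : Rel q₁ q₂ q₃
      (mulGzw q₁ q₂ q₃ (prodZW psiMinusSer eSer) i j)
      (-mulGwz q₁ q₂ q₃ (prodWZ psiMinusSer eSer) i j)
  | psiPlus_f (i j : ℤ) : Rel q₁ q₂ q₃
      (mulGwz q₁ q₂ q₃ (prodZW psiPlusSer fSer) i j)
      (-mulGzw q₁ q₂ q₃ (prodWZ psiPlusSer fSer) i j)
  | psiMinus_f (i j : ℤ) : Rel q₁ q₂ q₃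
      (mulGwz q₁ q₂ q₃ (prodZW psiMinusSer fSer) i j)
      (-mulGzw q₁ q₂ q₃ (prodWZ psiMinusSer fSer) i j)
  /-- `[e(z), f(w)] = δ(z/w) g(1,1)⁻¹ (ψ⁺(z) - ψ⁻(z))`; the coefficient of `z^{-i} w^{-j}` in
  `δ(z/w) ψ(z)` is `ψ_{i+j}`. -/
  | e_f (i j : ℤ) : Rel q₁ q₂ q₃
      (eSer i * fSer j - fSer j * eSer i)
      (((1 - q₁) * (1 - q₂) * (1 - q₃))⁻¹ • (psiPlusSer (i + j) - psiMinusSer (i + j)))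
  | psiPlus_psiPlus (i j : ℤ) : Rel q₁ q₂ q₃
      (psiPlusSer i * psiPlusSer j) (psiPlusSer j * psiPlusSer i)
  | psiMinus_psiMinus (i j : ℤ) : Rel q₁ q₂ q₃
      (psiMinusSer i * psiMinusSer j) (psiMinusSer j * psiMinusSer i)
  | psiPlus_psiMinus (i j : ℤ) : Rel q₁ q₂ q₃
      (psiPlusSer i * psiMinusSer j) (psiMinusSer j * psiPlusSer i)
  | psiPlus_mul_inv : Rel q₁ q₂ q₃ (psiPlusSer 0 * FreeAlgebra.ι ℂ Gen.psiPlusInv) 1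
  | psiPlus_inv_mul : Rel q₁ q₂ q₃ (FreeAlgebra.ι ℂ Gen.psiPlusInv * psiPlusSer 0) 1
  | psiMinus_mul_inv : Rel q₁ q₂ q₃ (psiMinusSer 0 * FreeAlgebra.ι ℂ Gen.psiMinusInv) 1
  | psiMinus_inv_mul : Rel q₁ q₂ q₃ (FreeAlgebra.ι ℂ Gen.psiMinusInv * psiMinusSer 0) 1
  | serre_e : Rel q₁ q₂ q₃ ⁅eSer 0, ⁅eSer 1, eSer (-1)⁆⁆ 0
  | serre_f : Rel q₁ q₂ q₃ ⁅fSer 0, ⁅fSer 1, fSer (-1)⁆⁆ 0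

/-- The quantum continuous `gl_∞` algebra `E` with parameters `q₁, q₂, q₃`. -/
abbrev EAlg (q₁ q₂ q₃ : ℂ) : Type := RingQuot (Rel q₁ q₂ q₃)

/-- The generators as elements of `E`. -/
def EAlg.gen (q₁ q₂ q₃ : ℂ) (x : Gen) : EAlg q₁ q₂ q₃ :=
  RingQuot.mkAlgHom ℂ (Rel q₁ q₂ q₃) (FreeAlgebra.ι ℂ x)

/-- Degrees of the generators. -/
def Gen.deg : Gen → ℤ
  | .e _ => 1
  | .f _ => -1
  | _ => 0

/-- The component of degree `d` of the `ℤ`-graded algebra `E`: the span of the words of degree `d`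
in the generators. -/
def EAlg.homogeneous (q₁ q₂ q₃ : ℂ) (d : ℤ) : Submodule ℂ (EAlg q₁ q₂ q₃) :=
  Submodule.span ℂ
    {x | ∃ w : List Gen, (w.map Gen.deg).sum = d ∧ x = (w.map (EAlg.gen q₁ q₂ q₃)).prod}

/-! ## Properties of `E`-modules

An `E`-module structure on a complex vector space `V` is an algebra homomorphism
`ρ : E → End V`. -/

section Modules

variable {q₁ q₂ q₃ : ℂ} {V : Type*} [AddCommGroup V] [Module ℂ V]

/-- `V`, with pieces `V_k`, is a graded `E`-module. -/
def IsGradedModule (ρ : EAlg q₁ q₂ q₃ →ₐ[ℂ] Module.End ℂ V) (piece : ℤ → Submodule ℂ V) : Prop :=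
  DirectSum.IsInternal piece ∧
    ∀ (d k : ℤ), ∀ x ∈ EAlg.homogeneous q₁ q₂ q₃ d, ∀ v ∈ piece k, ρ x v ∈ piece (d + k)

/-- Irreducibility of an `E`-module. -/
def IsIrreducibleModule (ρ : EAlg q₁ q₂ q₃ →ₐ[ℂ] Module.End ℂ V) : Prop :=
  letI : Module (EAlg q₁ q₂ q₃) V := Module.compHom V ρ.toRingHom
  IsSimpleModule (EAlg q₁ q₂ q₃) V

/-- The joint eigenspace of all `ψ⁺_i` and `ψ⁻_{-i}`, `i ≥ 0`, with eigenvalues `χ⁺ i`, `χ⁻ i`. -/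
def jointEigenspace (ρ : EAlg q₁ q₂ q₃ →ₐ[ℂ] Module.End ℂ V) (χ : (ℕ → ℂ) × (ℕ → ℂ)) :
    Submodule ℂ V :=
  ⨅ i : ℕ, (ρ (EAlg.gen q₁ q₂ q₃ (.psiPlus i))).eigenspace (χ.1 i) ⊓
    (ρ (EAlg.gen q₁ q₂ q₃ (.psiMinus i))).eigenspace (χ.2 i)

/-- Tame modules: the `ψ⁺_i`, `ψ⁻_{-i}` act by (simultaneously) diagonalizable operators with
simple joint spectrum, i.e. `V` is spanned by joint eigenvectors and every joint eigenspace has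
dimension at most `1`. -/
def IsTame (ρ : EAlg q₁ q₂ q₃ →ₐ[ℂ] Module.End ℂ V) : Prop :=
  (⨆ χ, jointEigenspace ρ χ) = ⊤ ∧ ∀ χ, Module.rank ℂ (jointEigenspace ρ χ) ≤ 1

/-- `V` is a highest weight module with highest vector `v` and highest weight `φ⁺(z), φ⁻(z)`.
Here `φp` is `φ⁺` as a series in `X = z⁻¹`, and `φm` is `φ⁻` as a series in `X = z`. -/
structure IsHighestWeight (ρ : EAlg q₁ q₂ q₃ →ₐ[ℂ] Module.End ℂ V) (v : V)
    (φp φm : LaurentSeries ℂ) : Prop where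
  ne_zero : v ≠ 0
  generates : ∀ x : V, ∃ y : EAlg q₁ q₂ q₃, ρ y v = x
  f_zero : ∀ k : ℤ, ρ (EAlg.gen q₁ q₂ q₃ (.f k)) v = 0
  psiPlus : ∀ k : ℕ, ρ (EAlg.gen q₁ q₂ q₃ (.psiPlus k)) v = φp.coeff (k : ℤ) • v
  psiMinus : ∀ k : ℕ, ρ (EAlg.gen q₁ q₂ q₃ (.psiMinus k)) v = φm.coeff (k : ℤ) • v

end Modules

/-! ## Eigenvalues of `ψ^±(z)` on the vector and Fock modules

All eigenvalues are rational functions, which have to be both expanded into series and evaluated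
at points. So they are defined over any field `K` with an embedding `ι` of `ℂ`: `K = ℂ` gives
values, and `K = ℂ((X))`, with `ι` the constant series, gives expansions, where `X = z⁻¹` for
`ψ⁺(z)` and `X = z` for `ψ⁻(z)`.
The argument is `x = u/z` for `ψ⁺` and `y = z/u` for `ψ⁻`.

Rows of a partition are numbered from `0`: row `s` here is `λ_{s+1}` in the usual notation. -/

/-- Finite partitions: non-increasing sequences of integers with finitely many nonzero terms. -/
def Partition : Type := {l : ℕ →₀ ℤ // Antitone l}

/-- The empty partition. -/
def Partition.empty : Partition := ⟨0, fun _ _ _ => le_refl _⟩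

/-- The size of a partition. -/
def Partition.size (l : Partition) : ℤ := l.1.sum fun _ m => m

section Eigenvalues

variable {K : Type*} [Field K] (ι : ℂ →+* K)

/-- Eigenvalue of `ψ⁺(z)` on the basis vector `|m⟩` of the vector module `V(u)`, `x = u/z`. -/
def vecPsiPlus (q₁ q₂ q₃ : ℂ) (m : ℤ) (x : K) : K :=
  ((1 - ι (q₁ ^ m * q₃) * x) * (1 - ι (q₁ ^ m * q₂) * x)) /
    ((1 - ι (q₁ ^ m) * x) * (1 - ι (q₁ ^ (m - 1)) * x))

/-- Eigenvalue of `ψ⁻(z)` on the basis vector `|m⟩` of the vector module `V(u)`, `y = z/u`. -/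
def vecPsiMinus (q₁ q₂ q₃ : ℂ) (m : ℤ) (y : K) : K :=
  ((1 - ι (q₁ ^ (-m) * q₃⁻¹) * y) * (1 - ι (q₁ ^ (-m) * q₂⁻¹) * y)) /
    ((1 - ι (q₁ ^ (-m)) * y) * (1 - ι (q₁ ^ (-m + 1)) * y))

/-- `⟨λ|ψ⁺(z)_j|λ⟩`: with `j` counted from `0`, the eigenvalue of `ψ⁺(z)` on
`|λ_j - j⟩ ∈ V(u q₂^{-j})`. -/
def rowPsiPlus (q₁ q₂ q₃ : ℂ) (l : Partition) (j : ℕ) (x : K) : K :=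
  vecPsiPlus ι q₁ q₂ q₃ (l.1 j - j) (ι (q₂ ^ (-(j : ℤ))) * x)

/-- `⟨λ|ψ⁻(z)_j|λ⟩`, similarly. -/
def rowPsiMinus (q₁ q₂ q₃ : ℂ) (l : Partition) (j : ℕ) (y : K) : K :=
  vecPsiMinus ι q₁ q₂ q₃ (l.1 j - j) (ι (q₂ ^ (j : ℤ)) * y)

/-- `ψ⁺_∅(x)`. -/
def psiEmptyPlus (q₂ : ℂ) (x : K) : K := (1 - ι q₂ * x) / (1 - x)

/-- `ψ⁻_∅(x)` as a function of `y = x⁻¹`. -/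
def psiEmptyMinus (q₂ : ℂ) (y : K) : K := ι q₂ * ((1 - ι q₂⁻¹ * y) / (1 - y))

/-- Eigenvalue of `ψ⁺(z)` on `|λ⟩` in the Fock module `F(u)`, `x = u/z`. -/
def fockPsiPlus (q₁ q₂ q₃ : ℂ) (l : Partition) (x : K) : K :=
  psiEmptyPlus ι q₂ x *
    ∏ᶠ j : ℕ, rowPsiPlus ι q₁ q₂ q₃ l j x / rowPsiPlus ι q₁ q₂ q₃ Partition.empty j x

/-- Eigenvalue of `ψ⁻(z)` on `|λ⟩` in the Fock module `F(u)`, `y = z/u`. -/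
def fockPsiMinus (q₁ q₂ q₃ : ℂ) (l : Partition) (y : K) : K :=
  psiEmptyMinus ι q₂ y *
    ∏ᶠ j : ℕ, rowPsiMinus ι q₁ q₂ q₃ l j y / rowPsiMinus ι q₁ q₂ q₃ Partition.empty j y

end Eigenvalues

/-! ## Matrix coefficients of `e(z)`, `f(z)` on Fock modules

Each nonzero matrix coefficient has the form `c · δ(v/z)`, whose coefficient of `z^{-k}` is
`c v^k`; functions of `z` multiplying `δ(v/z)` are evaluated at `z = v`. -/

/-- The support `v = q₁^{λ_s} q₃^{s} u` (`s` counted from `0`) of the delta function in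
`⟨λ + 1_s|e(z)|λ⟩` and `⟨λ|f(z)|λ + 1_s⟩`. -/
def boxSupport (q₁ q₃ u : ℂ) (l : Partition) (s : ℕ) : ℂ := q₁ ^ (l.1 s) * q₃ ^ s * u

/-- The coefficient `c` in `⟨λ + 1_s|e(z)|λ⟩ = c δ(v/z)` on `F(u)`. -/
def fockE (q₁ q₂ q₃ u : ℂ) (l : Partition) (s : ℕ) : ℂ :=
  (1 - q₁)⁻¹ * ∏ j ∈ Finset.range s, rowPsiPlus (RingHom.id ℂ) q₁ q₂ q₃ l j (u / boxSupport q₁ q₃ u l s)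

/-- The coefficient `c` in `⟨λ|f(z)|λ + 1_s⟩ = c δ(v/z)` on `F(u)`. -/
def fockF (q₁ q₂ q₃ u : ℂ) (l : Partition) (s : ℕ) : ℂ :=
  q₁ * (1 - q₁)⁻¹ * psiEmptyPlus (RingHom.id ℂ) q₂ (u * q₃ ^ (s + 1) / boxSupport q₁ q₃ u l s) *
    ∏ᶠ (j : ℕ) (_ : s < j), rowPsiPlus (RingHom.id ℂ) q₁ q₂ q₃ l j (u / boxSupport q₁ q₃ u l s) /
      rowPsiPlus (RingHom.id ℂ) q₁ q₂ q₃ Partition.empty j (u / boxSupport q₁ q₃ u l s)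

/-! ## Matrix coefficients on the tensor product `F(u_1) ⊗ ⋯ ⊗ F(u_N)`

They are given by the comultiplication `Δe = e ⊗ 1 + ψ⁻ ⊗ e`, `Δf = f ⊗ ψ⁺ + 1 ⊗ f`,
`Δψ^± = ψ^± ⊗ ψ^±`. -/

/-- `μ = λ + 1_s^{(i)}`. -/
def IsAddBox {N : ℕ} (i : Fin N) (s : ℕ) (lam mu : Fin N → Partition) : Prop :=
  (mu i).1 = (lam i).1 + Finsupp.single s 1 ∧ ∀ k, k ≠ i → mu k = lam k

open Classical in
/-- `⟨μ|e_k|λ⟩`. -/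
def tensorE {N : ℕ} (q₁ q₂ q₃ : ℂ) (u : Fin N → ℂ) (k : ℤ) (mu lam : Fin N → Partition) : ℂ :=
  ∑ᶠ (i : Fin N) (s : ℕ),
    if IsAddBox i s lam mu then
      (∏ m ∈ Finset.univ.filter (fun m => m < i),
          fockPsiMinus (RingHom.id ℂ) q₁ q₂ q₃ (lam m) (boxSupport q₁ q₃ (u i) (lam i) s / u m)) *
        fockE q₁ q₂ q₃ (u i) (lam i) s * boxSupport q₁ q₃ (u i) (lam i) s ^ k
    else 0

open Classical in
/-- `⟨λ|f_k|μ⟩`. -/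
def tensorF {N : ℕ} (q₁ q₂ q₃ : ℂ) (u : Fin N → ℂ) (k : ℤ) (lam mu : Fin N → Partition) : ℂ :=
  ∑ᶠ (i : Fin N) (s : ℕ),
    if IsAddBox i s lam mu then
      fockF q₁ q₂ q₃ (u i) (lam i) s *
        (∏ m ∈ Finset.univ.filter (fun m => i < m),
          fockPsiPlus (RingHom.id ℂ) q₁ q₂ q₃ (lam m) (u m / boxSupport q₁ q₃ (u i) (lam i) s)) *
        boxSupport q₁ q₃ (u i) (lam i) s ^ k
    else 0

open Classical in
/-- `⟨μ|ψ⁺_k|λ⟩`, `k ≥ 0`: the coefficient of `z^{-k}` in the matrix coefficient of `ψ⁺(z)`. -/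
def tensorPsiPlus {N : ℕ} (q₁ q₂ q₃ : ℂ) (u : Fin N → ℂ) (k : ℕ) (mu lam : Fin N → Partition) :
    ℂ :=
  if mu = lam then
    (∏ i, fockPsiPlus HahnSeries.C q₁ q₂ q₃ (lam i) (HahnSeries.single 1 (u i) : LaurentSeries ℂ)).coeff (k : ℤ)
  else 0

open Classical in
/-- `⟨μ|ψ⁻_{-k}|λ⟩`, `k ≥ 0`: the coefficient of `z^k` in the matrix coefficient of `ψ⁻(z)`. -/
def tensorPsiMinus {N : ℕ} (q₁ q₂ q₃ : ℂ) (u : Fin N → ℂ) (k : ℕ) (mu lam : Fin N → Partition) :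
    ℂ :=
  if mu = lam then
    (∏ i, fockPsiMinus HahnSeries.C q₁ q₂ q₃ (lam i)
      (HahnSeries.single 1 (u i)⁻¹ : LaurentSeries ℂ)).coeff (k : ℤ)
  else 0

/-! ## The space `M_{a,b}` and the action obtained by specialization of the parameters

There are `n + 1` tensor factors, numbered from `0` to `n`, and `a, b` are indexed by the `n`
pairs of neighbours. -/

/-- The labels of the basis of `M_{a,b}`: tuples of partitions with
`λ^{(i)}_s ≥ λ^{(i+1)}_{s+b_i} - a_i`. -/
def Label {n : ℕ} (a b : Fin n → ℕ) : Type :=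
  {lam : Fin (n + 1) → Partition //
    ∀ (i : Fin n) (s : ℕ), (lam i.succ).1 (s + b i) - (a i : ℤ) ≤ (lam i.castSucc).1 s}

/-- `M_{a,b}`: the complex vector space with basis the labels. -/
abbrev MSpace {n : ℕ} (a b : Fin n → ℕ) : Type := Label a b →₀ ℂ

/-- The basis vector `|λ⟩`. -/
def ket {n : ℕ} {a b : Fin n → ℕ} (lam : Label a b) : MSpace a b := Finsupp.single lam 1

/-- The label `(∅, …, ∅)`. -/
def Label.empty {n : ℕ} (a b : Fin n → ℕ) : Label a b :=
  ⟨fun _ => Partition.empty, fun i s => by simp [Partition.empty]⟩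

/-- The degree of a basis vector: the total number of boxes. -/
def Label.deg {n : ℕ} {a b : Fin n → ℕ} (lam : Label a b) : ℤ := ∑ i, (lam.1 i).size

/-- The grading of `M_{a,b}`. -/
def MSpace.piece {n : ℕ} (a b : Fin n → ℕ) (k : ℤ) : Submodule ℂ (MSpace a b) :=
  Finsupp.supported ℂ ℂ {lam : Label a b | lam.deg = k}

/-- Parameters `(q₁, q₂, (u_i))`; the third parameter is `q₃ = (q₁ q₂)⁻¹`. -/
abbrev Param (N : ℕ) : Type := ℂ × ℂ × (Fin N → ℂ)

/-- Generic parameter values `q₁, q₂, u_1, …, u_N`, approaching the value `p`. -/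
def genericNhds {N : ℕ} (p : Param N) : Filter (Param N) :=
  𝓝[{p' : Param N | Generic (Matrix.vecCons p'.1 (Matrix.vecCons p'.2.1 p'.2.2))}] p

/-- The `E`-module structure `ρ` on `M_{a,b}` is the one given by the tensor action: every matrix
coefficient (in the basis of `M_{a,b}`) of every mode of `e(z)`, `f(z)`, `ψ^±(z)` is well defined
at the parameters `(q₁, q₂, u)`, as the limit of the corresponding matrix coefficient of
`F(u_0) ⊗ ⋯ ⊗ F(u_n)` from generic values of the parameters, and is equal to this limit. -/
structure IsTensorAction {n : ℕ} (a b : Fin n → ℕ) {q₁ q₂ q₃ : ℂ} (u : Fin (n + 1) → ℂ)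
    (ρ : EAlg q₁ q₂ q₃ →ₐ[ℂ] Module.End ℂ (MSpace a b)) : Prop where
  e : ∀ (k : ℤ) (mu lam : Label a b),
    Tendsto (fun p : Param (n + 1) => tensorE p.1 p.2.1 (p.1 * p.2.1)⁻¹ p.2.2 k mu.1 lam.1)
      (genericNhds (q₁, q₂, u)) (𝓝 (ρ (EAlg.gen q₁ q₂ q₃ (.e k)) (ket lam) mu))
  f : ∀ (k : ℤ) (mu lam : Label a b),
    Tendsto (fun p : Param (n + 1) => tensorF p.1 p.2.1 (p.1 * p.2.1)⁻¹ p.2.2 k mu.1 lam.1)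
      (genericNhds (q₁, q₂, u)) (𝓝 (ρ (EAlg.gen q₁ q₂ q₃ (.f k)) (ket lam) mu))
  psiPlus : ∀ (k : ℕ) (mu lam : Label a b),
    Tendsto (fun p : Param (n + 1) => tensorPsiPlus p.1 p.2.1 (p.1 * p.2.1)⁻¹ p.2.2 k mu.1 lam.1)
      (genericNhds (q₁, q₂, u)) (𝓝 (ρ (EAlg.gen q₁ q₂ q₃ (.psiPlus k)) (ket lam) mu))
  psiMinus : ∀ (k : ℕ) (mu lam : Label a b),
    Tendsto (fun p : Param (n + 1) => tensorPsiMinus p.1 p.2.1 (p.1 * p.2.1)⁻¹ p.2.2 k mu.1 lam.1)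
      (genericNhds (q₁, q₂, u)) (𝓝 (ρ (EAlg.gen q₁ q₂ q₃ (.psiMinus k)) (ket lam) mu))

/-- `∏ ψ⁺_∅(u_i/z)` as a series in `X = z⁻¹`. -/
def highestWeightPlus {N : ℕ} (q₂ : ℂ) (u : Fin N → ℂ) : LaurentSeries ℂ :=
  ∏ i, psiEmptyPlus HahnSeries.C q₂ (HahnSeries.single 1 (u i) : LaurentSeries ℂ)

/-- `∏ ψ⁻_∅(u_i/z)` as a series in `X = z`. -/
def highestWeightMinus {N : ℕ} (q₂ : ℂ) (u : Fin N → ℂ) : LaurentSeries ℂ :=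
  ∏ i, psiEmptyMinus HahnSeries.C q₂ (HahnSeries.single 1 (u i)⁻¹ : LaurentSeries ℂ)

end QuantumGl

end

open QuantumGl

/-! A Fock module behaves like a semi-infinite tensor product of vector modules, one for each row of
the partition. A basis vector of the tensor product is therefore a function `X` on rows, and the
rows of all the partitions are ordered lexicographically. Raising a row multiplies by values of one
structure function `phi` between this row and the rows before it; lowering uses the rows after it.
Beyond a cut-off `L` all rows are empty, and their contribution telescopes to the single factor
`tailFactor`.

At the given parameters the weight of the next box of a row is `q₁ ^ col * q₃ ^ level * u`, with
integers `col` and `level`, so weights of different partitions can resonate: zeros and poles of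
`phi` become integer relations between the positions of two rows in a plane. The inequalities that
define the labels, in the form `IsState.interlace`, control these relations. A step from a label to
a non-label has coefficient zero (`Resonant.coefE_eq_zero`, `Resonant.coefF_eq_zero`), and a step
between labels has a finite nonzero coefficient (`Resonant.coefE_ne_zero`,
`Resonant.coefF_ne_zero`), which is the limit of the generic one.

The quadratic and Serre relations are verified directly at the given parameters. Such a relation is
a sum over paths of two or three raisings. Paths with the same end are grouped, rows that do not
move are absorbed into a common factor, and what is left is a rational identity between two or three
points: `gfun_mul_phi_mul_left` for the quadratic relation, `serre_phi_three`, `serre_phi_two_one`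
and `serre_phi_one_two` for the Serre relation. These identities need that no weights collide on the
way. That is `IsState.col_add_le`: a collision is guarded by four rows, and at most three can move.
Lowering is raising for inverse parameters and reflected states, so its relations follow.

The off-diagonal part of `[e(z), f(w)]` cancels by `phi_mul_phi_cross`. Its diagonal part consists,
for generic parameters, of the residues of the eigenvalue of `ψ(z)`, so partial fractions compare it
with the difference of the expansions at infinity and at zero. At the given parameters poles may
collide, and this identity is obtained as a limit.

The eigenvalue of `ψ⁺(z)` determines the multiset of weights of the rows: the difference of two such
multisets satisfies a linear recurrence in the plane with support in finitely many levels, hence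
vanishes (`eq_zero_of_relation`). The set of weights in turn determines the label
(`IsState.eq_of_forall_exists`). Hence the joint spectrum is simple, and every invariant subspace is
spanned by basis vectors. Since all steps between labels have nonzero coefficients, and every label
is connected with the empty one by removing boxes one at a time, the module is irreducible and
generated by the vacuum. Uniqueness holds because generic parameters accumulate at the given point,
so that limits are unique. -/

noncomputable section

namespace QuantumGl

/-! ### The structure function and the rational identities behind the relations. -/

section StructureFunction

variable {K : Type*} [Field K]

/-- The eigenvalue `(z - q₃ p)(z - q₂ p) / ((z - p)(z - q₁⁻¹ p))` of `ψ(z)` on a vector of the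
vector module, whose next box has weight `p`. -/
def phi (q₁ q₂ q₃ p z : K) : K := ((z - q₃ * p) * (z - q₂ * p)) / ((z - p) * (z - q₁⁻¹ * p))

/-- `g(z, w) = (z - q₁ w)(z - q₂ w)(z - q₃ w)`. -/
def gfun (q₁ q₂ q₃ z w : K) : K := (z - q₁ * w) * (z - q₂ * w) * (z - q₃ * w)

variable {q₁ q₂ q₃ : K}

theorem gfun_eq (hq : q₁ * q₂ * q₃ = 1) (z w : K) :
    gfun q₁ q₂ q₃ z w = z ^ 3 - (q₁ + q₂ + q₃) * z ^ 2 * w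
      + (q₁ * q₂ + q₁ * q₃ + q₂ * q₃) * z * w ^ 2 - w ^ 3 := by
  unfold gfun
  linear_combination (-w ^ 3) * hq

theorem gfun_mul_mul (c z w : K) :
    gfun q₁ q₂ q₃ (c * z) (c * w) = c ^ 3 * gfun q₁ q₂ q₃ z w := by
  unfold gfun; ring

theorem gfun_mul_left_self (z : K) : gfun q₁ q₂ q₃ (q₁ * z) z = 0 := by
  unfold gfun; ring

theorem ne_zero_left_of_prod (hq : q₁ * q₂ * q₃ = 1) : q₁ ≠ 0 := by
  rintro rfl; simp at hq

theorem ne_zero_mid_of_prod (hq : q₁ * q₂ * q₃ = 1) : q₂ ≠ 0 := by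
  rintro rfl; simp at hq

theorem ne_zero_right_of_prod (hq : q₁ * q₂ * q₃ = 1) : q₃ ≠ 0 := by
  rintro rfl; simp at hq

/-- `phi` with the common denominator `(z - p)(z - q₁ p)(q₁ z - p)`. -/
theorem phi_eq_div (hq : q₁ * q₂ * q₃ = 1) {p z : K} (h1 : z ≠ q₁ * p) :
    phi q₁ q₂ q₃ p z = q₁ * gfun q₁ q₂ q₃ z p / ((z - p) * (z - q₁ * p) * (q₁ * z - p)) := by
  have h0 := ne_zero_left_of_prod hq
  have h1' := sub_ne_zero.2 h1
  have e : z - q₁⁻¹ * p = (q₁ * z - p) / q₁ := by field_simp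
  unfold phi gfun
  rw [e, show q₁ * ((z - q₁ * p) * (z - q₂ * p) * (z - q₃ * p)) =
    (z - q₁ * p) * (q₁ * ((z - q₂ * p) * (z - q₃ * p))) by ring,
    show (z - p) * (z - q₁ * p) * (q₁ * z - p) = (z - q₁ * p) * ((z - p) * (q₁ * z - p)) by ring,
    mul_div_mul_left _ _ h1', mul_div_assoc', div_div_eq_mul_div]
  congr 1
  ring

/-- The denominator is that of `phi_eq_div`, and only the arguments of `g` are swapped. This
denominator changes sign under `p ↔ z`, which drives the two-row identities. -/
theorem phi_mul_left_eq_div (hq : q₁ * q₂ * q₃ = 1) {p z : K} (h1 : q₁ * z ≠ p) :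
    phi q₁ q₂ q₃ (q₁ * p) z =
      -(q₁ * gfun q₁ q₂ q₃ p z) / ((z - p) * (z - q₁ * p) * (q₁ * z - p)) := by
  have h0 := ne_zero_left_of_prod hq
  have h1' := sub_ne_zero.2 h1
  unfold phi gfun
  rw [inv_mul_cancel_left₀ h0, show (z - p) * (z - q₁ * p) * (q₁ * z - p) =
      (q₁ * z - p) * ((z - q₁ * p) * (z - p)) by ring,
    show -(q₁ * ((p - q₁ * z) * (p - q₂ * z) * (p - q₃ * z))) =
      (q₁ * z - p) * (q₁ * ((p - q₂ * z) * (p - q₃ * z))) by ring,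
    mul_div_mul_left _ _ h1']
  congr 1
  linear_combination (q₁ * p ^ 2 - z ^ 2) * hq

/-- The eigenvalues of `ψ(z)` before and after adding a box. -/
theorem gfun_mul_phi_mul_left (hq : q₁ * q₂ * q₃ = 1) {p z : K} (h1 : z ≠ q₁ * p)
    (h2 : q₁ * z ≠ p) :
    gfun q₁ q₂ q₃ z p * phi q₁ q₂ q₃ (q₁ * p) z = -gfun q₁ q₂ q₃ p z * phi q₁ q₂ q₃ p z := by
  rw [phi_eq_div hq h1, phi_mul_left_eq_div hq h2]
  ring

/-- Both sides are `-q₁² g(p, w) g(w, p)` over the square of the common denominator. If `w = q₁ p`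
or `p = q₁ w`, each side has a factor with denominator zero, and both sides are `0` by convention.
-/
theorem phi_mul_phi_cross (hq : q₁ * q₂ * q₃ = 1) (p w : K) :
    phi q₁ q₂ q₃ (q₁ * p) w * phi q₁ q₂ q₃ (q₁ * w) p = phi q₁ q₂ q₃ p w * phi q₁ q₂ q₃ w p := by
  have h0 := ne_zero_left_of_prod hq
  by_cases h1 : w = q₁ * p
  · subst h1
    simp [phi, h0]
  by_cases h2 : p = q₁ * w
  · subst h2
    simp [phi, h0]
  rw [phi_mul_left_eq_div hq (Ne.symm h2), phi_mul_left_eq_div hq (Ne.symm h1),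
    phi_eq_div hq h1, phi_eq_div hq h2]
  ring

/-- The weight with which `e_0 e_1 e_{-1} - e_0 e_{-1} e_1 - e_1 e_{-1} e_0 + e_{-1} e_1 e_0`
counts the path that adds boxes of weights `x`, `y`, `z` in this order. -/
def serreWeight (x y z : K) : K := x⁻¹ * y - x * y⁻¹ - y⁻¹ * z + y * z⁻¹

/-- Once `q₁ q₂ q₃ = 1` has normalized the last coefficient of `g`, nothing else about the
parameters matters: the elementary symmetric functions `s`, `t` are free variables. `W` is
`serreWeight` multiplied by `x y z`. -/
theorem serre_polynomial (s t a b c : K) :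
    let g : K → K → K := fun z w => z ^ 3 - s * z ^ 2 * w + t * z * w ^ 2 - w ^ 3
    let W : K → K → K → K := fun x y z => y ^ 2 * z - x ^ 2 * z - x * z ^ 2 + x * y ^ 2
    g a b * g a c * g b c * W a b c - g a b * g a c * g c b * W a c b
      - g b a * g a c * g b c * W b a c + g b a * g c a * g b c * W b c a
      + g a b * g c a * g c b * W c a b - g b a * g c a * g c b * W c b a = 0 := by
  intro g W
  simp only [g, W]
  ring

theorem serre_gfun (hq : q₁ * q₂ * q₃ = 1) {a b c : K} (ha : a ≠ 0) (hb : b ≠ 0) (hc : c ≠ 0) :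
    gfun q₁ q₂ q₃ a b * gfun q₁ q₂ q₃ a c * gfun q₁ q₂ q₃ b c * serreWeight a b c
      - gfun q₁ q₂ q₃ a b * gfun q₁ q₂ q₃ a c * gfun q₁ q₂ q₃ c b * serreWeight a c b
      - gfun q₁ q₂ q₃ b a * gfun q₁ q₂ q₃ a c * gfun q₁ q₂ q₃ b c * serreWeight b a c
      + gfun q₁ q₂ q₃ b a * gfun q₁ q₂ q₃ c a * gfun q₁ q₂ q₃ b c * serreWeight b c a
      + gfun q₁ q₂ q₃ a b * gfun q₁ q₂ q₃ c a * gfun q₁ q₂ q₃ c b * serreWeight c a b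
      - gfun q₁ q₂ q₃ b a * gfun q₁ q₂ q₃ c a * gfun q₁ q₂ q₃ c b * serreWeight c b a = 0 := by
  have hW : ∀ x y z : K, x ≠ 0 → y ≠ 0 → z ≠ 0 → serreWeight x y z =
      (y ^ 2 * z - x ^ 2 * z - x * z ^ 2 + x * y ^ 2) * (x * y * z)⁻¹ := by
    intro x y z hx hy hz
    unfold serreWeight
    field_simp
  have h := serre_polynomial (q₁ + q₂ + q₃) (q₁ * q₂ + q₁ * q₃ + q₂ * q₃) a b c
  simp only [← gfun_eq hq] at h
  rw [hW a b c ha hb hc, hW a c b ha hc hb, hW b a c hb ha hc, hW b c a hb hc ha,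
    hW c a b hc ha hb, hW c b a hc hb ha, show a * c * b = a * b * c by ring,
    show b * a * c = a * b * c by ring, show b * c * a = a * b * c by ring,
    show c * a * b = a * b * c by ring, show c * b * a = a * b * c by ring]
  linear_combination (a * b * c)⁻¹ * h

/-- The Serre relation for three boxes in three different rows. -/
theorem serre_phi_three (hq : q₁ * q₂ * q₃ = 1) {a b c : K} (ha : a ≠ 0) (hb : b ≠ 0) (hc : c ≠ 0)
    (h1 : b ≠ q₁ * a) (h2 : q₁ * b ≠ a) (h3 : c ≠ q₁ * a) (h4 : q₁ * c ≠ a)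
    (h5 : c ≠ q₁ * b) (h6 : q₁ * c ≠ b) :
    let φ := phi q₁ q₂ q₃
    φ (q₁ * a) b * (φ (q₁ * a) c * φ (q₁ * b) c) * serreWeight a b c
      + φ (q₁ * a) c * φ b c * φ (q₁ * a) b * serreWeight a c b
      + φ a b * (φ (q₁ * a) c * φ (q₁ * b) c) * serreWeight b a c
      + φ a b * (φ a c * φ (q₁ * b) c) * serreWeight b c a
      + φ a c * φ b c * φ (q₁ * a) b * serreWeight c a b
      + φ a c * φ b c * φ a b * serreWeight c b a = 0 := by
  intro φ
  simp only [φ]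
  rw [phi_eq_div hq h1, phi_mul_left_eq_div hq h2, phi_eq_div hq h3, phi_mul_left_eq_div hq h4,
    phi_eq_div hq h5, phi_mul_left_eq_div hq h6]
  have h := serre_gfun hq ha hb hc
  set D1 := (b - a) * (b - q₁ * a) * (q₁ * b - a)
  set D2 := (c - a) * (c - q₁ * a) * (q₁ * c - a)
  set D3 := (c - b) * (c - q₁ * b) * (q₁ * c - b)
  linear_combination (-q₁ ^ 3 / D1 / D2 / D3) * h

/-- The Serre relation for two boxes in one row, and a third box in a later row. -/
theorem serre_phi_two_one (hq : q₁ * q₂ * q₃ = 1) {a c : K} (ha : a ≠ 0) (hc : c ≠ 0)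
    (h1 : c ≠ a) (h2 : q₁ * c ≠ a) (h3 : c ≠ q₁ * a) (h4 : c ≠ q₁ * (q₁ * a)) :
    let φ := phi q₁ q₂ q₃
    φ (q₁ * (q₁ * a)) c * serreWeight a (q₁ * a) c + φ (q₁ * a) c * serreWeight a c (q₁ * a)
      + φ a c * serreWeight c a (q₁ * a) = 0 := by
  have h0 := ne_zero_left_of_prod hq
  have e3 : q₃ = (q₁ * q₂)⁻¹ := eq_inv_of_mul_eq_one_right hq
  have h5 := ne_zero_mid_of_prod hq
  have n1 := sub_ne_zero.2 h1
  have n2 : c * q₁ - a ≠ 0 := by rw [mul_comm]; exact sub_ne_zero.2 h2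
  have n3 := sub_ne_zero.2 h3
  have n4 : c - q₁ ^ 2 * a ≠ 0 := by rw [sq, mul_assoc]; exact sub_ne_zero.2 h4
  intro φ
  have e : c - q₁⁻¹ * a = (c * q₁ - a) / q₁ := by field_simp
  simp only [φ, phi, serreWeight, inv_mul_cancel_left₀ h0, e3, e]
  field_simp
  ring

/-- The Serre relation for two boxes in one row, and a third box in an earlier row. -/
theorem serre_phi_one_two (hq : q₁ * q₂ * q₃ = 1) {a c : K} (ha : a ≠ 0) (hc : c ≠ 0)
    (h1 : c ≠ a) (h2 : q₁ * c ≠ a) (h3 : c ≠ q₁ * a) (h4 : q₁ * (q₁ * c) ≠ a) :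
    let φ := phi q₁ q₂ q₃
    φ (q₁ * a) c * φ (q₁ * a) (q₁ * c) * serreWeight a c (q₁ * c)
      + φ a c * φ (q₁ * a) (q₁ * c) * serreWeight c a (q₁ * c)
      + φ a c * φ a (q₁ * c) * serreWeight c (q₁ * c) a = 0 := by
  have h0 := ne_zero_left_of_prod hq
  have e3 : q₃ = (q₁ * q₂)⁻¹ := eq_inv_of_mul_eq_one_right hq
  have h5 := ne_zero_mid_of_prod hq
  have n1 := sub_ne_zero.2 h1
  have n2 : c * q₁ - a ≠ 0 := by rw [mul_comm]; exact sub_ne_zero.2 h2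
  have n3 := sub_ne_zero.2 h3
  have n4 : c * q₁ ^ 2 - a ≠ 0 := by rw [mul_comm, sq, mul_assoc]; exact sub_ne_zero.2 h4
  intro φ
  have e : c - q₁⁻¹ * a = (c * q₁ - a) / q₁ := by field_simp
  have e' : q₁ * c - q₁⁻¹ * a = (c * q₁ ^ 2 - a) / q₁ := by field_simp
  have e'' : q₁ * c - q₁ * a = q₁ * (c - a) := by ring
  simp only [φ, phi, serreWeight, inv_mul_cancel_left₀ h0, e3, e, e', e'']
  field_simp
  ring

/-- Boxes in one row have weights in geometric progression, so the four terms are `q₁`, `-q₁⁻¹`,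
`-q₁`, `q₁⁻¹`. -/
theorem serreWeight_self_three (hq1 : q₁ ≠ 0) {a : K} (ha : a ≠ 0) :
    serreWeight a (q₁ * a) (q₁ * (q₁ * a)) = 0 := by
  unfold serreWeight
  field_simp
  ring

end StructureFunction

/-! ## Rows of boxes and raising operators -/

section Rows

variable {R : Type*}

/-- A strict total order on rows. -/
structure IsRowOrder (lt : R → R → Prop) : Prop where
  irrefl : ∀ r, ¬lt r r
  trans : ∀ {r s t}, lt r s → lt s t → lt r t
  total : ∀ {r s}, r ≠ s → lt r s ∨ lt s r

theorem IsRowOrder.asymm {lt : R → R → Prop} (h : IsRowOrder lt) {r s : R} (hrs : lt r s) :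
    ¬lt s r := fun hsr => h.irrefl r (h.trans hrs hsr)

theorem IsRowOrder.ne {lt : R → R → Prop} (h : IsRowOrder lt) {r s : R} (hrs : lt r s) :
    r ≠ s := by
  rintro rfl; exact h.irrefl r hrs

theorem IsRowOrder.swap {lt : R → R → Prop} (h : IsRowOrder lt) :
    IsRowOrder (fun r s => lt s r) :=
  ⟨h.irrefl, fun h1 h2 => h.trans h2 h1, fun hne => (h.total hne).symm⟩

/-- The weight of the next box of row `r` in the state `X`. -/
def pt (q₁ : ℂ) (c : R → ℂ) (X : R → ℤ) (r : R) : ℂ := q₁ ^ X r * c r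

/-- The coefficient with which row `r` of the state `X` is raised: the rows before `r`
contribute values of the structure function. -/
def coef (q₁ q₂ q₃ : ℂ) (c : R → ℂ) (lt : R → R → Prop) [DecidableRel lt] (τ : R → ℤ → ℂ)
    (S : Finset R) (X : R → ℤ) (r : R) : ℂ :=
  τ r (X r) * ∏ r' ∈ S with lt r' r, phi q₁ q₂ q₃ (pt q₁ c X r') (pt q₁ c X r)

theorem pt_ne_zero {q₁ : ℂ} (h : q₁ ≠ 0) {c : R → ℂ} (hc : ∀ r, c r ≠ 0) (X : R → ℤ) (r : R) :
    pt q₁ c X r ≠ 0 := mul_ne_zero (zpow_ne_zero _ h) (hc r)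

/-- The sum equals its transpose, so twice the sum is a sum of zeros. -/
theorem sum_sum_eq_zero_of_antisymm {V : Type*} [AddCommGroup V] [Module ℂ V] {S : Finset R}
    {f : R → R → V} (h : ∀ r ∈ S, ∀ s ∈ S, f r s + f s r = 0) :
    ∑ r ∈ S, ∑ s ∈ S, f r s = 0 := by
  have h2 : (2 : ℂ) • ∑ r ∈ S, ∑ s ∈ S, f r s = 0 := by
    rw [two_smul]
    nth_rw 2 [Finset.sum_comm]
    simp only [← Finset.sum_add_distrib]
    exact Finset.sum_eq_zero fun r hr => Finset.sum_eq_zero fun s hs => h r hr s hs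
  exact (smul_eq_zero.1 h2).resolve_left two_ne_zero

/-- Six times the sum is the sum over its six reorderings. -/
theorem sum_sum_sum_eq_zero_of_antisymm {V : Type*} [AddCommGroup V] [Module ℂ V] {S : Finset R}
    {f : R → R → R → V}
    (h : ∀ r ∈ S, ∀ s ∈ S, ∀ t ∈ S,
      f r s t + f r t s + f s r t + f s t r + f t r s + f t s r = 0) :
    ∑ r ∈ S, ∑ s ∈ S, ∑ t ∈ S, f r s t = 0 := by
  have e1 : ∀ g : R → R → R → V, ∑ r ∈ S, ∑ s ∈ S, ∑ t ∈ S, g r s t =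
      ∑ r ∈ S, ∑ s ∈ S, ∑ t ∈ S, g r t s := fun g =>
    Finset.sum_congr rfl fun r _ => Finset.sum_comm
  have e2 : ∀ g : R → R → R → V, ∑ r ∈ S, ∑ s ∈ S, ∑ t ∈ S, g r s t =
      ∑ r ∈ S, ∑ s ∈ S, ∑ t ∈ S, g s r t := fun g => Finset.sum_comm
  have h6 : (6 : ℂ) • ∑ r ∈ S, ∑ s ∈ S, ∑ t ∈ S, f r s t = 0 := by
    have a1 := e1 f
    have a2 := e2 f
    have a3 := (e2 f).trans (e1 fun r s t => f s r t)
    have a4 := (e1 f).trans (e2 fun r s t => f r t s)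
    have a5 := a4.trans (e1 fun r s t => f s t r)
    have : (6 : ℂ) • ∑ r ∈ S, ∑ s ∈ S, ∑ t ∈ S, f r s t =
        ∑ r ∈ S, ∑ s ∈ S, ∑ t ∈ S,
          (f r s t + f r t s + f s r t + f s t r + f t r s + f t s r) := by
      simp only [Finset.sum_add_distrib]
      rw [← a1, ← a2, ← a3, ← a4, ← a5]
      module
    rw [this]
    exact Finset.sum_eq_zero fun r hr => Finset.sum_eq_zero fun s hs =>
      Finset.sum_eq_zero fun t ht => h r hr s hs t ht
  exact (smul_eq_zero.1 h6).resolve_left (by norm_num)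

variable [DecidableEq R]

theorem pt_add_single_self {q₁ : ℂ} (h : q₁ ≠ 0) (c : R → ℂ) (X : R → ℤ) (r : R) :
    pt q₁ c (X + Pi.single r 1) r = q₁ * pt q₁ c X r := by
  simp [pt, zpow_add₀ h]; ring

theorem pt_add_single_of_ne (q₁ : ℂ) (c : R → ℂ) (X : R → ℤ) {r s : R} (h : s ≠ r) :
    pt q₁ c (X + Pi.single r 1) s = pt q₁ c X s := by
  simp [pt, h]

variable {q₁ q₂ q₃ γ : ℂ} {c : R → ℂ} {lt : R → R → Prop} [DecidableRel lt] {τ : R → ℤ → ℂ}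

/-- Rows that do not move can be absorbed into the external factor. -/
theorem exists_coef_eq_coef (τ : R → ℤ → ℂ) {S M : Finset R} (hM : M ⊆ S) (X : R → ℤ) :
    ∃ θ : R → ℤ → ℂ, ∀ Z : R → ℤ, (∀ r ∉ M, Z r = X r) → ∀ r,
      coef q₁ q₂ q₃ c lt τ S Z r = coef q₁ q₂ q₃ c lt θ M Z r := by
  refine ⟨fun r x => τ r x * ∏ r' ∈ S \ M with lt r' r,
    phi q₁ q₂ q₃ (pt q₁ c X r') (q₁ ^ x * c r), fun Z hZ r => ?_⟩
  simp only [coef, Finset.prod_filter]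
  rw [← Finset.prod_sdiff hM, ← mul_assoc]
  congr 2
  refine Finset.prod_congr rfl fun r' hr' => ?_
  have : Z r' = X r' := hZ r' (Finset.mem_sdiff.1 hr').2
  simp [pt, this]

/-- After all other rows are absorbed, only `s` sees `r`. The two orders of raising then involve
`phi` at `q₁ p` and at `p`, which `gfun_mul_phi_mul_left` compares. -/
theorem exchange_of_lt (hq : q₁ * q₂ * q₃ = 1) (ho : IsRowOrder lt) {S : Finset R} {X : R → ℤ}
    {r s : R} (hr : r ∈ S) (hs : s ∈ S) (hrs : lt r s)
    (h1 : pt q₁ c X s ≠ q₁ * pt q₁ c X r) (h2 : q₁ * pt q₁ c X s ≠ pt q₁ c X r) :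
    coef q₁ q₂ q₃ c lt τ S X r * coef q₁ q₂ q₃ c lt τ S (X + Pi.single r 1) s *
        gfun q₁ q₂ q₃ (pt q₁ c X s) (pt q₁ c X r) +
      coef q₁ q₂ q₃ c lt τ S X s * coef q₁ q₂ q₃ c lt τ S (X + Pi.single s 1) r *
        gfun q₁ q₂ q₃ (pt q₁ c X r) (pt q₁ c X s) = 0 := by
  have h0 := ne_zero_left_of_prod hq
  have hne := ho.ne hrs
  obtain ⟨θ, hθ⟩ := exists_coef_eq_coef (q₁ := q₁) (q₂ := q₂) (q₃ := q₃) (c := c) (lt := lt) τ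
    (M := {r, s}) (S := S) (by simp [Finset.insert_subset_iff, hr, hs]) X
  rw [hθ X (by simp), hθ X (by simp), hθ (X + Pi.single r 1) (by simp +contextual),
    hθ (X + Pi.single s 1) (by simp +contextual)]
  simp only [coef, Finset.filter_insert, Finset.filter_singleton, hrs, ho.irrefl, ho.asymm hrs,
    if_true, if_false, Finset.prod_empty, insert_empty_eq, Finset.prod_singleton,
    pt_add_single_self h0, pt_add_single_of_ne q₁ c X hne, pt_add_single_of_ne q₁ c X hne.symm,
    Pi.add_apply, Pi.single_eq_of_ne hne, Pi.single_eq_of_ne hne.symm, add_zero]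
  have := gfun_mul_phi_mul_left hq h1 h2
  linear_combination (θ r (X r) * θ s (X s)) * this

/-- The function `k` only marks the allowed end states. If `r = s`, the second box has `q₁` times
the weight of the first one, where `g` vanishes. -/
theorem exchange {V : Type*} [Zero V] {k : (R → ℤ) → V} {S : Finset R} {X : R → ℤ}
    (hq : q₁ * q₂ * q₃ = 1) (ho : IsRowOrder lt)
    {r s : R} (hr : r ∈ S) (hs : s ∈ S)
    (hres : ∀ r s, lt r s → k (X + Pi.single r 1 + Pi.single s 1) ≠ 0 →
      pt q₁ c X s ≠ q₁ * pt q₁ c X r ∧ q₁ * pt q₁ c X s ≠ pt q₁ c X r)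
    (hk : k (X + Pi.single r 1 + Pi.single s 1) ≠ 0) :
    coef q₁ q₂ q₃ c lt τ S X r * coef q₁ q₂ q₃ c lt τ S (X + Pi.single r 1) s *
        gfun q₁ q₂ q₃ (pt q₁ c (X + Pi.single r 1) s) (pt q₁ c X r) +
      coef q₁ q₂ q₃ c lt τ S X s * coef q₁ q₂ q₃ c lt τ S (X + Pi.single s 1) r *
        gfun q₁ q₂ q₃ (pt q₁ c (X + Pi.single s 1) r) (pt q₁ c X s) = 0 := by
  have h0 := ne_zero_left_of_prod hq
  by_cases hrs : r = s
  · subst hrs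
    simp [pt_add_single_self h0, gfun_mul_left_self]
  rw [pt_add_single_of_ne _ _ _ hrs, pt_add_single_of_ne _ _ _ (Ne.symm hrs)]
  rcases ho.total hrs with h | h
  · exact exchange_of_lt hq ho hr hs h (hres r s h hk).1 (hres r s h hk).2
  · rw [add_right_comm] at hk
    rw [add_comm]
    exact exchange_of_lt hq ho hs hr h (hres s r h hk).1 (hres s r h hk).2

variable {V : Type*} [AddCommGroup V] [Module ℂ V]

/-- `e_j` raises single rows of the state `Z`, with coefficients `E Z r` and weights `w Z r`, and
the coefficients of the states that are not allowed vanish. -/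
structure Expands (e : ℤ → Module.End ℂ V) (k : (R → ℤ) → V) (E w : (R → ℤ) → R → ℂ)
    (S : Finset R) (Z : R → ℤ) : Prop where
  apply : ∀ j, e j (k Z) = ∑ r ∈ S, (E Z r * w Z r ^ j) • k (Z + Pi.single r 1)
  eq_zero : ∀ r ∈ S, k (Z + Pi.single r 1) = 0 → E Z r = 0

variable {e : ℤ → Module.End ℂ V} {k : (R → ℤ) → V} {E w : (R → ℤ) → R → ℂ} {S : Finset R}
  {X : R → ℤ}

/-- A forbidden intermediate state is entered with coefficient `0`, so it may stay in the double sum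
although the action on it is not known. This allows symmetrization over all paths. -/
theorem Expands.apply₂ (h0 : Expands e k E w S X)
    (h1 : ∀ r ∈ S, k (X + Pi.single r 1) ≠ 0 → Expands e k E w S (X + Pi.single r 1)) (i j : ℤ) :
    e i (e j (k X)) = ∑ r ∈ S, ∑ s ∈ S, (E X r * E (X + Pi.single r 1) s *
      (w X r ^ j * w (X + Pi.single r 1) s ^ i)) • k (X + Pi.single r 1 + Pi.single s 1) := by
  rw [h0.apply, map_sum]
  refine Finset.sum_congr rfl fun r hr => ?_
  by_cases hz : k (X + Pi.single r 1) = 0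
  · simp [hz, h0.eq_zero r hr hz]
  · rw [map_smul, (h1 r hr hz).apply, Finset.smul_sum]
    refine Finset.sum_congr rfl fun s _ => ?_
    rw [smul_smul]; congr 1; ring

theorem Expands.apply₃ (h0 : Expands e k E w S X)
    (h1 : ∀ r ∈ S, k (X + Pi.single r 1) ≠ 0 → Expands e k E w S (X + Pi.single r 1))
    (h2 : ∀ r ∈ S, ∀ s ∈ S, k (X + Pi.single r 1 + Pi.single s 1) ≠ 0 →
      Expands e k E w S (X + Pi.single r 1 + Pi.single s 1)) (h i j : ℤ) :
    e h (e i (e j (k X))) = ∑ r ∈ S, ∑ s ∈ S, ∑ t ∈ S,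
      (E X r * E (X + Pi.single r 1) s * E (X + Pi.single r 1 + Pi.single s 1) t *
        (w X r ^ j * w (X + Pi.single r 1) s ^ i *
          w (X + Pi.single r 1 + Pi.single s 1) t ^ h)) •
        k (X + Pi.single r 1 + Pi.single s 1 + Pi.single t 1) := by
  rw [h0.apply, map_sum, map_sum]
  refine Finset.sum_congr rfl fun r hr => ?_
  by_cases hz : k (X + Pi.single r 1) = 0
  · simp [hz, h0.eq_zero r hr hz]
  · rw [map_smul, map_smul, (h1 r hr hz).apply₂ (h2 r hr), Finset.smul_sum]
    refine Finset.sum_congr rfl fun s _ => ?_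
    rw [Finset.smul_sum]
    refine Finset.sum_congr rfl fun t _ => ?_
    rw [smul_smul]; congr 1; ring

section Distributions

variable {A : Type*} [Ring A] [Algebra ℂ A]

theorem mulGzw_eq (hq : q₁ * q₂ * q₃ = 1) (Y : ℤ → ℤ → A) (i j : ℤ) :
    mulGzw q₁ q₂ q₃ Y i j = Y (i + 3) j - (q₁ + q₂ + q₃) • Y (i + 2) (j + 1)
      + (q₁ * q₂ + q₁ * q₃ + q₂ * q₃) • Y (i + 1) (j + 2) - Y i (j + 3) := by
  have e : Y i (j + 3) = (q₁ * q₂ * q₃) • Y i (j + 3) := by rw [hq, one_smul]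
  rw [e]
  simp only [mulGzw, mulZsubW, add_assoc]
  norm_num
  module

theorem mulGwz_eq (hq : q₁ * q₂ * q₃ = 1) (Y : ℤ → ℤ → A) (i j : ℤ) :
    mulGwz q₁ q₂ q₃ Y i j = Y i (j + 3) - (q₁ + q₂ + q₃) • Y (i + 1) (j + 2)
      + (q₁ * q₂ + q₁ * q₃ + q₂ * q₃) • Y (i + 2) (j + 1) - Y (i + 3) j := by
  have e : Y (i + 3) j = (q₁ * q₂ * q₃) • Y (i + 3) j := by rw [hq, one_smul]
  rw [e]
  simp only [mulGwz, mulWsubZ, add_assoc]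
  norm_num
  module

end Distributions

/-- On the modes of a product of delta functions supported at `z` and `w`, multiplication by `g` is
multiplication by the number `g(z, w)`. -/
theorem gfun_mul_zpow (hq : q₁ * q₂ * q₃ = 1) {z w : ℂ} (hz : z ≠ 0) (hw : w ≠ 0) (i j : ℤ) :
    z ^ (i + 3) * w ^ j - (q₁ + q₂ + q₃) * (z ^ (i + 2) * w ^ (j + 1))
      + (q₁ * q₂ + q₁ * q₃ + q₂ * q₃) * (z ^ (i + 1) * w ^ (j + 2)) - z ^ i * w ^ (j + 3) =
    gfun q₁ q₂ q₃ z w * (z ^ i * w ^ j) := by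
  rw [gfun_eq hq]
  simp only [zpow_add₀ hz, zpow_add₀ hw]
  norm_cast
  ring

/-- The quadratic relation for raising operators. -/
theorem quadratic_relation (hq : q₁ * q₂ * q₃ = 1) (ho : IsRowOrder lt) (hγ : γ ≠ 0)
    (hc : ∀ r, c r ≠ 0)
    (h0 : Expands e k (coef q₁ q₂ q₃ c lt τ S) (fun X r => γ * pt q₁ c X r) S X)
    (h1 : ∀ r ∈ S, k (X + Pi.single r 1) ≠ 0 →
      Expands e k (coef q₁ q₂ q₃ c lt τ S) (fun X r => γ * pt q₁ c X r) S (X + Pi.single r 1))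
    (hres : ∀ r s, lt r s → k (X + Pi.single r 1 + Pi.single s 1) ≠ 0 →
      pt q₁ c X s ≠ q₁ * pt q₁ c X r ∧ q₁ * pt q₁ c X s ≠ pt q₁ c X r) (i j : ℤ) :
    mulGzw q₁ q₂ q₃ (prodZW e e) i j (k X) = -mulGwz q₁ q₂ q₃ (prodWZ e e) i j (k X) := by
  have hq0 := ne_zero_left_of_prod hq
  rw [eq_neg_iff_add_eq_zero, mulGzw_eq hq, mulGwz_eq hq]
  simp only [prodZW, prodWZ, LinearMap.add_apply, LinearMap.sub_apply, LinearMap.smul_apply,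
    Module.End.mul_apply, h0.apply₂ h1]
  simp only [Finset.smul_sum, ← Finset.sum_sub_distrib, ← Finset.sum_add_distrib, smul_smul,
    ← sub_smul, ← add_smul]
  -- The paths `r, s` and `s, r` have the same end, so their contributions are paired.
  refine sum_sum_eq_zero_of_antisymm fun r hr s hs => ?_
  rw [add_right_comm X (Pi.single s 1) (Pi.single r 1), ← add_smul]
  by_cases hk : k (X + Pi.single r 1 + Pi.single s 1) = 0
  · rw [hk, smul_zero]
  have hp : ∀ Z r, γ * pt q₁ c Z r ≠ 0 := fun Z r => mul_ne_zero hγ (pt_ne_zero hq0 hc Z r)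
  have key := exchange (τ := τ) hq ho hr hs hres hk
  have hg : ∀ z w, gfun q₁ q₂ q₃ (γ * z) (γ * w) = γ ^ 3 * gfun q₁ q₂ q₃ z w :=
    fun z w => gfun_mul_mul γ z w
  convert zero_smul ℂ _ using 2
  have e1 := gfun_mul_zpow hq (hp (X + Pi.single r 1) s) (hp X r) i j
  have e2 := gfun_mul_zpow hq (hp (X + Pi.single r 1) s) (hp X r) j i
  have e3 := gfun_mul_zpow hq (hp (X + Pi.single s 1) r) (hp X s) i j
  have e4 := gfun_mul_zpow hq (hp (X + Pi.single s 1) r) (hp X s) j i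
  rw [hg] at e1 e2 e3 e4
  set A := coef q₁ q₂ q₃ c lt τ S X r * coef q₁ q₂ q₃ c lt τ S (X + Pi.single r 1) s
  set B := coef q₁ q₂ q₃ c lt τ S X s * coef q₁ q₂ q₃ c lt τ S (X + Pi.single s 1) r
  have hsum : A * gfun q₁ q₂ q₃ (pt q₁ c (X + Pi.single r 1) s) (pt q₁ c X r) *
        ((γ * pt q₁ c (X + Pi.single r 1) s) ^ i * (γ * pt q₁ c X r) ^ j +
          (γ * pt q₁ c (X + Pi.single r 1) s) ^ j * (γ * pt q₁ c X r) ^ i) +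
      B * gfun q₁ q₂ q₃ (pt q₁ c (X + Pi.single s 1) r) (pt q₁ c X s) *
        ((γ * pt q₁ c (X + Pi.single s 1) r) ^ i * (γ * pt q₁ c X s) ^ j +
          (γ * pt q₁ c (X + Pi.single s 1) r) ^ j * (γ * pt q₁ c X s) ^ i) = 0 := by
    by_cases hrs : r = s
    · subst hrs
      simp [pt_add_single_self hq0, gfun_mul_left_self]
    · rw [pt_add_single_of_ne _ _ _ hrs, pt_add_single_of_ne _ _ _ (Ne.symm hrs)] at key ⊢
      linear_combination ((γ * pt q₁ c X s) ^ i * (γ * pt q₁ c X r) ^ j +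
          (γ * pt q₁ c X s) ^ j * (γ * pt q₁ c X r) ^ i) * key
  linear_combination A * (e1 + e2) + B * (e3 + e4) + γ ^ 3 * hsum

/-- The contribution of the path that raises the rows `r`, `s`, `t` of `X`, in this order. -/
def serreTerm (q₁ q₂ q₃ : ℂ) (c : R → ℂ) (lt : R → R → Prop) [DecidableRel lt]
    (τ : R → ℤ → ℂ) (S : Finset R) (X : R → ℤ) (r s t : R) : ℂ :=
  coef q₁ q₂ q₃ c lt τ S X r * coef q₁ q₂ q₃ c lt τ S (X + Pi.single r 1) s *
    coef q₁ q₂ q₃ c lt τ S (X + Pi.single r 1 + Pi.single s 1) t *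
    serreWeight (pt q₁ c X r) (pt q₁ c (X + Pi.single r 1) s)
      (pt q₁ c (X + Pi.single r 1 + Pi.single s 1) t)

/-- Of the conditions in `hres` only `m = 1` and `m = -1` are used, for the three pairs of rows; the
rest is absorbed into `θ`. -/
theorem serreTerm_three (hq : q₁ * q₂ * q₃ = 1) (ho : IsRowOrder lt) (hc : ∀ r, c r ≠ 0)
    {r s t : R} (hr : r ∈ S) (hs : s ∈ S) (ht : t ∈ S) (hrs : lt r s) (hst : lt s t)
    (hres : ∀ r' s', lt r' s' → ∀ m : ℤ,
      m ≤ (Pi.single r 1 + Pi.single s 1 + Pi.single t 1 : R → ℤ) s' →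
        pt q₁ c X r' ≠ q₁ ^ m * pt q₁ c X s') :
    let T := serreTerm q₁ q₂ q₃ c lt τ S X
    T r s t + T r t s + T s r t + T s t r + T t r s + T t s r = 0 := by
  have h0 := ne_zero_left_of_prod hq
  have hrt := ho.trans hrs hst
  have n1 := ho.ne hrs
  have n2 := ho.ne hst
  have n3 := ho.ne hrt
  obtain ⟨θ, hθ⟩ := exists_coef_eq_coef (q₁ := q₁) (q₂ := q₂) (q₃ := q₃) (c := c) (lt := lt) τ
    (M := {r, s, t}) (S := S) (by simp [Finset.insert_subset_iff, hr, hs, ht]) X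
  have e0 : ∀ x, coef q₁ q₂ q₃ c lt τ S X x = coef q₁ q₂ q₃ c lt θ {r, s, t} X x :=
    hθ X (by simp)
  have e1 : ∀ x ∈ ({r, s, t} : Finset R), ∀ y, coef q₁ q₂ q₃ c lt τ S (X + Pi.single x 1) y =
      coef q₁ q₂ q₃ c lt θ {r, s, t} (X + Pi.single x 1) y := fun x hx => hθ _ fun z hz => by
    have : z ≠ x := fun h => hz (h ▸ hx)
    simp [this]
  have e2 : ∀ x ∈ ({r, s, t} : Finset R), ∀ y ∈ ({r, s, t} : Finset R), ∀ w,
      coef q₁ q₂ q₃ c lt τ S (X + Pi.single x 1 + Pi.single y 1) w =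
        coef q₁ q₂ q₃ c lt θ {r, s, t} (X + Pi.single x 1 + Pi.single y 1) w :=
    fun x hx y hy => hθ _ fun z hz => by
      have h1 : z ≠ x := fun h => hz (h ▸ hx)
      have h2 : z ≠ y := fun h => hz (h ▸ hy)
      simp [h1, h2]
  have mr : r ∈ ({r, s, t} : Finset R) := by simp
  have ms : s ∈ ({r, s, t} : Finset R) := by simp
  have mt : t ∈ ({r, s, t} : Finset R) := by simp
  have key := serre_phi_three hq (pt_ne_zero h0 hc X r) (pt_ne_zero h0 hc X s)
    (pt_ne_zero h0 hc X t)
    (fun h => hres r s hrs (-1) (by simp [n1.symm, n2]) (by rw [h]; simp [h0]))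
    (fun h => hres r s hrs 1 (by simp [n1.symm, n2]) (by rw [← h, zpow_one]))
    (fun h => hres r t hrt (-1) (by simp [n3.symm, n2.symm]) (by rw [h]; simp [h0]))
    (fun h => hres r t hrt 1 (by simp [n3.symm, n2.symm]) (by rw [← h, zpow_one]))
    (fun h => hres s t hst (-1) (by simp [n3.symm, n2.symm]) (by rw [h]; simp [h0]))
    (fun h => hres s t hst 1 (by simp [n3.symm, n2.symm]) (by rw [← h, zpow_one]))
  intro T
  simp only [T, serreTerm, e0, e1 _ mr, e1 _ ms, e1 _ mt, e2 _ mr _ ms, e2 _ mr _ mt, e2 _ ms _ mr,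
    e2 _ ms _ mt, e2 _ mt _ mr, e2 _ mt _ ms]
  simp only [coef, Finset.filter_insert, Finset.filter_singleton, hrs, hst, hrt, ho.irrefl,
    ho.asymm hrs, ho.asymm hst, ho.asymm hrt,
    if_true, if_false, Finset.prod_empty, insert_empty_eq, Finset.prod_singleton,
    Finset.prod_pair n1, 
    pt_add_single_self h0, pt_add_single_of_ne q₁ c _ n1, pt_add_single_of_ne q₁ c _ n1.symm,
    pt_add_single_of_ne q₁ c _ n2, pt_add_single_of_ne q₁ c _ n2.symm,
    pt_add_single_of_ne q₁ c _ n3, pt_add_single_of_ne q₁ c _ n3.symm,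
    Pi.add_apply, Pi.single_eq_of_ne n1, Pi.single_eq_of_ne n1.symm, Pi.single_eq_of_ne n2,
    Pi.single_eq_of_ne n2.symm, Pi.single_eq_of_ne n3, Pi.single_eq_of_ne n3.symm, add_zero]
  linear_combination (θ r (X r) * θ s (X s) * θ t (X t)) * key

/-- The identity depends on whether the row that is raised twice comes first (`serre_phi_two_one`)
or last (`serre_phi_one_two`). Exponents up to `2` occur only in the second case, where the later
row moves twice. -/
theorem serreTerm_two (hq : q₁ * q₂ * q₃ = 1) (ho : IsRowOrder lt) (hc : ∀ r, c r ≠ 0)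
    {r s : R} (hr : r ∈ S) (hs : s ∈ S) (hne : r ≠ s)
    (hres : ∀ r' s', lt r' s' → ∀ m : ℤ,
      m ≤ (Pi.single r 1 + Pi.single r 1 + Pi.single s 1 : R → ℤ) s' →
        pt q₁ c X r' ≠ q₁ ^ m * pt q₁ c X s') :
    let T := serreTerm q₁ q₂ q₃ c lt τ S X
    T r r s + T r s r + T s r r = 0 := by
  have h0 := ne_zero_left_of_prod hq
  obtain ⟨θ, hθ⟩ := exists_coef_eq_coef (q₁ := q₁) (q₂ := q₂) (q₃ := q₃) (c := c) (lt := lt) τ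
    (M := {r, s}) (S := S) (by simp [Finset.insert_subset_iff, hr, hs]) X
  have e0 : ∀ x, coef q₁ q₂ q₃ c lt τ S X x = coef q₁ q₂ q₃ c lt θ {r, s} X x :=
    hθ X (by simp)
  have e1 : ∀ x ∈ ({r, s} : Finset R), ∀ y, coef q₁ q₂ q₃ c lt τ S (X + Pi.single x 1) y =
      coef q₁ q₂ q₃ c lt θ {r, s} (X + Pi.single x 1) y := fun x hx => hθ _ fun z hz => by
    have : z ≠ x := fun h => hz (h ▸ hx)
    simp [this]
  have e2 : ∀ x ∈ ({r, s} : Finset R), ∀ y ∈ ({r, s} : Finset R), ∀ w,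
      coef q₁ q₂ q₃ c lt τ S (X + Pi.single x 1 + Pi.single y 1) w =
        coef q₁ q₂ q₃ c lt θ {r, s} (X + Pi.single x 1 + Pi.single y 1) w :=
    fun x hx y hy => hθ _ fun z hz => by
      have h1 : z ≠ x := fun h => hz (h ▸ hx)
      have h2 : z ≠ y := fun h => hz (h ▸ hy)
      simp [h1, h2]
  have mr : r ∈ ({r, s} : Finset R) := by simp
  have ms : s ∈ ({r, s} : Finset R) := by simp
  intro T
  simp only [T, serreTerm, e0, e1 _ mr, e1 _ ms, e2 _ mr _ ms, e2 _ ms _ mr, e2 _ mr _ mr]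
  have hpr := pt_ne_zero h0 hc X r
  have hps := pt_ne_zero h0 hc X s
  rcases ho.total hne with hrs | hrs
  · have key := serre_phi_two_one hq hpr hps
      (fun h => hres r s hrs 0 (by simp [hne.symm]) (by rw [h]; simp))
      (fun h => hres r s hrs 1 (by simp [hne.symm]) (by rw [← h, zpow_one]))
      (fun h => hres r s hrs (-1) (by simp [hne.symm]) (by rw [h]; simp [h0]))
      (fun h => hres r s hrs (-2) (by simp [hne.symm]) (by rw [h]; field_simp))
    simp only [coef, Finset.filter_insert, Finset.filter_singleton, hrs, ho.irrefl,
      ho.asymm hrs, if_true, if_false, Finset.prod_empty, insert_empty_eq, Finset.prod_singleton,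
      pt_add_single_self h0, pt_add_single_of_ne q₁ c _ hne, pt_add_single_of_ne q₁ c _ hne.symm,
      Pi.add_apply, Pi.single_eq_of_ne hne, Pi.single_eq_of_ne hne.symm, Pi.single_eq_same,
      add_zero]
    linear_combination (θ r (X r) * θ r (X r + 1) * θ s (X s)) * key
  · have key := serre_phi_one_two hq hps hpr
      (fun h => hres s r hrs 0 (by simp [hne]) (by rw [h]; simp))
      (fun h => hres s r hrs 1 (by simp [hne]) (by rw [← h, zpow_one]))
      (fun h => hres s r hrs (-1) (by simp [hne]) (by rw [h]; simp [h0]))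
      (fun h => hres s r hrs 2 (by simp [hne]) (by rw [← h, zpow_ofNat]; ring))
    simp only [coef, Finset.filter_insert, Finset.filter_singleton, hrs, ho.irrefl,
      ho.asymm hrs, if_true, if_false, Finset.prod_empty, insert_empty_eq, Finset.prod_singleton,
      pt_add_single_self h0, pt_add_single_of_ne q₁ c _ hne, pt_add_single_of_ne q₁ c _ hne.symm,
      Pi.add_apply, Pi.single_eq_of_ne hne, Pi.single_eq_of_ne hne.symm, Pi.single_eq_same,
      add_zero]
    linear_combination (θ r (X r) * θ r (X r + 1) * θ s (X s)) * key

theorem serreTerm_sum (hq : q₁ * q₂ * q₃ = 1) (ho : IsRowOrder lt) (hc : ∀ r, c r ≠ 0)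
    {r s t : R} (hr : r ∈ S) (hs : s ∈ S) (ht : t ∈ S)
    (hres : ∀ r' s', lt r' s' → ∀ m : ℤ,
      m ≤ (Pi.single r 1 + Pi.single s 1 + Pi.single t 1 : R → ℤ) s' →
        pt q₁ c X r' ≠ q₁ ^ m * pt q₁ c X s') :
    let T := serreTerm q₁ q₂ q₃ c lt τ S X
    T r s t + T r t s + T s r t + T s t r + T t r s + T t s r = 0 := by
  have h0 := ne_zero_left_of_prod hq
  intro T
  have a1 : (Pi.single r 1 + Pi.single s 1 + Pi.single t 1 : R → ℤ) =
    Pi.single r 1 + Pi.single t 1 + Pi.single s 1 := by abel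
  have a2 : (Pi.single r 1 + Pi.single s 1 + Pi.single t 1 : R → ℤ) =
    Pi.single s 1 + Pi.single r 1 + Pi.single t 1 := by abel
  have a3 : (Pi.single r 1 + Pi.single s 1 + Pi.single t 1 : R → ℤ) =
    Pi.single s 1 + Pi.single t 1 + Pi.single r 1 := by abel
  have a4 : (Pi.single r 1 + Pi.single s 1 + Pi.single t 1 : R → ℤ) =
    Pi.single t 1 + Pi.single r 1 + Pi.single s 1 := by abel
  have a5 : (Pi.single r 1 + Pi.single s 1 + Pi.single t 1 : R → ℤ) =
    Pi.single t 1 + Pi.single s 1 + Pi.single r 1 := by abel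
  by_cases hrs : r = s
  · subst hrs
    by_cases hrt : r = t
    · subst hrt
      have : T r r r = 0 := by
        simp only [T, serreTerm, pt_add_single_self h0,
          serreWeight_self_three h0 (pt_ne_zero h0 hc X r), mul_zero]
      simp only [this, add_zero]
    -- With one repeated row, each of the three distinct orders occurs twice among the six.
    · linear_combination 2 * serreTerm_two (τ := τ) hq ho hc hr ht hrt hres
  by_cases hrt : r = t
  · subst hrt
    linear_combination 2 * serreTerm_two (τ := τ) hq ho hc hr hs hrs (a1 ▸ hres)
  by_cases hst : s = t
  · subst hst
    linear_combination 2 * serreTerm_two (τ := τ) hq ho hc hs hr (Ne.symm hrs) (a3 ▸ hres)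
  rcases ho.total hrs with h1 | h1 <;> rcases ho.total hrt with h2 | h2 <;>
    rcases ho.total hst with h3 | h3
  · exact serreTerm_three hq ho hc hr hs ht h1 h3 hres
  · linear_combination serreTerm_three (τ := τ) hq ho hc hr ht hs h2 h3 (a1 ▸ hres)
  · exact absurd (ho.trans h1 h3) (ho.asymm h2)
  · linear_combination serreTerm_three (τ := τ) hq ho hc ht hr hs h2 h1 (a4 ▸ hres)
  · linear_combination serreTerm_three (τ := τ) hq ho hc hs hr ht h1 h2 (a2 ▸ hres)
  · exact absurd (ho.trans h3 h1) (ho.asymm h2)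
  · linear_combination serreTerm_three (τ := τ) hq ho hc hs ht hr h3 h2 (a3 ▸ hres)
  · linear_combination serreTerm_three (τ := τ) hq ho hc ht hs hr h3 h1 (a5 ▸ hres)

/-- The Serre relation for raising operators. -/
theorem serre_relation (hq : q₁ * q₂ * q₃ = 1) (ho : IsRowOrder lt) (hγ : γ ≠ 0)
    (hc : ∀ r, c r ≠ 0)
    (h0 : Expands e k (coef q₁ q₂ q₃ c lt τ S) (fun X r => γ * pt q₁ c X r) S X)
    (h1 : ∀ r ∈ S, k (X + Pi.single r 1) ≠ 0 →
      Expands e k (coef q₁ q₂ q₃ c lt τ S) (fun X r => γ * pt q₁ c X r) S (X + Pi.single r 1))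
    (h2 : ∀ r ∈ S, ∀ s ∈ S, k (X + Pi.single r 1 + Pi.single s 1) ≠ 0 →
      Expands e k (coef q₁ q₂ q₃ c lt τ S) (fun X r => γ * pt q₁ c X r) S
        (X + Pi.single r 1 + Pi.single s 1))
    (hres : ∀ r s t, k (X + Pi.single r 1 + Pi.single s 1 + Pi.single t 1) ≠ 0 →
      ∀ r' s', lt r' s' → ∀ m : ℤ,
        m ≤ (Pi.single r 1 + Pi.single s 1 + Pi.single t 1 : R → ℤ) s' →
          pt q₁ c X r' ≠ q₁ ^ m * pt q₁ c X s') :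
    ⁅e 0, ⁅e 1, e (-1)⁆⁆ (k X) = 0 := by
  have hq0 := ne_zero_left_of_prod hq
  have hp : ∀ Z r, γ * pt q₁ c Z r ≠ 0 := fun Z r => mul_ne_zero hγ (pt_ne_zero hq0 hc Z r)
  simp only [Ring.lie_def, mul_sub, sub_mul, LinearMap.sub_apply, Module.End.mul_apply,
    h0.apply₃ h1 h2]
  simp only [← Finset.sum_sub_distrib, ← sub_smul]
  refine sum_sum_sum_eq_zero_of_antisymm fun r hr s hs t ht => ?_
  set Y := X + Pi.single r 1 + Pi.single s 1 + Pi.single t 1 with hY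
  rw [show X + Pi.single r 1 + Pi.single t 1 + Pi.single s 1 = Y by rw [hY]; abel,
    show X + Pi.single s 1 + Pi.single r 1 + Pi.single t 1 = Y by rw [hY]; abel,
    show X + Pi.single s 1 + Pi.single t 1 + Pi.single r 1 = Y by rw [hY]; abel,
    show X + Pi.single t 1 + Pi.single r 1 + Pi.single s 1 = Y by rw [hY]; abel,
    show X + Pi.single t 1 + Pi.single s 1 + Pi.single r 1 = Y by rw [hY]; abel]
  by_cases hk : k Y = 0
  · simp [hk]
  simp only [← add_smul]
  convert zero_smul ℂ _ using 2
  rw [← serreTerm_sum (τ := τ) hq ho hc hr hs ht (hres r s t hk)]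
  have hw : ∀ x y z : ℂ, x ≠ 0 → y ≠ 0 → z ≠ 0 →
      (γ * x) ^ (-1 : ℤ) * (γ * y) ^ (1 : ℤ) * (γ * z) ^ (0 : ℤ)
        - (γ * x) ^ (1 : ℤ) * (γ * y) ^ (-1 : ℤ) * (γ * z) ^ (0 : ℤ)
        - ((γ * x) ^ (0 : ℤ) * (γ * y) ^ (-1 : ℤ) * (γ * z) ^ (1 : ℤ)
        - (γ * x) ^ (0 : ℤ) * (γ * y) ^ (1 : ℤ) * (γ * z) ^ (-1 : ℤ)) = serreWeight x y z := by
    intro x y z hx hy hz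
    simp only [serreWeight, zpow_neg_one, zpow_one, zpow_zero]
    field_simp
    ring
  have hp' := fun Z r => pt_ne_zero hq0 hc Z r
  simp only [serreTerm]
  rw [← hw _ _ _ (hp' _ _) (hp' _ _) (hp' _ _)]
  rw [← hw _ _ _ (hp' _ _) (hp' _ _) (hp' _ _)]
  rw [← hw _ _ _ (hp' _ _) (hp' _ _) (hp' _ _)]
  rw [← hw _ _ _ (hp' _ _) (hp' _ _) (hp' _ _)]
  rw [← hw _ _ _ (hp' _ _) (hp' _ _) (hp' _ _)]
  rw [← hw _ _ _ (hp' _ _) (hp' _ _) (hp' _ _)]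
  ring

end Rows

theorem pt_inv_neg {R : Type*} (q₁ : ℂ) (c : R → ℂ) (X : R → ℤ) (r : R) :
    pt q₁⁻¹ c (-X) r = pt q₁ c X r := by
  simp [pt]

/-! ### Lowering operators and their commutator with raising operators. -/

section Lowering

variable {R : Type*} [DecidableEq R] {q₁ q₂ q₃ : ℂ} {c : R → ℂ} {lt : R → R → Prop}
  [DecidableRel lt] {τ : R → ℤ → ℂ} {V : Type*} [AddCommGroup V] [Module ℂ V]
  {e f : ℤ → Module.End ℂ V} {k : (R → ℤ) → V} {E F w : (R → ℤ) → R → ℂ} {S : Finset R}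
  {X : R → ℤ}

/-- `f_j` lowers single rows of the state `Z`. -/
structure ExpandsLow (f : ℤ → Module.End ℂ V) (k : (R → ℤ) → V) (F w : (R → ℤ) → R → ℂ)
    (S : Finset R) (Z : R → ℤ) : Prop where
  apply : ∀ j, f j (k Z) = ∑ r ∈ S,
    (F (Z - Pi.single r 1) r * w (Z - Pi.single r 1) r ^ j) • k (Z - Pi.single r 1)
  eq_zero : ∀ r ∈ S, k (Z - Pi.single r 1) = 0 → F (Z - Pi.single r 1) r = 0

/-- Inverse parameters evaluate the same function at `q₁⁻¹ z`: this is the weight of the last box of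
a row, which lowering removes, instead of the next box. -/
theorem phi_inv (hq : q₁ * q₂ * q₃ = 1) (p z : ℂ) :
    phi q₁⁻¹ q₂⁻¹ q₃⁻¹ p z = phi q₁ q₂ q₃ p (q₁⁻¹ * z) := by
  have h1 := ne_zero_left_of_prod hq
  have h2 := ne_zero_mid_of_prod hq
  have h3 := ne_zero_right_of_prod hq
  have e3 : q₃⁻¹ = q₁ * q₂ := by field_simp; linear_combination -hq
  have e2 : q₂⁻¹ = q₁ * q₃ := by field_simp; linear_combination -hq
  unfold phi
  rw [e2, e3, inv_inv]
  rw [show (q₁⁻¹ * z - q₃ * p) * (q₁⁻¹ * z - q₂ * p) =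
      (q₁⁻¹ * q₁⁻¹) * ((z - q₁ * q₂ * p) * (z - q₁ * q₃ * p)) by field_simp,
    show (q₁⁻¹ * z - p) * (q₁⁻¹ * z - q₁⁻¹ * p) =
      (q₁⁻¹ * q₁⁻¹) * ((z - p) * (z - q₁ * p)) by field_simp,
    mul_div_mul_left _ _ (mul_ne_zero (inv_ne_zero h1) (inv_ne_zero h1))]

theorem pt_sub_single_self (h : q₁ ≠ 0) (c : R → ℂ) (X : R → ℤ) (r : R) :
    pt q₁ c (X - Pi.single r 1) r = q₁⁻¹ * pt q₁ c X r := by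
  simp [pt, zpow_sub₀ h]; ring

theorem pt_sub_single_of_ne (q₁ : ℂ) (c : R → ℂ) (X : R → ℤ) {r s : R} (h : s ≠ r) :
    pt q₁ c (X - Pi.single r 1) s = pt q₁ c X s := by
  simp [pt, h]

/-- Lowering is raising for the inverse parameters and reflected states. -/
theorem coef_inv_neg (hq : q₁ * q₂ * q₃ = 1) (ho : IsRowOrder lt) (r : R) :
    coef q₁⁻¹ q₂⁻¹ q₃⁻¹ c lt (fun r x => τ r (-x - 1)) S (-X) r =
      coef q₁ q₂ q₃ c lt τ S (X - Pi.single r 1) r := by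
  simp only [coef, pt_inv_neg, phi_inv hq, Pi.neg_apply, neg_neg, Pi.sub_apply, Pi.single_eq_same]
  congr 1
  refine Finset.prod_congr rfl fun r' hr' => ?_
  rw [pt_sub_single_self (ne_zero_left_of_prod hq),
    pt_sub_single_of_ne _ _ _ (ho.ne (Finset.mem_filter.1 hr').2)]

/-- The factor `q₁⁻¹` between the weights of the last and of the next box of a row is the reason for
the parameter `γ` in the relations for raising operators. -/
theorem ExpandsLow.expands (hq : q₁ * q₂ * q₃ = 1) (ho : IsRowOrder lt)
    (h : ExpandsLow f k (coef q₁ q₂ q₃ c lt τ S) (pt q₁ c) S X) :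
    Expands f (fun Z => k (-Z)) (coef q₁⁻¹ q₂⁻¹ q₃⁻¹ c lt (fun r x => τ r (-x - 1)) S)
      (fun Z r => q₁⁻¹ * pt q₁⁻¹ c Z r) S (-X) := by
  have e : ∀ r, -(-X + Pi.single r 1) = X - Pi.single r 1 := fun r => by abel
  refine ⟨fun j => ?_, fun r hr => ?_⟩
  · simp only [neg_neg, h.apply, coef_inv_neg hq ho, pt_inv_neg, e,
      pt_sub_single_self (ne_zero_left_of_prod hq)]
  · simp only [coef_inv_neg hq ho, e]
    exact h.eq_zero r hr

section Distributions

variable {A : Type*} [Ring A] [Algebra ℂ A]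

/-- As `q₁ q₂ q₃ = 1`, inverting the parameters exchanges their first two elementary symmetric
functions, which turns `g(z, w)` into `-g(w, z)`. -/
theorem mulGzw_inv (hq : q₁ * q₂ * q₃ = 1) (Y : ℤ → ℤ → A) (i j : ℤ) :
    mulGzw q₁⁻¹ q₂⁻¹ q₃⁻¹ Y i j = -mulGwz q₁ q₂ q₃ Y i j := by
  have h1 := ne_zero_left_of_prod hq
  have h2 := ne_zero_mid_of_prod hq
  have hq' : q₁⁻¹ * q₂⁻¹ * q₃⁻¹ = 1 := by rw [← mul_inv, ← mul_inv, hq, inv_one]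
  have e3 : q₃ = (q₁ * q₂)⁻¹ := eq_inv_of_mul_eq_one_right hq
  have s1 : q₁⁻¹ + q₂⁻¹ + q₃⁻¹ = q₁ * q₂ + q₁ * q₃ + q₂ * q₃ := by
    rw [e3]; field_simp; ring
  have s2 : q₁⁻¹ * q₂⁻¹ + q₁⁻¹ * q₃⁻¹ + q₂⁻¹ * q₃⁻¹ = q₁ + q₂ + q₃ := by
    rw [e3]; field_simp; ring
  rw [mulGzw_eq hq', mulGwz_eq hq, s1, s2]
  abel

theorem mulGwz_inv (hq : q₁ * q₂ * q₃ = 1) (Y : ℤ → ℤ → A) (i j : ℤ) :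
    mulGwz q₁⁻¹ q₂⁻¹ q₃⁻¹ Y i j = -mulGzw q₁ q₂ q₃ Y i j := by
  have hq' : q₁⁻¹ * q₂⁻¹ * q₃⁻¹ = 1 := by rw [← mul_inv, ← mul_inv, hq, inv_one]
  have := mulGzw_inv hq' Y i j
  rw [inv_inv, inv_inv, inv_inv] at this
  rw [this, neg_neg]

end Distributions

/-- The quadratic relation for lowering operators. -/
theorem quadratic_relation_low (hq : q₁ * q₂ * q₃ = 1) (ho : IsRowOrder lt)
    (hc : ∀ r, c r ≠ 0)
    (h0 : ExpandsLow f k (coef q₁ q₂ q₃ c lt τ S) (pt q₁ c) S X)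
    (h1 : ∀ r ∈ S, k (X - Pi.single r 1) ≠ 0 →
      ExpandsLow f k (coef q₁ q₂ q₃ c lt τ S) (pt q₁ c) S (X - Pi.single r 1))
    (hres : ∀ r s, lt r s → k (X - Pi.single r 1 - Pi.single s 1) ≠ 0 →
      pt q₁ c X r ≠ q₁ * pt q₁ c X s ∧ q₁ * pt q₁ c X r ≠ pt q₁ c X s) (i j : ℤ) :
    mulGwz q₁ q₂ q₃ (prodZW f f) i j (k X) = -mulGzw q₁ q₂ q₃ (prodWZ f f) i j (k X) := by
  have hq0 := ne_zero_left_of_prod hq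
  have hq' : q₁⁻¹ * q₂⁻¹ * q₃⁻¹ = 1 := by rw [← mul_inv, ← mul_inv, hq, inv_one]
  have e : ∀ r, -(-X + Pi.single r 1) = X - Pi.single r 1 := fun r => by abel
  have e' : ∀ r s, -(-X + Pi.single r 1 + Pi.single s 1) = X - Pi.single r 1 - Pi.single s 1 :=
    fun r s => by abel
  have := quadratic_relation (k := fun Z => k (-Z)) hq' ho (inv_ne_zero hq0) hc
    (h0.expands hq ho) (fun r hr hk => by
      rw [e] at hk
      have := (h1 r hr hk).expands hq ho
      rwa [show -(X - Pi.single r 1) = -X + Pi.single r 1 by abel] at this)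
    (fun r s hrs hk => by
      rw [e'] at hk
      rw [pt_inv_neg, pt_inv_neg]
      have := hres r s hrs hk
      constructor
      · intro h; rw [h, mul_inv_cancel_left₀ hq0] at this; exact this.1 rfl
      · intro h; rw [← h, mul_inv_cancel_left₀ hq0] at this; exact this.2 rfl) i j
  rw [mulGzw_inv hq, mulGwz_inv hq] at this
  simpa [neg_eq_iff_eq_neg] using this

/-- The Serre relation for lowering operators. -/
theorem serre_relation_low (hq : q₁ * q₂ * q₃ = 1) (ho : IsRowOrder lt)
    (hc : ∀ r, c r ≠ 0)
    (h0 : ExpandsLow f k (coef q₁ q₂ q₃ c lt τ S) (pt q₁ c) S X)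
    (h1 : ∀ r ∈ S, k (X - Pi.single r 1) ≠ 0 →
      ExpandsLow f k (coef q₁ q₂ q₃ c lt τ S) (pt q₁ c) S (X - Pi.single r 1))
    (h2 : ∀ r ∈ S, ∀ s ∈ S, k (X - Pi.single r 1 - Pi.single s 1) ≠ 0 →
      ExpandsLow f k (coef q₁ q₂ q₃ c lt τ S) (pt q₁ c) S (X - Pi.single r 1 - Pi.single s 1))
    (hres : ∀ r s t, k (X - Pi.single r 1 - Pi.single s 1 - Pi.single t 1) ≠ 0 →
      ∀ r' s', lt r' s' → ∀ m : ℤ,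
        m ≤ (Pi.single r 1 + Pi.single s 1 + Pi.single t 1 : R → ℤ) s' →
          q₁ ^ m * pt q₁ c X r' ≠ pt q₁ c X s') :
    ⁅f 0, ⁅f 1, f (-1)⁆⁆ (k X) = 0 := by
  have hq0 := ne_zero_left_of_prod hq
  have hq' : q₁⁻¹ * q₂⁻¹ * q₃⁻¹ = 1 := by rw [← mul_inv, ← mul_inv, hq, inv_one]
  have e : ∀ r, -(-X + Pi.single r 1) = X - Pi.single r 1 := fun r => by abel
  have e' : ∀ r s, -(-X + Pi.single r 1 + Pi.single s 1) = X - Pi.single r 1 - Pi.single s 1 :=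
    fun r s => by abel
  have e'' : ∀ r s t, -(-X + Pi.single r 1 + Pi.single s 1 + Pi.single t 1) =
      X - Pi.single r 1 - Pi.single s 1 - Pi.single t 1 := fun r s t => by abel
  have := serre_relation (k := fun Z => k (-Z)) hq' ho (inv_ne_zero hq0) hc
    (h0.expands hq ho) (fun r hr hk => by
      rw [e] at hk
      have := (h1 r hr hk).expands hq ho
      rwa [show -(X - Pi.single r 1) = -X + Pi.single r 1 by abel] at this)
    (fun r hr s hs hk => by
      rw [e'] at hk
      have := (h2 r hr s hs hk).expands hq ho
      rwa [show -(X - Pi.single r 1 - Pi.single s 1) = -X + Pi.single r 1 + Pi.single s 1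
        by abel] at this)
    (fun r s t hk r' s' hrs m hm => by
      rw [e''] at hk
      rw [pt_inv_neg, pt_inv_neg]
      intro h
      refine hres r s t hk r' s' hrs m hm ?_
      rw [h, inv_zpow, mul_inv_cancel_left₀ (zpow_ne_zero _ hq0)])
  simpa using this

/-- Raising one row and lowering another one commute. -/
theorem coef_mul_coef_cross (hq : q₁ * q₂ * q₃ = 1) (ho : IsRowOrder lt) {τ' : R → ℤ → ℂ}
    {r s : R} (hr : r ∈ S) (hs : s ∈ S) (hne : r ≠ s) :
    coef q₁ q₂ q₃ c lt τ S (X + Pi.single s 1) r *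
        coef q₁ q₂ q₃ c (fun a b => lt b a) τ' S (X + Pi.single r 1) s =
      coef q₁ q₂ q₃ c (fun a b => lt b a) τ' S X s * coef q₁ q₂ q₃ c lt τ S X r := by
  have h0 := ne_zero_left_of_prod hq
  have hM : ({r, s} : Finset R) ⊆ S := by simp [Finset.insert_subset_iff, hr, hs]
  obtain ⟨θ, hθ⟩ := exists_coef_eq_coef (q₁ := q₁) (q₂ := q₂) (q₃ := q₃) (c := c) (lt := lt) τ
    hM X
  obtain ⟨η, hη⟩ := exists_coef_eq_coef (q₁ := q₁) (q₂ := q₂) (q₃ := q₃) (c := c)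
    (lt := fun a b => lt b a) τ' hM X
  rw [hθ X (by simp), hη X (by simp), hη (X + Pi.single r 1) (by simp +contextual),
    hθ (X + Pi.single s 1) (by simp +contextual)]
  rcases ho.total hne with hrs | hrs
  · simp only [coef, Finset.filter_insert, Finset.filter_singleton, ho.irrefl,
      ho.asymm hrs, if_false, Finset.prod_empty, insert_empty_eq,
      Pi.add_apply, Pi.single_eq_of_ne hne, Pi.single_eq_of_ne hne.symm, add_zero]
    ring
  · simp only [coef, Finset.filter_insert, Finset.filter_singleton, hrs, ho.irrefl,
      if_true, if_false, insert_empty_eq, Finset.prod_singleton,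
      pt_add_single_self h0, pt_add_single_of_ne q₁ c _ hne, pt_add_single_of_ne q₁ c _ hne.symm,
      Pi.add_apply, Pi.single_eq_of_ne hne, Pi.single_eq_of_ne hne.symm, add_zero]
    linear_combination (θ r (X r) * η s (X s)) * phi_mul_phi_cross hq (pt q₁ c X s) (pt q₁ c X r)

/-- The commutator of raising and lowering operators is diagonal. -/
theorem commutator_relation (hq : q₁ * q₂ * q₃ = 1) (ho : IsRowOrder lt) (hc : ∀ r, c r ≠ 0)
    {τ' : R → ℤ → ℂ}
    (h0 : Expands e k (coef q₁ q₂ q₃ c lt τ S) (pt q₁ c) S X)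
    (h0' : ExpandsLow f k (coef q₁ q₂ q₃ c (fun a b => lt b a) τ' S) (pt q₁ c) S X)
    (h1 : ∀ r ∈ S, k (X - Pi.single r 1) ≠ 0 →
      Expands e k (coef q₁ q₂ q₃ c lt τ S) (pt q₁ c) S (X - Pi.single r 1))
    (h1' : ∀ r ∈ S, k (X + Pi.single r 1) ≠ 0 →
      ExpandsLow f k (coef q₁ q₂ q₃ c (fun a b => lt b a) τ' S) (pt q₁ c) S (X + Pi.single r 1))
    (i j : ℤ) :
    (e i * f j - f j * e i) (k X) = (∑ r ∈ S,
      (coef q₁ q₂ q₃ c lt τ S (X - Pi.single r 1) r *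
          coef q₁ q₂ q₃ c (fun a b => lt b a) τ' S (X - Pi.single r 1) r *
          pt q₁ c (X - Pi.single r 1) r ^ (i + j) -
        coef q₁ q₂ q₃ c lt τ S X r * coef q₁ q₂ q₃ c (fun a b => lt b a) τ' S X r *
          pt q₁ c X r ^ (i + j))) • k X := by
  have hq0 := ne_zero_left_of_prod hq
  have hef : e i (f j (k X)) = ∑ r ∈ S, ∑ s ∈ S,
      (coef q₁ q₂ q₃ c lt τ S (X - Pi.single s 1) r *
        coef q₁ q₂ q₃ c (fun a b => lt b a) τ' S (X - Pi.single s 1) s *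
        (pt q₁ c (X - Pi.single s 1) r ^ i * pt q₁ c (X - Pi.single s 1) s ^ j)) •
      k (X - Pi.single s 1 + Pi.single r 1) := by
    rw [h0'.apply, map_sum, Finset.sum_comm]
    refine Finset.sum_congr rfl fun s hs => ?_
    by_cases hz : k (X - Pi.single s 1) = 0
    · simp [hz, h0'.eq_zero s hs hz]
    · rw [map_smul, (h1 s hs hz).apply, Finset.smul_sum]
      refine Finset.sum_congr rfl fun r _ => ?_
      rw [smul_smul]; congr 1; ring
  have hfe : f j (e i (k X)) = ∑ r ∈ S, ∑ s ∈ S,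
      (coef q₁ q₂ q₃ c lt τ S X r *
        coef q₁ q₂ q₃ c (fun a b => lt b a) τ' S (X + Pi.single r 1 - Pi.single s 1) s *
        (pt q₁ c X r ^ i * pt q₁ c (X + Pi.single r 1 - Pi.single s 1) s ^ j)) •
      k (X - Pi.single s 1 + Pi.single r 1) := by
    rw [h0.apply, map_sum]
    refine Finset.sum_congr rfl fun r hr => ?_
    by_cases hz : k (X + Pi.single r 1) = 0
    · simp [hz, h0.eq_zero r hr hz]
    · rw [map_smul, (h1' r hr hz).apply, Finset.smul_sum]
      refine Finset.sum_congr rfl fun s _ => ?_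
      rw [smul_smul, add_sub_right_comm]; congr 1; ring
  rw [LinearMap.sub_apply, Module.End.mul_apply, Module.End.mul_apply, hef, hfe,
    ← Finset.sum_sub_distrib, Finset.sum_smul]
  refine Finset.sum_congr rfl fun r hr => ?_
  -- For `s ≠ r` the two orders cancel by `coef_mul_coef_cross`, applied to the state in which `s`
  -- is already lowered. Only the returns to `X` are left.
  rw [← Finset.sum_sub_distrib, Finset.sum_eq_single r]
  · rw [sub_add_cancel, add_sub_cancel_right, ← sub_smul, zpow_add₀ (pt_ne_zero hq0 hc _ _),
      zpow_add₀ (pt_ne_zero hq0 hc _ _)]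
  · intro s hs hsr
    have := coef_mul_coef_cross (X := X - Pi.single s 1) (c := c) (τ := τ) (τ' := τ') hq ho hr hs
      hsr.symm
    rw [sub_add_cancel] at this
    rw [add_sub_right_comm, this, pt_sub_single_of_ne _ _ _ hsr.symm,
      pt_add_single_of_ne _ _ _ hsr, ← sub_smul]
    convert zero_smul ℂ _ using 2
    ring
  · exact fun h => absurd hr h

end Lowering

/-! ## States -/

/-- A row of one of the partitions. -/
abbrev Row (n : ℕ) : Type := Fin (n + 1) × ℕ

/-- The lexicographic order of rows. -/
def rowLt {n : ℕ} (r s : Row n) : Prop := r.1 < s.1 ∨ r.1 = s.1 ∧ r.2 < s.2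

instance {n : ℕ} : DecidableRel (rowLt (n := n)) := fun _ _ => by
  unfold rowLt; infer_instance

theorem isRowOrder_rowLt (n : ℕ) : IsRowOrder (rowLt (n := n)) where
  irrefl r := by simp [rowLt]
  trans {r s t} h1 h2 := by
    rcases h1 with h1 | ⟨h1, h1'⟩ <;> rcases h2 with h2 | ⟨h2, h2'⟩
    · exact Or.inl (h1.trans h2)
    · exact Or.inl (h2 ▸ h1)
    · exact Or.inl (h1 ▸ h2)
    · exact Or.inr ⟨h1.trans h2, h1'.trans h2'⟩
  total {r s} h := by
    rcases lt_trichotomy r.1 s.1 with h1 | h1 | h1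
    · exact Or.inl (Or.inl h1)
    · rcases lt_trichotomy r.2 s.2 with h2 | h2 | h2
      · exact Or.inl (Or.inr ⟨h1, h2⟩)
      · exact absurd (Prod.ext h1 h2) h
      · exact Or.inr (Or.inr ⟨h1.symm, h2⟩)
    · exact Or.inr (Or.inl h1)

section States

variable {n : ℕ} {a b : Fin n → ℕ}

/-- The lengths of the rows of a label. -/
def Label.state (lam : Label a b) : Row n → ℤ := fun r => (lam.1 r.1).1 r.2

theorem Label.state_injective : Function.Injective (Label.state (a := a) (b := b)) := by
  intro x y h
  refine Subtype.ext (funext fun i => Subtype.ext (Finsupp.ext fun s => ?_))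
  exact congrFun h (i, s)

/-- The lengths of the rows of the labels. -/
structure IsState (a b : Fin n → ℕ) (X : Row n → ℤ) : Prop where
  succ_le : ∀ i s, X (i, s + 1) ≤ X (i, s)
  sub_le : ∀ (i : Fin n) (s : ℕ), X (i.succ, s + b i) - a i ≤ X (i.castSucc, s)
  bounded : ∃ N, ∀ i s, N ≤ s → X (i, s) = 0

theorem IsState.antitone {X : Row n → ℤ} (h : IsState a b X) (i : Fin (n + 1)) :
    Antitone fun s => X (i, s) := antitone_nat_of_succ_le (h.succ_le i)

theorem IsState.nonneg {X : Row n → ℤ} (h : IsState a b X) (r : Row n) : 0 ≤ X r := by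
  obtain ⟨N, hN⟩ := h.bounded
  rcases r with ⟨i, s⟩
  rw [← hN i (max N s) (le_max_left _ _)]
  exact h.antitone i (le_max_right _ _)

theorem Label.isState (lam : Label a b) : IsState a b lam.state where
  succ_le i s := (lam.1 i).2 (Nat.le_succ s)
  sub_le i s := lam.2 i s
  bounded := by
    refine ⟨Finset.univ.sup (fun i => (lam.1 i).1.support.sup fun s => s + 1), fun i s hs => ?_⟩
    by_contra h
    have h1 : s + 1 ≤ (lam.1 i).1.support.sup fun s => s + 1 :=
      Finset.le_sup (f := fun s => s + 1) (Finsupp.mem_support_iff.2 h)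
    have h2 := Finset.le_sup (f := fun i => (lam.1 i).1.support.sup fun s => s + 1)
      (Finset.mem_univ i)
    have := h1.trans (h2.trans hs)
    omega

theorem IsState.exists_label {X : Row n → ℤ} (h : IsState a b X) :
    ∃ lam : Label a b, lam.state = X := by
  classical
  obtain ⟨N, hN⟩ := h.bounded
  refine ⟨⟨fun i => ⟨Finsupp.onFinset (Finset.range N) (fun s => X (i, s)) fun s hs => ?_, ?_⟩, ?_⟩,
    ?_⟩
  · by_contra hs'
    exact hs (hN i s (by simpa using hs'))
  · intro s t hst
    exact h.antitone i hst
  · intro i s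
    exact h.sub_le i s
  · rfl

theorem isState_iff {X : Row n → ℤ} : IsState a b X ↔ ∃ lam : Label a b, lam.state = X :=
  ⟨IsState.exists_label, by rintro ⟨lam, rfl⟩; exact lam.isState⟩

open Classical in
/-- The basis vector with given lengths of the rows, and `0` if there is none. -/
def ketOf (a b : Fin n → ℕ) (X : Row n → ℤ) : MSpace a b :=
  if h : ∃ lam : Label a b, lam.state = X then ket h.choose else 0

theorem ketOf_state (lam : Label a b) : ketOf a b lam.state = ket lam := by
  have h : ∃ mu : Label a b, mu.state = lam.state := ⟨lam, rfl⟩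
  rw [ketOf, dif_pos h, Label.state_injective h.choose_spec]

theorem ketOf_of_not {X : Row n → ℤ} (h : ¬IsState a b X) : ketOf a b X = 0 := by
  rw [ketOf, dif_neg (by rwa [← isState_iff])]

theorem ket_ne_zero (lam : Label a b) : ket lam ≠ 0 := by
  simp [ket]

theorem ketOf_ne_zero_iff {X : Row n → ℤ} : ketOf a b X ≠ 0 ↔ IsState a b X := by
  refine ⟨fun h => by_contra fun h' => h (ketOf_of_not h'), fun h => ?_⟩
  obtain ⟨lam, rfl⟩ := h.exists_label
  rw [ketOf_state]
  exact ket_ne_zero lam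

open Classical in
theorem ketOf_apply (X : Row n → ℤ) (mu : Label a b) :
    ketOf a b X mu = if mu.state = X then 1 else 0 := by
  by_cases h : IsState a b X
  · obtain ⟨lam, rfl⟩ := h.exists_label
    rw [ketOf_state, ket, Finsupp.single_apply]
    simp only [Label.state_injective.eq_iff, eq_comm]
  · rw [ketOf_of_not h, if_neg]
    · rfl
    · rintro rfl
      exact h mu.isState

/-- The sum of the `a_k + 1` for `k < i`. -/
def offset (a : Fin n → ℕ) (i : Fin (n + 1)) : ℤ :=
  ∑ k : Fin n, if k.castSucc < i then (a k : ℤ) + 1 else 0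

theorem offset_zero (a : Fin n → ℕ) : offset a 0 = 0 := by
  simp [offset]

theorem offset_succ (a : Fin n → ℕ) (i : Fin n) :
    offset a i.succ = offset a i.castSucc + a i + 1 := by
  have h : ∀ k : Fin n, (if k.castSucc < i.succ then (a k : ℤ) + 1 else 0) =
      (if k.castSucc < i.castSucc then (a k : ℤ) + 1 else 0) +
        if k = i then (a k : ℤ) + 1 else 0 := by
    intro k
    rcases lt_trichotomy k i with hk | hk | hk
    · rw [if_pos (Fin.castSucc_lt_succ_iff.2 hk.le), if_pos (Fin.castSucc_lt_castSucc_iff.2 hk),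
        if_neg hk.ne, add_zero]
    · subst hk
      simp [Fin.castSucc_lt_succ_iff]
    · rw [if_neg (by simpa [Fin.castSucc_lt_succ_iff] using hk),
        if_neg (by simpa using hk.le), if_neg hk.ne', add_zero]
  simp only [offset, h, Finset.sum_add_distrib, Finset.sum_ite_eq', Finset.mem_univ, if_true]
  ring

theorem offset_strictMono (a : Fin n → ℕ) : StrictMono (offset a) :=
  Fin.strictMono_iff_lt_succ.2 fun i => by rw [offset_succ]; omega

/-- The second coordinate of a row in the plane: the weight of the next box of the row `r` is
`q₁ ^ col q₃ ^ level u`. -/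
def level (b : Fin n → ℕ) (r : Row n) : ℤ := r.2 - offset b r.1

/-- The first coordinate of a row in the plane. -/
def col (a : Fin n → ℕ) (X : Row n → ℤ) (r : Row n) : ℤ := X r - offset a r.1

/-- Neighbouring partitions satisfy this by definition, since their defining inequality compares
rows whose levels differ by one. For others, pass through the row `t'` of the partition before the
last: it has the level of `(j, s)`, so the induction hypothesis applies to `(j, s + 1)`, which is
not longer than `(j, s)`. -/
theorem IsState.interlace {X : Row n → ℤ} (h : IsState a b X) {j : Fin (n + 1)} :
    ∀ i : Fin (n + 1), j < i → ∀ s t : ℕ, level b (j, s) = level b (i, t) + 1 →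
      col a X (i, t) + 1 ≤ col a X (j, s) := by
  intro i
  induction i using Fin.induction with
  | zero => intro hj; exact absurd hj (Fin.not_lt_zero j)
  | succ i ih =>
    intro hj s t hst
    simp only [level, col] at hst ih ⊢
    rw [offset_succ] at hst ⊢
    rcases (Fin.le_castSucc_iff.2 hj).lt_or_eq with hlt | rfl
    · have hB := offset_strictMono b hlt
      obtain ⟨t', ht'⟩ : ∃ t' : ℕ, t = t' + b i := by
        refine ⟨t - b i, ?_⟩
        omega
      subst ht'
      have h1 := h.sub_le i t'
      have h2 := ih hlt (s + 1) t' (by push_cast at hst ⊢; omega)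
      have h3 := h.succ_le j s
      omega
    · obtain rfl : t = s + b i := by omega
      have h1 := h.sub_le i s
      omega

/-- Inside one partition an earlier row has a smaller level, so only the case of two partitions is
left. -/
theorem IsState.col_le_of_level_eq_add_one {X : Row n → ℤ} (h : IsState a b X) {r r' : Row n}
    (hr : rowLt r' r) (hl : level b r' = level b r + 1) : col a X r + 1 ≤ col a X r' := by
  rcases hr with hr | ⟨hr, hr'⟩
  · exact h.interlace r.1 hr r'.2 r.2 hl
  · simp only [level, hr] at hl
    omega

theorem IsState.col_le_of_level_eq {X : Row n → ℤ} (h : IsState a b X) {r r' : Row n}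
    (hr : rowLt r' r) (hl : level b r' = level b r) : col a X r + 1 ≤ col a X r' := by
  rcases hr with hr | ⟨hr, hr'⟩
  · have h1 := h.interlace r.1 hr (r'.2 + 1) r.2 (by simp only [level] at hl ⊢; push_cast; omega)
    have h2 := h.succ_le r'.1 r'.2
    simp only [col, Prod.mk.eta] at h1 h2 ⊢
    omega
  · simp only [level, hr] at hl
    omega

theorem IsState.col_le_of_level_add_one_eq {X : Row n → ℤ} (h : IsState a b X) {r r' : Row n}
    (hr : rowLt r' r) (hl : level b r' + 1 = level b r) : col a X r ≤ col a X r' := by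
  rcases hr with hr | ⟨hr, hr'⟩
  · have h1 := h.interlace r.1 hr (r'.2 + 2) r.2 (by simp only [level] at hl ⊢; push_cast; omega)
    have h2 := h.antitone r'.1 (show r'.2 ≤ r'.2 + 2 by omega)
    simp only [col, Prod.mk.eta] at h1 h2 ⊢
    omega
  · obtain ⟨i, t⟩ := r
    obtain ⟨j, s⟩ := r'
    obtain rfl : j = i := hr
    simp only [level] at hl
    obtain rfl : t = s + 1 := by omega
    have := h.succ_le j s
    simp only [col]
    omega

/-- Rows of one level stay apart if at most three rows move. -/
theorem IsState.col_add_le {X D : Row n → ℤ} (h : IsState a b X) (h' : IsState a b (X + D))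
    {T : Finset (Row n)} (hT : T.card ≤ 3) (hD : ∀ r ∉ T, D r = 0) {r r' : Row n}
    (hr : rowLt r' r) (hl : level b r' = level b r) : col a X r + D r + 1 ≤ col a X r' := by
  obtain ⟨i, t⟩ := r
  obtain ⟨j, s⟩ := r'
  have hji : j < i := by
    rcases hr with hr | ⟨hr, hr'⟩
    · exact hr
    · obtain rfl : j = i := hr
      simp only [level] at hl hr'
      omega
  have hB := offset_strictMono b hji
  have hl' := hl
  simp only [level] at hl'
  -- Equal levels in partitions `j < i` force the row of the later one to have positive index.
  obtain ⟨t, rfl⟩ : ∃ t', t = t' + 1 := ⟨t - 1, by omega⟩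
  -- A collision is guarded by the two rows and by their neighbours `(j, s + 1)` and `(i, t)`. At
  -- most three rows move, so one of the four is fixed, and each case gives the bound from the
  -- inequalities for `X` and `X + D`.
  have hex : D (j, s) = 0 ∨ D (i, t + 1) = 0 ∨ D (j, s + 1) = 0 ∨ D (i, t) = 0 := by
    by_contra hne
    push Not at hne
    have hsub : ({(j, s), (i, t + 1), (j, s + 1), (i, t)} : Finset (Row n)) ⊆ T := by
      intro x hx
      by_contra hxT
      have := hD x hxT
      simp only [Finset.mem_insert, Finset.mem_singleton] at hx
      rcases hx with rfl | rfl | rfl | rfl <;> tauto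
    have hcard := Finset.card_le_card hsub
    rw [Finset.card_insert_of_notMem (by simp [hji.ne]),
      Finset.card_insert_of_notMem (by simp [hji.ne']),
      Finset.card_insert_of_notMem (by simp [hji.ne]), Finset.card_singleton] at hcard
    omega
  have hZ : ∀ x, col a (X + D) x = col a X x + D x := fun x => by simp [col]; ring
  rcases hex with h0 | h0 | h0 | h0
  · have := h'.col_le_of_level_eq hr hl
    rw [hZ, hZ] at this
    omega
  · have := h.col_le_of_level_eq hr hl
    omega
  · have h1 := h'.col_le_of_level_eq_add_one (r' := (j, s + 1)) (r := (i, t + 1)) (Or.inl hji)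
      (by simp only [level] at hl ⊢; push_cast at hl ⊢; omega)
    have h2 := h.succ_le j s
    rw [hZ, hZ] at h1
    simp only [col] at *
    omega
  · have h1 := h.col_le_of_level_eq_add_one (r' := (j, s)) (r := (i, t)) (Or.inl hji)
      (by simp only [level] at hl ⊢; push_cast at hl ⊢; omega)
    have h2 := h'.succ_le i t
    simp only [Pi.add_apply, col] at *
    omega

end States

/-! ## Matrix coefficients as finite products -/

/-- The rows with index less than `L` of all partitions. -/
def rows (n L : ℕ) : Finset (Row n) := Finset.univ ×ˢ Finset.range L

theorem mem_rows {n L : ℕ} {r : Row n} : r ∈ rows n L ↔ r.2 < L := by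
  simp [rows]

theorem prod_rows {n L : ℕ} {M : Type*} [CommMonoid M] (f : Row n → M) :
    ∏ r ∈ rows n L, f r = ∏ i, ∏ s ∈ Finset.range L, f (i, s) := Finset.prod_product _ _ _

theorem prod_rows_succ {n L : ℕ} {M : Type*} [CommMonoid M] (f : Row n → M) :
    ∏ r ∈ rows n (L + 1), f r = (∏ i, f (i, L)) * ∏ r ∈ rows n L, f r := by
  simp only [prod_rows, Finset.prod_range_succ, Finset.prod_mul_distrib, mul_comm]

theorem rows_subset_succ (n L : ℕ) : rows n L ⊆ rows n (L + 1) := fun r hr => by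
  rw [mem_rows] at hr ⊢; omega

/-- The weights of the first boxes of the rows. -/
def rowBase {n : ℕ} (q₃ : ℂ) (us : Fin (n + 1) → ℂ) (r : Row n) : ℂ := q₃ ^ r.2 * us r.1

/-- The eigenvalue of `ψ(z)` on the vacuum of a Fock module whose first box has weight `p`. -/
def tailFactor {K : Type*} [Field K] (q₂ p z : K) : K := (z - q₂ * p) / (z - p)

/-- The zero `q₂ q₃ p = q₁⁻¹ p` and the pole `q₃ p` of the shifted tail cancel against a pole and a
zero of `phi`. By iteration, empty rows are absorbed into the tail one after another. -/
theorem tailFactor_eq {K : Type*} [Field K] {q₁ q₂ q₃ p z : K} (hq : q₁ * q₂ * q₃ = 1)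
    (h1 : z ≠ q₃ * p) (h2 : z ≠ q₁⁻¹ * p) :
    tailFactor q₂ p z = tailFactor q₂ (q₃ * p) z * phi q₁ q₂ q₃ p z := by
  have e : q₂ * (q₃ * p) = q₁⁻¹ * p := by
    have := ne_zero_left_of_prod hq
    field_simp
    linear_combination p * hq
  have h1' := sub_ne_zero.2 h1
  have h2' := sub_ne_zero.2 h2
  unfold tailFactor phi
  rw [e, div_mul_div_comm, show (z - q₁⁻¹ * p) * ((z - q₃ * p) * (z - q₂ * p)) =
      ((z - q₁⁻¹ * p) * (z - q₃ * p)) * (z - q₂ * p) by ring,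
    show (z - q₃ * p) * ((z - p) * (z - q₁⁻¹ * p)) =
      ((z - q₁⁻¹ * p) * (z - q₃ * p)) * (z - p) by ring,
    mul_div_mul_left _ _ (mul_ne_zero h2' h1')]

section Coefficients

variable {n : ℕ}

/-- The external factor of the coefficients of `e(z)`. -/
def extE (q₁ q₂ q₃ : ℂ) (us : Fin (n + 1) → ℂ) (L : ℕ) (r : Row n) (x : ℤ) : ℂ :=
  (1 - q₁)⁻¹ * ∏ m, if m < r.1 then
    tailFactor q₂ (q₃ ^ L * us m) (q₁ ^ x * rowBase q₃ us r) else 1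

/-- The external factor of the coefficients of `f(z)`. -/
def extF (q₁ q₂ q₃ : ℂ) (us : Fin (n + 1) → ℂ) (L : ℕ) (r : Row n) (x : ℤ) : ℂ :=
  q₁ * (1 - q₁)⁻¹ * ∏ m, if r.1 ≤ m then
    tailFactor q₂ (q₃ ^ L * us m) (q₁ ^ x * rowBase q₃ us r) else 1

/-- The coefficient of `e(z)` from `X` to `X + 1_r`. -/
def coefE (q₁ q₂ q₃ : ℂ) (us : Fin (n + 1) → ℂ) (L : ℕ) : (Row n → ℤ) → Row n → ℂ :=
  coef q₁ q₂ q₃ (rowBase q₃ us) rowLt (extE q₁ q₂ q₃ us L) (rows n L)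

/-- The coefficient of `f(z)` from `X + 1_r` to `X`. -/
def coefF (q₁ q₂ q₃ : ℂ) (us : Fin (n + 1) → ℂ) (L : ℕ) : (Row n → ℤ) → Row n → ℂ :=
  coef q₁ q₂ q₃ (rowBase q₃ us) (fun r s => rowLt s r) (extF q₁ q₂ q₃ us L) (rows n L)

/-- The eigenvalue of `ψ(z)` on `X`. -/
def psiRat {K : Type*} [Field K] (ι : ℂ →+* K) (q₁ q₂ q₃ : ℂ) (us : Fin (n + 1) → ℂ) (L : ℕ)
    (X : Row n → ℤ) (z : K) : K :=
  (∏ m, tailFactor (ι q₂) (ι (q₃ ^ L * us m)) z) *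
    ∏ r ∈ rows n L, phi (ι q₁) (ι q₂) (ι q₃) (ι (pt q₁ (rowBase q₃ us) X r)) z

/-- The rows of `X` with index at least `L - 1` are empty. -/
structure Room (L : ℕ) (X : Row n → ℤ) : Prop where
  pos : 1 ≤ L
  eq_zero : ∀ i s, L ≤ s + 1 → X (i, s) = 0

theorem Room.mono {L L' : ℕ} {X : Row n → ℤ} (h : Room L X) (hL : L ≤ L') : Room L' X :=
  ⟨h.pos.trans hL, fun i s hs => h.eq_zero i s (hL.trans hs)⟩

theorem IsState.exists_room {a b : Fin n → ℕ} {X : Row n → ℤ} (h : IsState a b X) :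
    ∃ L, Room L X := by
  obtain ⟨N, hN⟩ := h.bounded
  exact ⟨N + 1, by omega, fun i s hs => hN i s (by omega)⟩

theorem pt_rowBase_of_eq_zero (q₁ q₃ : ℂ) (us : Fin (n + 1) → ℂ) {X : Row n → ℤ} {i : Fin (n + 1)}
    {s : ℕ} (h : X (i, s) = 0) : pt q₁ (rowBase q₃ us) X (i, s) = q₃ ^ s * us i := by
  simp [pt, h, rowBase]

/-- Row `L` is empty in every partition, so its factor is the one that `tailFactor_eq` splits off
from the tail. It precedes `r` exactly for the partitions `m < r.1`, whose tails occur in `extE`. -/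
theorem coefE_succ_of_ne {q₁ q₂ q₃ : ℂ} (hq : q₁ * q₂ * q₃ = 1) (us : Fin (n + 1) → ℂ) {L : ℕ}
    {X : Row n → ℤ} (hX : Room L X) {r : Row n} (hr : r ∈ rows n L)
    (h1 : ∀ m, pt q₁ (rowBase q₃ us) X r ≠ q₃ ^ (L + 1) * us m)
    (h2 : ∀ m, pt q₁ (rowBase q₃ us) X r ≠ q₁⁻¹ * (q₃ ^ L * us m)) :
    coefE q₁ q₂ q₃ us L X r = coefE q₁ q₂ q₃ us (L + 1) X r := by
  rw [mem_rows] at hr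
  simp only [coefE, coef, extE, Finset.prod_filter]
  rw [prod_rows_succ, mul_assoc, mul_assoc, ← mul_assoc (∏ m, _) (∏ m, _),
    ← Finset.prod_mul_distrib]
  congr 2
  refine Finset.prod_congr rfl fun m _ => ?_
  have hlt : rowLt (m, L) r ↔ m < r.1 := by
    simp only [rowLt]; omega
  simp only [hlt]
  split_ifs
  · rw [pt_rowBase_of_eq_zero _ _ _ (hX.eq_zero m L (by omega))]
    change tailFactor _ _ (pt q₁ (rowBase q₃ us) X r) = tailFactor _ _ (pt q₁ (rowBase q₃ us) X r) * _
    rw [tailFactor_eq hq (by rw [← mul_assoc, ← pow_succ']; exact h1 m) (h2 m), ← mul_assoc,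
      ← pow_succ']
  · rw [one_mul]

theorem coefF_succ_of_ne {q₁ q₂ q₃ : ℂ} (hq : q₁ * q₂ * q₃ = 1) (us : Fin (n + 1) → ℂ) {L : ℕ}
    {X : Row n → ℤ} (hX : Room L X) {r : Row n} (hr : r ∈ rows n L)
    (h1 : ∀ m, pt q₁ (rowBase q₃ us) X r ≠ q₃ ^ (L + 1) * us m)
    (h2 : ∀ m, pt q₁ (rowBase q₃ us) X r ≠ q₁⁻¹ * (q₃ ^ L * us m)) :
    coefF q₁ q₂ q₃ us L X r = coefF q₁ q₂ q₃ us (L + 1) X r := by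
  rw [mem_rows] at hr
  simp only [coefF, coef, extF, Finset.prod_filter]
  rw [prod_rows_succ, mul_assoc (q₁ * _), mul_assoc (q₁ * _), ← mul_assoc (∏ m, _) (∏ m, _),
    ← Finset.prod_mul_distrib]
  congr 2
  refine Finset.prod_congr rfl fun m _ => ?_
  have hlt : rowLt r (m, L) ↔ r.1 ≤ m := by
    simp only [rowLt]; omega
  simp only [hlt]
  split_ifs
  · rw [pt_rowBase_of_eq_zero _ _ _ (hX.eq_zero m L (by omega))]
    change tailFactor _ _ (pt q₁ (rowBase q₃ us) X r) = tailFactor _ _ (pt q₁ (rowBase q₃ us) X r) * _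
    rw [tailFactor_eq hq (by rw [← mul_assoc, ← pow_succ']; exact h1 m) (h2 m), ← mul_assoc,
      ← pow_succ']
  · rw [one_mul]

/-- The resonance conditions for the parameters. -/
structure Resonant (a b : Fin n → ℕ) (q₁ q₂ q₃ u : ℂ) (us : Fin (n + 1) → ℂ) : Prop where
  prod_eq_one : q₁ * q₂ * q₃ = 1
  ne_zero : u ≠ 0
  indep : ∀ x y : ℤ, q₁ ^ x * q₃ ^ y = 1 → x = 0 ∧ y = 0
  eq : ∀ i, us i = q₁ ^ (-offset a i) * q₃ ^ (-offset b i) * u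

namespace Resonant

variable {a b : Fin n → ℕ} {q₁ q₂ q₃ u : ℂ} {us : Fin (n + 1) → ℂ}

theorem q1_ne (H : Resonant a b q₁ q₂ q₃ u us) : q₁ ≠ 0 := ne_zero_left_of_prod H.prod_eq_one

theorem q2_ne (H : Resonant a b q₁ q₂ q₃ u us) : q₂ ≠ 0 := ne_zero_mid_of_prod H.prod_eq_one

theorem q3_ne (H : Resonant a b q₁ q₂ q₃ u us) : q₃ ≠ 0 := ne_zero_right_of_prod H.prod_eq_one

theorem q2_eq (H : Resonant a b q₁ q₂ q₃ u us) : q₂ = q₁ ^ (-1 : ℤ) * q₃ ^ (-1 : ℤ) := by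
  have := H.q1_ne
  have := H.q3_ne
  rw [zpow_neg_one, zpow_neg_one]
  field_simp
  linear_combination H.prod_eq_one

theorem one_sub_q1_ne (H : Resonant a b q₁ q₂ q₃ u us) : 1 - q₁ ≠ 0 := by
  intro h
  have := (H.indep 1 0 (by rw [zpow_one, zpow_zero]; linear_combination -h)).1
  omega

theorem us_ne (H : Resonant a b q₁ q₂ q₃ u us) (i : Fin (n + 1)) : us i ≠ 0 := by
  rw [H.eq]
  exact mul_ne_zero (mul_ne_zero (zpow_ne_zero _ H.q1_ne) (zpow_ne_zero _ H.q3_ne)) H.ne_zero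

theorem rowBase_ne (H : Resonant a b q₁ q₂ q₃ u us) (r : Row n) : rowBase q₃ us r ≠ 0 :=
  mul_ne_zero (pow_ne_zero _ H.q3_ne) (H.us_ne _)

theorem monomial_inj (H : Resonant a b q₁ q₂ q₃ u us) {x y x' y' : ℤ}
    (h : q₁ ^ x * q₃ ^ y * u = q₁ ^ x' * q₃ ^ y' * u) : x = x' ∧ y = y' := by
  have h1 := mul_right_cancel₀ H.ne_zero h
  have n1 := zpow_ne_zero x' H.q1_ne
  have n2 := zpow_ne_zero y' H.q3_ne
  have := H.indep (x - x') (y - y') (by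
    rw [zpow_sub₀ H.q1_ne, zpow_sub₀ H.q3_ne, div_mul_div_comm, h1,
      div_self (mul_ne_zero n1 n2)])
  omega

theorem pt_eq (H : Resonant a b q₁ q₂ q₃ u us) (X : Row n → ℤ) (r : Row n) :
    pt q₁ (rowBase q₃ us) X r = q₁ ^ col a X r * q₃ ^ level b r * u := by
  rw [pt, rowBase, H.eq, col, level, sub_eq_add_neg, sub_eq_add_neg, zpow_add₀ H.q1_ne,
    zpow_add₀ H.q3_ne, zpow_natCast]
  ring

theorem tail_eq (H : Resonant a b q₁ q₂ q₃ u us) (x y : ℤ) (L : ℕ) (m : Fin (n + 1)) :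
    q₁ ^ x * q₃ ^ y * (q₃ ^ L * us m) =
      q₁ ^ (x - offset a m) * q₃ ^ (y + L - offset b m) * u := by
  rw [H.eq, sub_eq_add_neg, sub_eq_add_neg, zpow_add₀ H.q1_ne,
    zpow_add₀ H.q3_ne, zpow_add₀ H.q3_ne, zpow_natCast]
  ring

/-- Comparison of the weights of two rows. -/
theorem pt_eq_iff (H : Resonant a b q₁ q₂ q₃ u us) {X Z : Row n → ℤ} {r r' : Row n} {x y : ℤ} :
    pt q₁ (rowBase q₃ us) Z r = q₁ ^ x * q₃ ^ y * pt q₁ (rowBase q₃ us) X r' ↔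
      col a Z r = x + col a X r' ∧ level b r = y + level b r' := by
  have e : q₁ ^ x * q₃ ^ y * pt q₁ (rowBase q₃ us) X r' =
      q₁ ^ (x + col a X r') * q₃ ^ (y + level b r') * u := by
    rw [H.pt_eq, zpow_add₀ H.q1_ne, zpow_add₀ H.q3_ne]; ring
  rw [e, H.pt_eq]
  exact ⟨H.monomial_inj, fun h => by rw [h.1, h.2]⟩

/-- The weight of a box differs from the poles and zeros of the tails. -/
theorem pt_ne_tail (H : Resonant a b q₁ q₂ q₃ u us) {Z : Row n → ℤ} {r : Row n} {L : ℕ}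
    (hr : r ∈ rows n L) (hZ : 0 ≤ Z r) {x y : ℤ} (h : x = 0 ∧ 0 ≤ y ∨ x = -1 ∧ -1 ≤ y)
    (m : Fin (n + 1)) :
    pt q₁ (rowBase q₃ us) Z r ≠ q₁ ^ x * q₃ ^ y * (q₃ ^ L * us m) := by
  rw [H.tail_eq, H.pt_eq]
  intro he
  obtain ⟨h1, h2⟩ := H.monomial_inj he
  rw [mem_rows] at hr
  simp only [col, level] at h1 h2
  -- For a later partition `m` the columns disagree, for an earlier one the levels; inside the same
  -- partition one of the two does.
  rcases lt_trichotomy r.1 m with hm | hm | hm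
  · have := offset_strictMono a hm
    omega
  · rw [hm] at h1 h2
    omega
  · have := offset_strictMono b hm
    omega

theorem coefE_succ (H : Resonant a b q₁ q₂ q₃ u us) {L : ℕ} {X : Row n → ℤ} (hX : Room L X)
    {r : Row n} (hr : r ∈ rows n L) (h0 : 0 ≤ X r) :
    coefE q₁ q₂ q₃ us L X r = coefE q₁ q₂ q₃ us (L + 1) X r := by
  refine coefE_succ_of_ne H.prod_eq_one us hX hr (fun m => ?_) fun m => ?_
  · have := H.pt_ne_tail hr h0 (x := 0) (y := 1) (by omega) m
    rwa [zpow_zero, one_mul, zpow_one, ← mul_assoc, ← pow_succ'] at this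
  · have := H.pt_ne_tail hr h0 (x := -1) (y := 0) (by omega) m
    rwa [zpow_zero, mul_one, zpow_neg_one] at this

theorem coefF_succ (H : Resonant a b q₁ q₂ q₃ u us) {L : ℕ} {X : Row n → ℤ} (hX : Room L X)
    {r : Row n} (hr : r ∈ rows n L) (h0 : 0 ≤ X r) :
    coefF q₁ q₂ q₃ us L X r = coefF q₁ q₂ q₃ us (L + 1) X r := by
  refine coefF_succ_of_ne H.prod_eq_one us hX hr (fun m => ?_) fun m => ?_
  · have := H.pt_ne_tail hr h0 (x := 0) (y := 1) (by omega) m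
    rwa [zpow_zero, one_mul, zpow_one, ← mul_assoc, ← pow_succ'] at this
  · have := H.pt_ne_tail hr h0 (x := -1) (y := 0) (by omega) m
    rwa [zpow_zero, mul_one, zpow_neg_one] at this

theorem tailFactor_ne_zero (H : Resonant a b q₁ q₂ q₃ u us) {Z : Row n → ℤ} {r : Row n} {L : ℕ}
    (hr : r ∈ rows n L) (hZ : 0 ≤ Z r) (m : Fin (n + 1)) :
    tailFactor q₂ (q₃ ^ L * us m) (pt q₁ (rowBase q₃ us) Z r) ≠ 0 := by
  refine div_ne_zero (sub_ne_zero.2 ?_) (sub_ne_zero.2 ?_)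
  · have := H.pt_ne_tail hr hZ (x := -1) (y := -1) (by omega) m
    rwa [← H.q2_eq] at this
  · have := H.pt_ne_tail hr hZ (x := 0) (y := 0) (by omega) m
    rwa [zpow_zero, zpow_zero, one_mul, one_mul] at this

/-- Seen from `r'` in the plane of `col` and `level`, the zeros of `phi` are one step in the
direction of `q₃` and one diagonal step for `q₂ = q₁⁻¹ q₃⁻¹`. -/
theorem phi_eq_zero (H : Resonant a b q₁ q₂ q₃ u us) {X : Row n → ℤ} {r r' : Row n}
    (h : col a X r = col a X r' ∧ level b r = 1 + level b r' ∨
      col a X r + 1 = col a X r' ∧ level b r + 1 = level b r') :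
    phi q₁ q₂ q₃ (pt q₁ (rowBase q₃ us) X r') (pt q₁ (rowBase q₃ us) X r) = 0 := by
  unfold phi
  rcases h with h | h
  · have := (H.pt_eq_iff (X := X) (Z := X) (r := r) (r' := r') (x := 0) (y := 1)).2 (by omega)
    rw [zpow_zero, one_mul, zpow_one] at this
    rw [this]
    simp
  · have := (H.pt_eq_iff (X := X) (Z := X) (r := r) (r' := r') (x := -1) (y := -1)).2 (by omega)
    rw [← H.q2_eq] at this
    rw [this]
    simp

/-- The values of the structure function at different rows are finite unless two rows of one
level touch. -/
theorem phi_den_ne_zero (H : Resonant a b q₁ q₂ q₃ u us) {X : Row n → ℤ} {r r' : Row n}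
    (h : level b r = level b r' → col a X r ≠ col a X r' ∧ col a X r + 1 ≠ col a X r') :
    pt q₁ (rowBase q₃ us) X r - pt q₁ (rowBase q₃ us) X r' ≠ 0 ∧
      pt q₁ (rowBase q₃ us) X r - q₁⁻¹ * pt q₁ (rowBase q₃ us) X r' ≠ 0 := by
  constructor
  · rw [sub_ne_zero]
    intro he
    have := (H.pt_eq_iff (X := X) (Z := X) (r := r) (r' := r') (x := 0) (y := 0)).1 (by simpa using he)
    have := h (by omega)
    omega
  · rw [sub_ne_zero]
    intro he
    have := (H.pt_eq_iff (X := X) (Z := X) (r := r) (r' := r') (x := -1) (y := 0)).1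
      (by rwa [zpow_neg_one, zpow_zero, mul_one])
    have := h (by omega)
    omega

/-- The hypotheses exclude, in this order, the two poles, the zero at `q₃ p` and the zero at `q₂ p`.
Poles have to be excluded because the value there is `0` by convention. -/
theorem phi_ne_zero (H : Resonant a b q₁ q₂ q₃ u us) {X : Row n → ℤ} {r r' : Row n}
    (h : level b r = level b r' → col a X r ≠ col a X r' ∧ col a X r + 1 ≠ col a X r')
    (h1 : level b r = 1 + level b r' → col a X r ≠ col a X r')
    (h2 : level b r + 1 = level b r' → col a X r + 1 ≠ col a X r') :
    phi q₁ q₂ q₃ (pt q₁ (rowBase q₃ us) X r') (pt q₁ (rowBase q₃ us) X r) ≠ 0 := by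
  have hd := H.phi_den_ne_zero h
  refine div_ne_zero (mul_ne_zero (sub_ne_zero.2 ?_) (sub_ne_zero.2 ?_)) (mul_ne_zero hd.1 hd.2)
  · intro he
    have := (H.pt_eq_iff (X := X) (Z := X) (r := r) (r' := r') (x := 0) (y := 1)).1 (by simpa using he)
    exact h1 (by omega) (by omega)
  · intro he
    rw [H.q2_eq] at he
    have := H.pt_eq_iff.1 he
    exact h2 (by omega) (by omega)

end Resonant

end Coefficients

/-! ### Vanishing and nonvanishing of the coefficients at resonant parameters. -/

section Resonance

variable {n : ℕ} {a b : Fin n → ℕ} {q₁ q₂ q₃ u : ℂ} {us : Fin (n + 1) → ℂ} {X : Row n → ℤ}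
  {L : ℕ} {r : Row n}

/-- A row that cannot be raised is blocked by the previous row of the same partition or by a row
of the previous partition. -/
theorem IsState.blocked_add (h : IsState a b X) (hr : ¬IsState a b (X + Pi.single r 1)) :
    (∃ s, r.2 = s + 1 ∧ X (r.1, s) = X r) ∨
      ∃ (k : Fin n) (s : ℕ), r = (k.succ, s + b k) ∧ X (k.castSucc, s) = X r - a k := by
  by_contra hcon
  push Not at hcon
  obtain ⟨h1, h2⟩ := hcon
  refine hr ⟨fun i s => ?_, fun k s => ?_, ?_⟩
  · have e := h.succ_le i s
    by_cases hi : (i, s + 1) = r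
    · subst hi
      have e1 := h1 s rfl
      simp only [Pi.add_apply, Pi.single_eq_same]
      rw [Pi.single_eq_of_ne (by simp)]
      dsimp only at e1
      omega
    · simp only [Pi.add_apply, Pi.single_eq_of_ne hi]
      by_cases hi' : (i, s) = r
      · subst hi'; simp only [Pi.single_eq_same]; omega
      · rw [Pi.single_eq_of_ne hi']; omega
  · have e := h.sub_le k s
    by_cases hi : (k.succ, s + b k) = r
    · subst hi
      have e1 := h2 k s rfl
      simp only [Pi.add_apply, Pi.single_eq_same]
      rw [Pi.single_eq_of_ne (by simp [Fin.ext_iff])]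
      omega
    · simp only [Pi.add_apply, Pi.single_eq_of_ne hi]
      by_cases hi' : (k.castSucc, s) = r
      · subst hi'; simp only [Pi.single_eq_same]; omega
      · rw [Pi.single_eq_of_ne hi']; omega
  · obtain ⟨N, hN⟩ := h.bounded
    refine ⟨max N (r.2 + 1), fun i s hs => ?_⟩
    have hne : (i, s) ≠ r := by rintro rfl; simp at hs
    rw [Pi.add_apply, Pi.single_eq_of_ne hne, hN i s (by omega), add_zero]

theorem IsState.blocked_sub (h : IsState a b X) (hr : ¬IsState a b (X - Pi.single r 1)) :
    X (r.1, r.2 + 1) = X r ∨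
      ∃ (k : Fin n) (s : ℕ), r = (k.castSucc, s) ∧ X (k.succ, s + b k) - a k = X r := by
  by_contra hcon
  push Not at hcon
  obtain ⟨h1, h2⟩ := hcon
  refine hr ⟨fun i s => ?_, fun k s => ?_, ?_⟩
  · have e := h.succ_le i s
    by_cases hi : (i, s) = r
    · subst hi
      simp only [Pi.sub_apply, Pi.single_eq_same]
      rw [Pi.single_eq_of_ne (by simp)]
      dsimp only at h1
      omega
    · simp only [Pi.sub_apply, Pi.single_eq_of_ne hi]
      by_cases hi' : (i, s + 1) = r
      · subst hi'; simp only [Pi.single_eq_same]; omega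
      · rw [Pi.single_eq_of_ne hi']; omega
  · have e := h.sub_le k s
    by_cases hi : (k.castSucc, s) = r
    · subst hi
      have e1 := h2 k s rfl
      simp only [Pi.sub_apply, Pi.single_eq_same]
      rw [Pi.single_eq_of_ne (by simp [Fin.ext_iff])]
      omega
    · simp only [Pi.sub_apply, Pi.single_eq_of_ne hi]
      by_cases hi' : (k.succ, s + b k) = r
      · subst hi'; simp only [Pi.single_eq_same]; omega
      · rw [Pi.single_eq_of_ne hi']; omega
  · obtain ⟨N, hN⟩ := h.bounded
    refine ⟨max N (r.2 + 1), fun i s hs => ?_⟩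
    have hne : (i, s) ≠ r := by rintro rfl; simp at hs
    rw [Pi.sub_apply, Pi.single_eq_of_ne hne, hN i s (by omega), sub_zero]

/-- The structure function vanishes between two rows of equal length in one partition. -/
theorem phi_eq_zero_of_row_eq {q₁ q₂ q₃ : ℂ} {us : Fin (n + 1) → ℂ} {i : Fin (n + 1)} {s : ℕ}
    (h : X (i, s) = X (i, s + 1)) :
    phi q₁ q₂ q₃ (pt q₁ (rowBase q₃ us) X (i, s)) (pt q₁ (rowBase q₃ us) X (i, s + 1)) = 0 := by
  have : pt q₁ (rowBase q₃ us) X (i, s + 1) = q₃ * pt q₁ (rowBase q₃ us) X (i, s) := by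
    simp only [pt, rowBase, h, pow_succ]; ring
  simp [phi, this]

/-- No condition on the parameters is needed: this zero is present before the specialization and
later absorbs the only possible pole in the diagonal terms. -/
theorem coefE_eq_zero_of_row_eq {q₁ q₂ q₃ : ℂ} {us : Fin (n + 1) → ℂ} (hr : r ∈ rows n L) {s : ℕ}
    (hs : r.2 = s + 1) (h : X (r.1, s) = X r) : coefE q₁ q₂ q₃ us L X r = 0 := by
  obtain ⟨i, t⟩ := r
  obtain rfl : t = s + 1 := hs
  refine mul_eq_zero_of_right _ (Finset.prod_eq_zero (i := (i, s)) ?_ (phi_eq_zero_of_row_eq h))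
  rw [Finset.mem_filter]
  rw [mem_rows] at hr ⊢
  exact ⟨by dsimp only at *; omega, Or.inr ⟨rfl, by simp⟩⟩

/-- A row of equal length below a row blocks its lowering. -/
theorem coefF_eq_zero_of_row_eq {q₁ q₂ q₃ : ℂ} {us : Fin (n + 1) → ℂ}
    (hq : q₁ * q₂ * q₃ = 1) (hR : Room L X) (hr : r ∈ rows n L)
    (h : X (r.1, r.2 + 1) = X r) : coefF q₁ q₂ q₃ us L (X - Pi.single r 1) r = 0 := by
  obtain ⟨i, s⟩ := r
  dsimp only at h
  rw [mem_rows] at hr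
  have h0 := ne_zero_left_of_prod hq
  have hz : ∀ p : ℂ, q₂ * (q₃ * p) = q₁⁻¹ * p := fun p => by
    field_simp
    linear_combination p * hq
  by_cases hs : s + 1 < L
  · refine mul_eq_zero_of_right _ (Finset.prod_eq_zero (i := (i, s + 1)) ?_ ?_)
    · rw [Finset.mem_filter, mem_rows]
      exact ⟨hs, Or.inr ⟨rfl, by simp⟩⟩
    · have e1 : pt q₁ (rowBase q₃ us) (X - Pi.single (i, s) 1) (i, s) =
          q₁⁻¹ * pt q₁ (rowBase q₃ us) X (i, s) := pt_sub_single_self h0 _ _ _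
      have e2 : pt q₁ (rowBase q₃ us) (X - Pi.single (i, s) 1) (i, s + 1) =
          q₃ * pt q₁ (rowBase q₃ us) X (i, s) := by
        rw [pt_sub_single_of_ne _ _ _ (by simp)]
        simp only [pt, rowBase, h, pow_succ]; ring
      rw [e1, e2, phi, hz]
      simp
  -- The next row lies beyond the cut-off, and row `s` itself is empty. The zero now comes from the
  -- tail of the same partition.
  · obtain rfl : L = s + 1 := by dsimp only at hr; omega
    have e1 : q₁ ^ (X - Pi.single (i, s) 1 : Row n → ℤ) (i, s) * rowBase q₃ us (i, s) =
          q₁⁻¹ * (q₃ ^ s * us i) := by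
      rw [Pi.sub_apply, Pi.single_eq_same, hR.eq_zero i s le_rfl, zero_sub, zpow_neg_one]
      rfl
    refine mul_eq_zero_of_left (mul_eq_zero_of_right _ (Finset.prod_eq_zero (Finset.mem_univ i) ?_)) _
    rw [if_pos le_rfl, e1, tailFactor, pow_succ', mul_assoc, hz, sub_self, zero_div]

namespace Resonant

/-- The blocking row produces a zero of `phi`: at `q₃ p` if it is the previous row of the same
partition, at `q₂ p` if it is the row of the previous partition for which the interlacing inequality
is an equality. -/
theorem coefE_eq_zero (H : Resonant a b q₁ q₂ q₃ u us) (hX : IsState a b X) (hr : r ∈ rows n L)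
    (h : ¬IsState a b (X + Pi.single r 1)) : coefE q₁ q₂ q₃ us L X r = 0 := by
  rcases hX.blocked_add h with ⟨s, hs, h⟩ | ⟨k, s, rfl, h⟩
  · exact coefE_eq_zero_of_row_eq hr hs h
  · refine mul_eq_zero_of_right _ (Finset.prod_eq_zero (i := (k.castSucc, s)) ?_
      (H.phi_eq_zero (Or.inr ?_)))
    · rw [Finset.mem_filter]
      rw [mem_rows] at hr ⊢
      exact ⟨by dsimp only at *; omega, Or.inl (by simp [Fin.lt_def])⟩
    · simp only [col, level, offset_succ, h]
      push_cast
      omega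

theorem coefF_eq_zero (H : Resonant a b q₁ q₂ q₃ u us) (hX : IsState a b X) (hR : Room L X)
    (hr : r ∈ rows n L)
    (h : ¬IsState a b (X - Pi.single r 1)) : coefF q₁ q₂ q₃ us L (X - Pi.single r 1) r = 0 := by
  by_cases h1 : X (r.1, r.2 + 1) = X r
  · exact coefF_eq_zero_of_row_eq H.prod_eq_one hR hr h1
  rcases hX.blocked_sub h with h | ⟨k, s, rfl, h⟩
  · exact absurd h h1
  · have hne : (k.succ, s + b k) ≠ (k.castSucc, s) := by simp [Fin.ext_iff]
    refine mul_eq_zero_of_right _ (Finset.prod_eq_zero (i := (k.succ, s + b k)) ?_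
      (H.phi_eq_zero (Or.inl ?_)))
    · rw [Finset.mem_filter, mem_rows]
      refine ⟨?_, Or.inl (by simp [Fin.lt_def])⟩
      -- If the blocking row had index at least `L`, it would be empty. Then the row `(k, s)` and
      -- the row below it would be empty as well, contrary to `h1`.
      by_contra hL
      have h2 := hR.eq_zero k.succ (s + b k) (by dsimp only at hL; omega)
      have h3 := hX.nonneg (k.castSucc, s)
      have h4 := hX.nonneg (k.castSucc, s + 1)
      have h5 := hX.succ_le k.castSucc s
      dsimp only at h1
      omega
    · simp only [col, level, offset_succ, Pi.sub_apply, Pi.single_eq_same, Pi.single_eq_of_ne hne]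
      push_cast
      omega

/-- The inequalities of the target state keep the raised row away from every zero and pole of `phi`.
-/
theorem coefE_ne_zero (H : Resonant a b q₁ q₂ q₃ u us) (hX : IsState a b X) (hr : r ∈ rows n L)
    (h : IsState a b (X + Pi.single r 1)) : coefE q₁ q₂ q₃ us L X r ≠ 0 := by
  refine mul_ne_zero (mul_ne_zero (inv_ne_zero H.one_sub_q1_ne) ?_) ?_
  · refine Finset.prod_ne_zero_iff.2 fun m _ => ?_
    split_ifs
    · exact H.tailFactor_ne_zero hr (hX.nonneg r) m
    · exact one_ne_zero
  · refine Finset.prod_ne_zero_iff.2 fun r' hr' => ?_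
    have hlt := (Finset.mem_filter.1 hr').2
    have hne := (isRowOrder_rowLt n).ne hlt
    have hc1 : col a (X + Pi.single r 1) r = col a X r + 1 := by simp [col]; ring
    have hc2 : col a (X + Pi.single r 1) r' = col a X r' := by simp [col, hne]
    refine H.phi_ne_zero (fun hl => ?_) (fun hl => ?_) (fun hl => ?_)
    · have := h.col_le_of_level_eq hlt hl.symm
      omega
    · have := h.col_le_of_level_add_one_eq hlt (by omega)
      omega
    · have := h.col_le_of_level_eq_add_one hlt (by omega)
      omega

/-- Here `X` is the state reached by lowering, and its own inequalities exclude every zero and pole.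
-/
theorem coefF_ne_zero (H : Resonant a b q₁ q₂ q₃ u us) (hX : IsState a b X)
    (hr : r ∈ rows n L) : coefF q₁ q₂ q₃ us L X r ≠ 0 := by
  refine mul_ne_zero (mul_ne_zero (mul_ne_zero H.q1_ne (inv_ne_zero H.one_sub_q1_ne)) ?_) ?_
  · refine Finset.prod_ne_zero_iff.2 fun m _ => ?_
    split_ifs
    · exact H.tailFactor_ne_zero hr (hX.nonneg r) m
    · exact one_ne_zero
  · refine Finset.prod_ne_zero_iff.2 fun r' hr' => ?_
    have hlt := (Finset.mem_filter.1 hr').2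
    refine H.phi_ne_zero (fun hl => ?_) (fun hl => ?_) (fun hl => ?_)
    · have := hX.col_le_of_level_eq hlt hl
      omega
    · have := hX.col_le_of_level_eq_add_one hlt (by omega)
      omega
    · have := hX.col_le_of_level_add_one_eq hlt (by omega)
      omega

/-- Weights of rows do not collide along a path of at most three raisings. -/
theorem pt_ne_of_path (H : Resonant a b q₁ q₂ q₃ u us) {D : Row n → ℤ} (hX : IsState a b X)
    (hXD : IsState a b (X + D)) {T : Finset (Row n)} (hT : T.card ≤ 3) (hD : ∀ r ∉ T, D r = 0)
    {r' : Row n} (hr : rowLt r' r) {m : ℤ} (hm : m ≤ D r) :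
    pt q₁ (rowBase q₃ us) X r' ≠ q₁ ^ m * pt q₁ (rowBase q₃ us) X r := by
  intro he
  have := (H.pt_eq_iff (X := X) (Z := X) (r := r') (r' := r) (x := m) (y := 0)).1 (by simpa using he)
  have := hX.col_add_le hXD hT hD hr (by omega)
  omega

/-- `IsState.col_add_le` is applied to the path run backwards, from `X - D` to `X`. -/
theorem pt_ne_of_path_low (H : Resonant a b q₁ q₂ q₃ u us) {D : Row n → ℤ} (hX : IsState a b X)
    (hXD : IsState a b (X - D)) {T : Finset (Row n)} (hT : T.card ≤ 3) (hD : ∀ r ∉ T, D r = 0)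
    {r' : Row n} (hr : rowLt r' r) {m : ℤ} (hm : m ≤ D r') :
    q₁ ^ m * pt q₁ (rowBase q₃ us) X r ≠ pt q₁ (rowBase q₃ us) X r' := by
  intro he
  have := (H.pt_eq_iff (X := X) (Z := X) (r := r') (r' := r) (x := m) (y := 0)).1 (by simpa using he.symm)
  have h1 := hXD.col_add_le (D := D) (by rwa [sub_add_cancel]) hT hD hr (by omega)
  simp only [col, Pi.sub_apply] at h1 this
  omega

end Resonant

end Resonance

/-! ## The operators on `M_{a,b}` -/

section Operators

variable {n : ℕ} {a b : Fin n → ℕ} {q₁ q₂ q₃ u : ℂ} {us : Fin (n + 1) → ℂ} {X : Row n → ℤ}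
  {L : ℕ} {r : Row n}

/-- If a row beyond the new cut-off were nonempty, all rows from `L - 1` to this one would be
nonempty. They are empty in `X`, so they all belong to `T`, which is too small. -/
theorem Room.add_of_card {D : Row n → ℤ} (h : Room L X) (hX : IsState a b (X + D)) {d : ℕ}
    {T : Finset (Row n)} (hT : T.card ≤ d) (hD : ∀ r ∉ T, D r = 0) : Room (L + d) (X + D) := by
  have hL := h.pos
  refine ⟨by omega, fun i s hs => ?_⟩
  by_contra hne
  have hpos := lt_of_le_of_ne (hX.nonneg (i, s)) (Ne.symm hne)
  have hsub : (Finset.Icc (L - 1) s).image (fun t => (i, t)) ⊆ T := by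
    intro x hx
    obtain ⟨t, ht, rfl⟩ := Finset.mem_image.1 hx
    rw [Finset.mem_Icc] at ht
    by_contra hxT
    have h1 := hX.antitone i ht.2
    simp only [Pi.add_apply, hD _ hxT, h.eq_zero i t (by omega)] at h1 hpos
    omega
  have hcard := Finset.card_le_card hsub
  rw [Finset.card_image_of_injective _ (Prod.mk_right_injective i), Nat.card_Icc] at hcard
  omega

theorem Room.sub_of_nonneg {D : Row n → ℤ} (h : Room L X) (hX : IsState a b (X - D))
    (hD : 0 ≤ D) : Room L (X - D) := by
  refine ⟨h.pos, fun i s hs => ?_⟩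
  have h1 := hX.nonneg (i, s)
  have h2 : (0 : ℤ) ≤ D (i, s) := hD (i, s)
  simp only [Pi.sub_apply, h.eq_zero i s hs] at h1 ⊢
  omega

theorem Room.add_of_isState (h : Room L X) (hX : IsState a b (X + Pi.single r 1)) :
    Room (L + 1) (X + Pi.single r 1) :=
  h.add_of_card hX (T := {r}) (Finset.card_singleton r).le fun x hx => by
    rw [Pi.single_eq_of_ne (by simpa using hx)]

theorem Room.sub_of_isState (h : Room L X) (hX : IsState a b (X - Pi.single r 1)) :
    Room L (X - Pi.single r 1) :=
  h.sub_of_nonneg hX fun x => by by_cases h : x = r <;> simp [h]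

theorem Room.mem_rows_of_isState (h : Room L X) (hX : IsState a b (X - Pi.single r 1)) :
    r ∈ rows n L := by
  rw [mem_rows]
  by_contra hr
  have h1 := hX.nonneg r
  have h2 := h.eq_zero r.1 r.2 (by omega)
  simp only [Pi.sub_apply, Pi.single_eq_same] at h1
  rw [Prod.mk.eta] at h2
  omega

theorem Room.mem_rows_of_isState_add (h : Room L X) (hX : IsState a b (X + Pi.single r 1)) :
    r ∈ rows n L := by
  have hX0 := (h.add_of_isState hX).eq_zero r.1 r.2
  have h2 := h.eq_zero r.1 r.2
  rw [Prod.mk.eta] at hX0 h2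
  rw [mem_rows]
  by_contra hr
  have := hX0 (by omega)
  have := h2 (by omega)
  simp only [Pi.add_apply, Pi.single_eq_same] at *
  omega

/-- The number of rows that are taken into account for a label. -/
def Label.room (lam : Label a b) : ℕ := lam.isState.exists_room.choose

theorem Label.room_spec (lam : Label a b) : Room lam.room lam.state :=
  lam.isState.exists_room.choose_spec

/-- The image of `X` under `e_k`. -/
def sumE (a b : Fin n → ℕ) (q₁ q₂ q₃ : ℂ) (us : Fin (n + 1) → ℂ) (L : ℕ) (k : ℤ)
    (X : Row n → ℤ) : MSpace a b :=
  ∑ r ∈ rows n L, (coefE q₁ q₂ q₃ us L X r * pt q₁ (rowBase q₃ us) X r ^ k) •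
    ketOf a b (X + Pi.single r 1)

/-- The image of `X` under `f_k`. -/
def sumF (a b : Fin n → ℕ) (q₁ q₂ q₃ : ℂ) (us : Fin (n + 1) → ℂ) (L : ℕ) (k : ℤ)
    (X : Row n → ℤ) : MSpace a b :=
  ∑ r ∈ rows n L, (coefF q₁ q₂ q₃ us L (X - Pi.single r 1) r *
    pt q₁ (rowBase q₃ us) (X - Pi.single r 1) r ^ k) • ketOf a b (X - Pi.single r 1)

/-- The operator `e_k`. -/
def opE (a b : Fin n → ℕ) (q₁ q₂ q₃ : ℂ) (us : Fin (n + 1) → ℂ) (k : ℤ) :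
    Module.End ℂ (MSpace a b) :=
  Finsupp.linearCombination ℂ fun lam => sumE a b q₁ q₂ q₃ us lam.room k lam.state

/-- The operator `f_k`. -/
def opF (a b : Fin n → ℕ) (q₁ q₂ q₃ : ℂ) (us : Fin (n + 1) → ℂ) (k : ℤ) :
    Module.End ℂ (MSpace a b) :=
  Finsupp.linearCombination ℂ fun lam => sumF a b q₁ q₂ q₃ us lam.room k lam.state

theorem linearCombination_ket (g : Label a b → MSpace a b) (lam : Label a b) :
    Finsupp.linearCombination ℂ g (ket lam) = g lam := by
  simp [ket]

theorem end_ext {A B : Module.End ℂ (MSpace a b)} (h : ∀ lam, A (ket lam) = B (ket lam)) :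
    A = B := by
  refine Finsupp.lhom_ext fun lam c => ?_
  have : (Finsupp.single lam c : MSpace a b) = c • ket lam := by simp [ket]
  rw [this, map_smul, map_smul, h]

/-- A function of `L` that is constant as soon as there is enough room does not depend on `L`. -/
theorem Room.eq_of_succ {M : Type*} {g : ℕ → M} (hg : ∀ L, Room L X → g L = g (L + 1)) {L L' : ℕ}
    (h : Room L X) (h' : Room L' X) : g L = g L' := by
  have key : ∀ L L', Room L X → L ≤ L' → g L = g L' := by
    intro L L' h hL
    induction L', hL using Nat.le_induction with
    | base => rfl
    | succ m hm ih => rw [ih, hg m (h.mono hm)]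
  rcases le_total L L' with hL | hL
  · exact key _ _ h hL
  · exact (key _ _ h' hL).symm

namespace Resonant

theorem sumE_succ (H : Resonant a b q₁ q₂ q₃ u us) (hX : IsState a b X) (k : ℤ) (h : Room L X) :
    sumE a b q₁ q₂ q₃ us L k X = sumE a b q₁ q₂ q₃ us (L + 1) k X := by
  unfold sumE
  rw [← Finset.sum_subset (rows_subset_succ n L)]
  · exact Finset.sum_congr rfl fun r hr => by rw [H.coefE_succ h hr (hX.nonneg r)]
  · intro r _ hr
    rw [ketOf_of_not fun hs => hr (h.mem_rows_of_isState_add hs), smul_zero]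

theorem sumF_succ (H : Resonant a b q₁ q₂ q₃ u us) (k : ℤ) (h : Room L X) :
    sumF a b q₁ q₂ q₃ us L k X = sumF a b q₁ q₂ q₃ us (L + 1) k X := by
  unfold sumF
  rw [← Finset.sum_subset (rows_subset_succ n L)]
  · refine Finset.sum_congr rfl fun r hr => ?_
    by_cases hs : IsState a b (X - Pi.single r 1)
    · rw [H.coefF_succ (h.sub_of_isState hs) hr (hs.nonneg r)]
    · rw [ketOf_of_not hs, smul_zero, smul_zero]
  · intro r _ hr
    rw [ketOf_of_not fun hs => hr (h.mem_rows_of_isState hs), smul_zero]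

theorem opE_ketOf (H : Resonant a b q₁ q₂ q₃ u us) (hX : IsState a b X) (k : ℤ) (h : Room L X) :
    opE a b q₁ q₂ q₃ us k (ketOf a b X) = sumE a b q₁ q₂ q₃ us L k X := by
  obtain ⟨lam, rfl⟩ := hX.exists_label
  rw [ketOf_state, opE, linearCombination_ket]
  exact lam.room_spec.eq_of_succ (g := fun L => sumE a b q₁ q₂ q₃ us L k lam.state)
    (fun L hL => H.sumE_succ hX k hL) h

theorem opF_ketOf (H : Resonant a b q₁ q₂ q₃ u us) (hX : IsState a b X) (k : ℤ) (h : Room L X) :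
    opF a b q₁ q₂ q₃ us k (ketOf a b X) = sumF a b q₁ q₂ q₃ us L k X := by
  obtain ⟨lam, rfl⟩ := hX.exists_label
  rw [ketOf_state, opF, linearCombination_ket]
  exact lam.room_spec.eq_of_succ (g := fun L => sumF a b q₁ q₂ q₃ us L k lam.state)
    (fun L hL => H.sumF_succ k hL) h

theorem expands (H : Resonant a b q₁ q₂ q₃ u us) (hX : IsState a b X) (h : Room L X) :
    Expands (opE a b q₁ q₂ q₃ us) (ketOf a b) (coefE q₁ q₂ q₃ us L) (pt q₁ (rowBase q₃ us))
      (rows n L) X where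
  apply k := H.opE_ketOf hX k h
  eq_zero _ hr hk := H.coefE_eq_zero hX hr fun hs => ketOf_ne_zero_iff.2 hs hk

theorem expandsLow (H : Resonant a b q₁ q₂ q₃ u us) (hX : IsState a b X) (h : Room L X) :
    ExpandsLow (opF a b q₁ q₂ q₃ us) (ketOf a b) (coefF q₁ q₂ q₃ us L) (pt q₁ (rowBase q₃ us))
      (rows n L) X where
  apply k := H.opF_ketOf hX k h
  eq_zero _ hr hk := H.coefF_eq_zero hX h hr fun hs => ketOf_ne_zero_iff.2 hs hk

/-- The cut-off `L + 1` serves every state of the path to which an operator is applied; the Serre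
relation needs `L + 2` for the same reason. -/
theorem opE_quadratic (H : Resonant a b q₁ q₂ q₃ u us) (i j : ℤ) :
    mulGzw q₁ q₂ q₃ (prodZW (opE a b q₁ q₂ q₃ us) (opE a b q₁ q₂ q₃ us)) i j =
      -mulGwz q₁ q₂ q₃ (prodWZ (opE a b q₁ q₂ q₃ us) (opE a b q₁ q₂ q₃ us)) i j := by
  refine end_ext fun lam => ?_
  have hX := lam.isState
  obtain ⟨L, hL⟩ := hX.exists_room
  rw [← ketOf_state]
  have e1 : ∀ (L : ℕ), (fun X r => 1 * pt q₁ (rowBase q₃ us) X r : (Row n → ℤ) → Row n → ℂ) =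
    pt q₁ (rowBase q₃ us) := fun _ => by simp
  refine quadratic_relation (γ := 1) (c := rowBase q₃ us) (lt := rowLt)
    (τ := extE q₁ q₂ q₃ us (L + 1)) (S := rows n (L + 1)) H.prod_eq_one
    (isRowOrder_rowLt n) one_ne_zero H.rowBase_ne ?_ (fun r _ hk => ?_) (fun r s hrs hk => ?_) i j
  · simp only [one_mul]
    exact H.expands hX (hL.mono (by omega))
  · simp only [one_mul]
    exact H.expands (ketOf_ne_zero_iff.1 hk) (hL.add_of_isState (ketOf_ne_zero_iff.1 hk))
  · have hXD := ketOf_ne_zero_iff.1 hk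
    rw [add_assoc] at hXD
    have key := fun (m : ℤ) hm => H.pt_ne_of_path (m := m) hX hXD (T := {r, s}) (Finset.card_le_two.trans
      (by norm_num)) (fun x hx => by
        simp only [Finset.mem_insert, Finset.mem_singleton, not_or] at hx
        simp [hx.1, hx.2]) hrs hm
    have hne := (isRowOrder_rowLt n).ne hrs
    constructor
    · intro he
      refine key (-1) (by simp [hne.symm]) ?_
      rw [he, zpow_neg_one, inv_mul_cancel_left₀ H.q1_ne]
    · intro he
      refine key 1 (by simp [hne.symm]) ?_
      rw [← he, zpow_one]

theorem opF_quadratic (H : Resonant a b q₁ q₂ q₃ u us) (i j : ℤ) :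
    mulGwz q₁ q₂ q₃ (prodZW (opF a b q₁ q₂ q₃ us) (opF a b q₁ q₂ q₃ us)) i j =
      -mulGzw q₁ q₂ q₃ (prodWZ (opF a b q₁ q₂ q₃ us) (opF a b q₁ q₂ q₃ us)) i j := by
  refine end_ext fun lam => ?_
  have hX := lam.isState
  obtain ⟨L, hL⟩ := hX.exists_room
  rw [← ketOf_state]
  refine quadratic_relation_low (c := rowBase q₃ us) (lt := fun r s => rowLt s r)
    (τ := extF q₁ q₂ q₃ us L) (S := rows n L) H.prod_eq_one
    (isRowOrder_rowLt n).swap H.rowBase_ne (H.expandsLow hX hL) (fun r _ hk => ?_)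
    (fun r s hrs hk => ?_) i j
  · exact H.expandsLow (ketOf_ne_zero_iff.1 hk) (hL.sub_of_isState (ketOf_ne_zero_iff.1 hk))
  · have hXD := ketOf_ne_zero_iff.1 hk
    rw [sub_sub] at hXD
    have key := fun (m : ℤ) hm => H.pt_ne_of_path_low (m := m) hX hXD (T := {r, s})
      (Finset.card_le_two.trans (by norm_num)) (fun x hx => by
        simp only [Finset.mem_insert, Finset.mem_singleton, not_or] at hx
        simp [hx.1, hx.2]) hrs hm
    have hne := (isRowOrder_rowLt n).ne hrs
    constructor
    · intro he
      refine key (-1) (by simp [hne]) ?_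
      rw [he, zpow_neg_one, inv_mul_cancel_left₀ H.q1_ne]
    · intro he
      refine key 1 (by simp [hne]) ?_
      rw [← he, zpow_one]

theorem opE_serre (H : Resonant a b q₁ q₂ q₃ u us) :
    ⁅opE a b q₁ q₂ q₃ us 0, ⁅opE a b q₁ q₂ q₃ us 1, opE a b q₁ q₂ q₃ us (-1)⁆⁆ = 0 := by
  refine end_ext fun lam => ?_
  have hX := lam.isState
  obtain ⟨L, hL⟩ := hX.exists_room
  rw [← ketOf_state, LinearMap.zero_apply]
  refine serre_relation (γ := 1) (c := rowBase q₃ us) (lt := rowLt)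
    (τ := extE q₁ q₂ q₃ us (L + 2)) (S := rows n (L + 2)) H.prod_eq_one
    (isRowOrder_rowLt n) one_ne_zero H.rowBase_ne ?_ (fun r _ hk => ?_) (fun r _ s _ hk => ?_)
    (fun r s t hk r' s' hrs m hm => ?_)
  · simp only [one_mul]
    exact H.expands hX (hL.mono (by omega))
  · simp only [one_mul]
    exact H.expands (ketOf_ne_zero_iff.1 hk)
      ((hL.add_of_isState (ketOf_ne_zero_iff.1 hk)).mono (by omega))
  · simp only [one_mul]
    have hk' := ketOf_ne_zero_iff.1 hk
    rw [add_assoc] at hk' ⊢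
    exact H.expands hk' (hL.add_of_card hk' (T := {r, s}) Finset.card_le_two fun x hx => by
      simp only [Finset.mem_insert, Finset.mem_singleton, not_or] at hx
      simp [hx.1, hx.2])
  · have hXD := ketOf_ne_zero_iff.1 hk
    rw [add_assoc, add_assoc, ← add_assoc (Pi.single r 1)] at hXD
    exact H.pt_ne_of_path (m := m) hX hXD (T := {r, s, t}) Finset.card_le_three (fun x hx => by
        simp only [Finset.mem_insert, Finset.mem_singleton, not_or] at hx
        simp [hx.1, hx.2.1, hx.2.2]) hrs hm

theorem opF_serre (H : Resonant a b q₁ q₂ q₃ u us) :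
    ⁅opF a b q₁ q₂ q₃ us 0, ⁅opF a b q₁ q₂ q₃ us 1, opF a b q₁ q₂ q₃ us (-1)⁆⁆ = 0 := by
  refine end_ext fun lam => ?_
  have hX := lam.isState
  obtain ⟨L, hL⟩ := hX.exists_room
  rw [← ketOf_state, LinearMap.zero_apply]
  refine serre_relation_low (c := rowBase q₃ us) (lt := fun r s => rowLt s r)
    (τ := extF q₁ q₂ q₃ us L) (S := rows n L) H.prod_eq_one
    (isRowOrder_rowLt n).swap H.rowBase_ne (H.expandsLow hX hL) (fun r _ hk => ?_)
    (fun r _ s _ hk => ?_) (fun r s t hk r' s' hrs m hm => ?_)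
  · exact H.expandsLow (ketOf_ne_zero_iff.1 hk) (hL.sub_of_isState (ketOf_ne_zero_iff.1 hk))
  · have hk' := ketOf_ne_zero_iff.1 hk
    rw [sub_sub] at hk' ⊢
    exact H.expandsLow hk' (hL.sub_of_nonneg hk' fun x => add_nonneg
      (by by_cases h : x = r <;> simp [h])
      (by by_cases h : x = s <;> simp [h]))
  · have hXD := ketOf_ne_zero_iff.1 hk
    rw [sub_sub, sub_sub, ← add_assoc] at hXD
    exact H.pt_ne_of_path_low (m := m) hX hXD (T := {r, s, t}) Finset.card_le_three (fun x hx => by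
        simp only [Finset.mem_insert, Finset.mem_singleton, not_or] at hx
        simp [hx.1, hx.2.1, hx.2.2]) hrs hm

theorem commutator_opE_opF (H : Resonant a b q₁ q₂ q₃ u us) (hX : IsState a b X) (hL : Room L X)
    (i j : ℤ) :
    (opE a b q₁ q₂ q₃ us i * opF a b q₁ q₂ q₃ us j -
        opF a b q₁ q₂ q₃ us j * opE a b q₁ q₂ q₃ us i) (ketOf a b X) =
      (∑ r ∈ rows n (L + 1), (coefE q₁ q₂ q₃ us (L + 1) (X - Pi.single r 1) r *
          coefF q₁ q₂ q₃ us (L + 1) (X - Pi.single r 1) r *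
          pt q₁ (rowBase q₃ us) (X - Pi.single r 1) r ^ (i + j) -
        coefE q₁ q₂ q₃ us (L + 1) X r * coefF q₁ q₂ q₃ us (L + 1) X r *
          pt q₁ (rowBase q₃ us) X r ^ (i + j))) • ketOf a b X := by
  refine commutator_relation (c := rowBase q₃ us) (lt := rowLt)
    (τ := extE q₁ q₂ q₃ us (L + 1)) (τ' := extF q₁ q₂ q₃ us (L + 1)) (S := rows n (L + 1))
    H.prod_eq_one (isRowOrder_rowLt n) H.rowBase_ne (H.expands hX (hL.mono (by omega)))
    (H.expandsLow hX (hL.mono (by omega))) (fun r _ hk => ?_) (fun r _ hk => ?_) i j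
  · exact H.expands (ketOf_ne_zero_iff.1 hk)
      ((hL.sub_of_isState (ketOf_ne_zero_iff.1 hk)).mono (by omega))
  · exact H.expandsLow (ketOf_ne_zero_iff.1 hk) (hL.add_of_isState (ketOf_ne_zero_iff.1 hk))

end Resonant

end Operators

/-! ## Eigenvalues and matrix coefficients on Fock modules as finite products -/

section Eigenvalues

variable {K : Type*} [Field K] (ι : ℂ →+* K) {q₁ q₂ q₃ : ℂ}

theorem one_sub_mul_div (c w : ℂ) {z : K} (hz : z ≠ 0) :
    1 - ι c * (ι w / z) = (z - ι (c * w)) / z := by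
  rw [map_mul]; field_simp

theorem one_sub_mul_div' {c w : ℂ} (hc : c ≠ 0) (hw : w ≠ 0) (z : K) :
    1 - ι c⁻¹ * (z / ι w) = -(z - ι (c * w)) / ι (c * w) := by
  have h1 : ι c ≠ 0 := by simpa using hc
  have h2 : ι w ≠ 0 := by simpa using hw
  rw [map_mul, map_inv₀]; field_simp; ring

theorem psiEmptyPlus_eq (w : ℂ) {z : K} (hz : z ≠ 0) :
    psiEmptyPlus ι q₂ (ι w / z) = tailFactor (ι q₂) (ι w) z := by
  have h := one_sub_mul_div ι 1 w hz
  rw [map_one, one_mul, one_mul] at h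
  rw [psiEmptyPlus, tailFactor, one_sub_mul_div ι _ _ hz, h, div_div_div_cancel_right₀ hz, map_mul]

theorem psiEmptyMinus_eq (h2 : q₂ ≠ 0) {w : ℂ} (hw : w ≠ 0) (z : K) :
    psiEmptyMinus ι q₂ (z / ι w) = tailFactor (ι q₂) (ι w) z := by
  have h := one_sub_mul_div' ι one_ne_zero hw z
  have h2' : ι q₂ ≠ 0 := by simpa using h2
  have hw' : ι w ≠ 0 := by simpa using hw
  rw [inv_one, map_one, one_mul, one_mul] at h
  rw [psiEmptyMinus, tailFactor, one_sub_mul_div' ι h2 hw, h, map_mul]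
  rw [div_div_eq_mul_div, ← mul_div_assoc]
  rw [show ι q₂ * (-(z - ι q₂ * ι w) / (ι q₂ * ι w) * ι w) = -(z - ι q₂ * ι w) by field_simp,
    neg_div_neg_eq]

/-- The shifts by `j` of the basis vector and of the evaluation parameter of a vector module combine
to `q₁ ^ (-j) q₂ ^ (-j) = q₃ ^ j`. -/
theorem rowPsiPlus_eq (hq : q₁ * q₂ * q₃ = 1) (l : Partition) (j : ℕ) (w : ℂ) {z : K}
    (hz : z ≠ 0) :
    rowPsiPlus ι q₁ q₂ q₃ l j (ι w / z) =
      phi (ι q₁) (ι q₂) (ι q₃) (ι (q₁ ^ l.1 j * (q₃ ^ j * w))) z := by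
  have h1 := ne_zero_left_of_prod hq
  have h2 := ne_zero_mid_of_prod hq
  have e : ∀ c : ℂ, ι (q₁ ^ (l.1 j - j) * c) * (ι (q₂ ^ (-(j : ℤ))) * (ι w / z)) =
      ι c * (ι (q₁ ^ l.1 j * (q₃ ^ j * w)) / z) := by
    intro c
    have : q₁ ^ (l.1 j - j) * q₂ ^ (-(j : ℤ)) = q₁ ^ l.1 j * q₃ ^ j := by
      have e3 : q₃ = (q₁ * q₂)⁻¹ := eq_inv_of_mul_eq_one_right hq
      rw [e3, sub_eq_add_neg, zpow_add₀ h1, zpow_neg, zpow_neg, zpow_natCast, zpow_natCast,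
        inv_pow, mul_pow, mul_inv]
      ring
    rw [mul_div_assoc', mul_div_assoc', mul_div_assoc', ← map_mul, ← map_mul, ← map_mul]
    congr 2
    linear_combination (c * w) * this
  have e0 := e 1
  rw [mul_one] at e0
  rw [rowPsiPlus, vecPsiPlus, e, e, e0, zpow_sub_one₀ h1, e, one_sub_mul_div ι _ _ hz,
    one_sub_mul_div ι _ _ hz, one_sub_mul_div ι _ _ hz, one_sub_mul_div ι _ _ hz,
    div_mul_div_comm, div_mul_div_comm, div_div_div_cancel_right₀ (mul_ne_zero hz hz), phi, one_mul]
  simp only [map_mul, map_inv₀]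

/-- This is the rational function of `rowPsiPlus_eq` again: the constants from rewriting it in `z /
w` cancel because `q₂ q₃ = q₁⁻¹`. -/
theorem rowPsiMinus_eq (hq : q₁ * q₂ * q₃ = 1) (l : Partition) (j : ℕ) {w : ℂ} (hw : w ≠ 0)
    (z : K) :
    rowPsiMinus ι q₁ q₂ q₃ l j (z / ι w) =
      phi (ι q₁) (ι q₂) (ι q₃) (ι (q₁ ^ l.1 j * (q₃ ^ j * w))) z := by
  have h1 := ne_zero_left_of_prod hq
  have h2 := ne_zero_mid_of_prod hq
  have h3 := ne_zero_right_of_prod hq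
  set p := q₁ ^ l.1 j * (q₃ ^ j * w) with hp
  have hp0 : p ≠ 0 := mul_ne_zero (zpow_ne_zero _ h1) (mul_ne_zero (pow_ne_zero _ h3) hw)
  have e : ∀ c : ℂ, ι (q₁ ^ (-(l.1 j - j)) * c) * (ι (q₂ ^ (j : ℤ)) * (z / ι w)) =
      ι c * (z / ι p) := by
    intro c
    have : q₁ ^ (-(l.1 j - j)) * q₂ ^ (j : ℤ) * w⁻¹ = p⁻¹ := by
      have e3 : q₃ = (q₁ * q₂)⁻¹ := eq_inv_of_mul_eq_one_right hq
      rw [hp, e3, neg_sub, sub_eq_add_neg, zpow_add₀ h1, zpow_neg, zpow_natCast, zpow_natCast,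
        inv_pow, mul_pow, mul_inv, mul_inv, inv_inv]
      ring
    rw [div_eq_mul_inv, div_eq_mul_inv, ← map_inv₀, ← map_inv₀, ← this]
    simp only [map_mul]
    ring
  have e0 := e 1
  rw [mul_one] at e0
  have hz1 := one_sub_mul_div' ι one_ne_zero hp0 z
  rw [inv_one, one_mul] at hz1
  have hz2 := one_sub_mul_div' ι (inv_ne_zero h1) hp0 z
  rw [inv_inv] at hz2
  rw [rowPsiMinus, vecPsiMinus, e, e, e0, zpow_add_one₀ h1, e, one_sub_mul_div' ι h2 hp0,
    one_sub_mul_div' ι h3 hp0, hz1, hz2,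
    div_mul_div_comm, div_mul_div_comm]
  have hd : ι (q₃ * p) * ι (q₂ * p) = ι p * ι (q₁⁻¹ * p) := by
    rw [← map_mul, ← map_mul]
    congr 1
    field_simp
    linear_combination hq
  have hd0 : ι p * ι (q₁⁻¹ * p) ≠ 0 := by
    exact mul_ne_zero (by simpa using hp0) (by simpa using ⟨h1, hp0⟩)
  rw [hd, div_div_div_cancel_right₀ hd0, phi, neg_mul_neg, neg_mul_neg]
  simp only [map_mul, map_inv₀]

theorem tailFactor_telescope (hq : q₁ * q₂ * q₃ = 1) (w : ℂ) {z : K} {N L : ℕ} (hNL : N ≤ L)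
    (h1 : ∀ j, N ≤ j → z ≠ ι (q₃ ^ (j + 1) * w)) (h2 : ∀ j, N ≤ j → z ≠ ι (q₁⁻¹ * (q₃ ^ j * w))) :
    tailFactor (ι q₂) (ι (q₃ ^ N * w)) z = tailFactor (ι q₂) (ι (q₃ ^ L * w)) z *
      ∏ j ∈ Finset.Ico N L, phi (ι q₁) (ι q₂) (ι q₃) (ι (q₃ ^ j * w)) z := by
  have hq' : ι q₁ * ι q₂ * ι q₃ = 1 := by rw [← map_mul, ← map_mul, hq, map_one]
  induction L, hNL using Nat.le_induction with
  | base => simp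
  | succ L hL ih =>
    rw [ih, tailFactor_eq hq' (by rw [← map_mul, ← mul_assoc, ← pow_succ']; exact h1 L hL)
      (by rw [← map_inv₀, ← map_mul]; exact h2 L hL), Finset.prod_Ico_succ_top hL, ← map_mul,
      ← mul_assoc, ← pow_succ']
    ring

/-- Products over rows are compared with the vacuum up to the row `L`. -/
theorem tailFactor_mul_prod (hq : q₁ * q₂ * q₃ = 1) (w : ℂ) {z : K} {N L : ℕ} (hNL : N ≤ L)
    (f : ℕ → K) (h1 : ∀ j, N ≤ j → z ≠ ι (q₃ ^ (j + 1) * w))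
    (h2 : ∀ j, N ≤ j → z ≠ ι (q₁⁻¹ * (q₃ ^ j * w)))
    (h3 : ∀ j, N ≤ j → phi (ι q₁) (ι q₂) (ι q₃) (ι (q₃ ^ j * w)) z ≠ 0) :
    tailFactor (ι q₂) (ι (q₃ ^ N * w)) z *
      ∏ j ∈ Finset.Ico N L, f j / phi (ι q₁) (ι q₂) (ι q₃) (ι (q₃ ^ j * w)) z =
    tailFactor (ι q₂) (ι (q₃ ^ L * w)) z * ∏ j ∈ Finset.Ico N L, f j := by
  rw [tailFactor_telescope ι hq w hNL h1 h2, mul_assoc, ← Finset.prod_mul_distrib]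
  congr 1
  refine Finset.prod_congr rfl fun j hj => ?_
  rw [mul_div_cancel₀ _ (h3 j (Finset.mem_Ico.1 hj).1)]

theorem phi_ne_zero_of_ne {p z : K} {q₁ q₂ q₃ : K} (h1 : z ≠ q₃ * p) (h2 : z ≠ q₂ * p)
    (h3 : z ≠ p) (h4 : z ≠ q₁⁻¹ * p) : phi q₁ q₂ q₃ p z ≠ 0 :=
  div_ne_zero (mul_ne_zero (sub_ne_zero.2 h1) (sub_ne_zero.2 h2))
    (mul_ne_zero (sub_ne_zero.2 h3) (sub_ne_zero.2 h4))

theorem q2_eq_of_prod (hq : q₁ * q₂ * q₃ = 1) : q₂ = q₁ ^ (-1 : ℤ) * q₃ ^ (-1 : ℤ) := by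
  have := ne_zero_left_of_prod hq
  have := ne_zero_right_of_prod hq
  rw [zpow_neg_one, zpow_neg_one]
  field_simp
  linear_combination hq

theorem phi_vacuum_ne_zero (hq : q₁ * q₂ * q₃ = 1) (w : ℂ) {z : K}
    (hz : ∀ x y : ℤ, z ≠ ι (q₁ ^ x * q₃ ^ y * w)) (j : ℕ) :
    phi (ι q₁) (ι q₂) (ι q₃) (ι (q₃ ^ j * w)) z ≠ 0 := by
  have h3 := ne_zero_right_of_prod hq
  refine phi_ne_zero_of_ne ?_ ?_ ?_ ?_
  · have := hz 0 (j + 1)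
    rwa [zpow_zero, one_mul, zpow_add_one₀ h3, zpow_natCast, mul_comm (q₃ ^ j), mul_assoc,
      map_mul] at this
  · have := hz (-1) (-1 + j)
    rwa [zpow_add₀ h3, ← mul_assoc, ← q2_eq_of_prod hq, mul_assoc, zpow_natCast, map_mul] at this
  · simpa using hz 0 j
  · have := hz (-1) j
    rwa [zpow_neg_one, mul_assoc, zpow_natCast, map_mul, map_inv₀] at this

/-- From row `L` on, numerator and denominator agree; nonvanishing of the vacuum factors is needed
for the quotient to be `1`. -/
theorem finprod_row_eq {l : Partition} {L : ℕ} (hl : ∀ j, L ≤ j → l.1 j = 0) {f g : ℕ → K}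
    (hfg : ∀ j, l.1 j = 0 → f j = g j) (hg : ∀ j, g j ≠ 0) :
    ∏ᶠ j, f j / g j = ∏ j ∈ Finset.Ico 0 L, f j / g j := by
  refine finprod_eq_prod_of_mulSupport_subset _ fun j hj => ?_
  by_contra hL
  refine hj ?_
  change f j / g j = 1
  rw [hfg j (hl j (by simpa using hL)), div_self (hg j)]

/-- The eigenvalue of `ψ⁺(z)` as a finite product. -/
theorem fockPsiPlus_eq (hq : q₁ * q₂ * q₃ = 1) {l : Partition} {L : ℕ}
    (hl : ∀ j, L ≤ j → l.1 j = 0) (w : ℂ) {z : K} (hz0 : z ≠ 0)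
    (hz : ∀ x y : ℤ, z ≠ ι (q₁ ^ x * q₃ ^ y * w)) :
    fockPsiPlus ι q₁ q₂ q₃ l (ι w / z) = tailFactor (ι q₂) (ι (q₃ ^ L * w)) z *
      ∏ j ∈ Finset.range L, phi (ι q₁) (ι q₂) (ι q₃) (ι (q₁ ^ l.1 j * (q₃ ^ j * w))) z := by
  have h3 := phi_vacuum_ne_zero ι hq w hz
  have key := tailFactor_mul_prod ι hq w (N := 0) (L := L) (Nat.zero_le L)
    (fun j => phi (ι q₁) (ι q₂) (ι q₃) (ι (q₁ ^ l.1 j * (q₃ ^ j * w))) z)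
    (fun j _ => by
      have := hz 0 (j + 1 : ℕ)
      rwa [zpow_zero, one_mul, zpow_natCast] at this)
    (fun j _ => by simpa [mul_assoc] using hz (-1) j) (fun j _ => h3 j)
  rw [pow_zero, one_mul] at key
  rw [fockPsiPlus, psiEmptyPlus_eq ι w hz0, Finset.range_eq_Ico, ← key]
  simp only [rowPsiPlus_eq ι hq _ _ w hz0]
  congr 1
  have he : ∀ j, (Partition.empty.1 j : ℤ) = 0 := fun j => rfl
  simp only [he, zpow_zero, one_mul]
  exact finprod_row_eq hl (fun j hj => by rw [hj, zpow_zero, one_mul]) h3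

/-- The eigenvalue of `ψ⁻(z)` as a finite product. -/
theorem fockPsiMinus_eq (hq : q₁ * q₂ * q₃ = 1) {l : Partition} {L : ℕ}
    (hl : ∀ j, L ≤ j → l.1 j = 0) {w : ℂ} (hw : w ≠ 0) {z : K}
    (hz : ∀ x y : ℤ, z ≠ ι (q₁ ^ x * q₃ ^ y * w)) :
    fockPsiMinus ι q₁ q₂ q₃ l (z / ι w) = tailFactor (ι q₂) (ι (q₃ ^ L * w)) z *
      ∏ j ∈ Finset.range L, phi (ι q₁) (ι q₂) (ι q₃) (ι (q₁ ^ l.1 j * (q₃ ^ j * w))) z := by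
  have h3 := phi_vacuum_ne_zero ι hq w hz
  have key := tailFactor_mul_prod ι hq w (N := 0) (L := L) (Nat.zero_le L)
    (fun j => phi (ι q₁) (ι q₂) (ι q₃) (ι (q₁ ^ l.1 j * (q₃ ^ j * w))) z)
    (fun j _ => by
      have := hz 0 (j + 1 : ℕ)
      rwa [zpow_zero, one_mul, zpow_natCast] at this)
    (fun j _ => by simpa [mul_assoc] using hz (-1) j) (fun j _ => h3 j)
  rw [pow_zero, one_mul] at key
  rw [fockPsiMinus, psiEmptyMinus_eq ι (ne_zero_mid_of_prod hq) hw, Finset.range_eq_Ico, ← key]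
  simp only [rowPsiMinus_eq ι hq _ _ hw z]
  congr 1
  have he : ∀ j, (Partition.empty.1 j : ℤ) = 0 := fun j => rfl
  simp only [he, zpow_zero, one_mul]
  exact finprod_row_eq hl (fun j hj => by rw [hj, zpow_zero, one_mul]) h3

end Eigenvalues

/-! ### The variable `z` as a Laurent series at infinity and at zero. -/

section Laurent

/-- The variable `z`, expanded at infinity. -/
def zInf : LaurentSeries ℂ := HahnSeries.single (-1) 1

/-- The variable `z`, expanded at zero. -/
def zZero : LaurentSeries ℂ := HahnSeries.single 1 1

theorem zInf_ne_C (c : ℂ) : zInf ≠ HahnSeries.C c := by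
  intro h
  have := congrArg (fun f => HahnSeries.coeff f (-1)) h
  simp [zInf, HahnSeries.C_apply] at this

theorem zZero_ne_C (c : ℂ) : zZero ≠ HahnSeries.C c := by
  intro h
  have := congrArg (fun f => HahnSeries.coeff f 1) h
  simp [zZero, HahnSeries.C_apply] at this

theorem zInf_ne_zero : zInf ≠ 0 := by
  simpa using zInf_ne_C 0

theorem C_div_zInf (c : ℂ) : HahnSeries.C c / zInf = HahnSeries.single 1 c := by
  rw [div_eq_iff zInf_ne_zero]
  simp [zInf, HahnSeries.C_apply]

theorem zZero_div_C {c : ℂ} (hc : c ≠ 0) : zZero / HahnSeries.C c = HahnSeries.single 1 c⁻¹ := by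
  rw [div_eq_iff (by simpa using hc)]
  simp [zZero, HahnSeries.C_apply, hc]

end Laurent

/-! ### Matrix coefficients of the tensor product for generic parameters. -/

section Coefficients

variable {n : ℕ} {q₁ q₂ q₃ : ℂ} {us : Fin (n + 1) → ℂ} {lam mu : Fin (n + 1) → Partition} {L : ℕ}

/-- The lengths of the rows of a tuple of partitions. -/
def rawState (lam : Fin (n + 1) → Partition) : Row n → ℤ := fun r => (lam r.1).1 r.2

theorem prod_filter_rowLt {M : Type*} [CommMonoid M] (f : Row n → M) (i : Fin (n + 1)) {s : ℕ}
    (hs : s ≤ L) :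
    ∏ r ∈ rows n L with rowLt r (i, s), f r =
      (∏ m with m < i, ∏ j ∈ Finset.range L, f (m, j)) * ∏ j ∈ Finset.range s, f (i, j) := by
  rw [Finset.prod_filter, prod_rows, ← Finset.prod_filter_mul_prod_filter_not _ (fun m => m < i)]
  congr 1
  · refine Finset.prod_congr rfl fun m hm => Finset.prod_congr rfl fun j _ => ?_
    rw [if_pos (show rowLt (m, j) (i, s) from Or.inl (Finset.mem_filter.1 hm).2)]
  · rw [Finset.prod_eq_single_of_mem i (by simp)]
    · rw [← Finset.prod_filter]
      refine Finset.prod_congr ?_ fun _ _ => rfl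
      ext j
      simp [rowLt]
      omega
    · intro m hm hne
      refine Finset.prod_eq_one fun j _ => if_neg ?_
      have := (Finset.mem_filter.1 hm).2
      simp [rowLt, this, hne]

theorem prod_filter_rowGt {M : Type*} [CommMonoid M] (f : Row n → M) (i : Fin (n + 1)) (s : ℕ) :
    ∏ r ∈ rows n L with rowLt (i, s) r, f r =
      (∏ m with i < m, ∏ j ∈ Finset.range L, f (m, j)) * ∏ j ∈ Finset.Ico (s + 1) L, f (i, j) := by
  rw [Finset.prod_filter, prod_rows, ← Finset.prod_filter_mul_prod_filter_not _ (fun m => i < m)]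
  congr 1
  · refine Finset.prod_congr rfl fun m hm => Finset.prod_congr rfl fun j _ => ?_
    rw [if_pos (show rowLt (i, s) (m, j) from Or.inl (Finset.mem_filter.1 hm).2)]
  · rw [Finset.prod_eq_single_of_mem i (by simp)]
    · rw [← Finset.prod_filter]
      refine Finset.prod_congr ?_ fun _ _ => rfl
      ext j
      simp [rowLt]
      omega
    · intro m hm hne
      refine Finset.prod_eq_one fun j _ => if_neg ?_
      have := (Finset.mem_filter.1 hm).2
      simp [rowLt, this, hne.symm]

theorem prod_fockPsiPlus_eq (hq : q₁ * q₂ * q₃ = 1) (h : Room L (rawState lam)) :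
    ∏ i, fockPsiPlus HahnSeries.C q₁ q₂ q₃ (lam i)
      (HahnSeries.single 1 (us i) : LaurentSeries ℂ) =
      psiRat HahnSeries.C q₁ q₂ q₃ us L (rawState lam) zInf := by
  rw [psiRat, prod_rows, ← Finset.prod_mul_distrib]
  refine Finset.prod_congr rfl fun i _ => ?_
  rw [← C_div_zInf, fockPsiPlus_eq HahnSeries.C hq (l := lam i) (L := L)
    (fun j hj => h.eq_zero i j (by omega)) _ zInf_ne_zero fun _ _ => zInf_ne_C _]
  rfl

theorem prod_fockPsiMinus_eq (hq : q₁ * q₂ * q₃ = 1) (hus : ∀ i, us i ≠ 0)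
    (h : Room L (rawState lam)) :
    ∏ i, fockPsiMinus HahnSeries.C q₁ q₂ q₃ (lam i)
      (HahnSeries.single 1 (us i)⁻¹ : LaurentSeries ℂ) =
      psiRat HahnSeries.C q₁ q₂ q₃ us L (rawState lam) zZero := by
  rw [psiRat, prod_rows, ← Finset.prod_mul_distrib]
  refine Finset.prod_congr rfl fun i _ => ?_
  rw [← zZero_div_C (hus i), fockPsiMinus_eq (HahnSeries.C : ℂ →+* LaurentSeries ℂ) hq (L := L)
    (fun j hj => h.eq_zero i j (by omega)) (hus i) fun _ _ => zZero_ne_C _]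
  rfl

/-- The conditions that hold for generic parameters. -/
structure Separated (q₁ q₂ q₃ : ℂ) (us : Fin (n + 1) → ℂ) : Prop where
  prod_eq_one : q₁ * q₂ * q₃ = 1
  ne_zero : ∀ i, us i ≠ 0
  indep : ∀ x y : ℤ, q₁ ^ x * q₃ ^ y = 1 → x = 0 ∧ y = 0
  sep : ∀ i m, i ≠ m → ∀ x y : ℤ, us i ≠ q₁ ^ x * q₃ ^ y * us m

/-- As `q₃ = (q₁ q₂)⁻¹`, the monomial `q₁ ^ x q₃ ^ y` has exponents `x - y` and `-y` in `q₁` and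
`q₂`. -/
theorem Generic.separated {q₁ q₂ : ℂ} {us : Fin (n + 1) → ℂ}
    (h : Generic (Matrix.vecCons q₁ (Matrix.vecCons q₂ us))) :
    Separated q₁ q₂ (q₁ * q₂)⁻¹ us := by
  obtain ⟨h0, hg⟩ := h
  have h1 : q₁ ≠ 0 := h0 0
  have h2 : q₂ ≠ 0 := h0 1
  have hus : ∀ i, us i ≠ 0 := fun i => h0 i.succ.succ
  have e : ∀ x y : ℤ, q₁ ^ (x - y) * q₂ ^ (-y) = q₁ ^ x * (q₁ * q₂)⁻¹ ^ y := by
    intro x y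
    rw [inv_zpow', mul_zpow, sub_eq_add_neg, zpow_add₀ h1, mul_assoc]
  refine ⟨mul_inv_cancel₀ (mul_ne_zero h1 h2), hus, fun x y hxy => ?_, fun i m him x y hxy => ?_⟩
  · have := hg (Matrix.vecCons (x - y) (Matrix.vecCons (-y) 0)) (by
      have := (e x y).trans hxy
      rw [zpow_neg] at this
      simpa [Fin.prod_univ_succ] using this)
    have a0 := congrFun this 0
    have a1 := congrFun this 1
    simp at a0 a1
    omega
  · have := hg (Matrix.vecCons (x - y) (Matrix.vecCons (-y) (Pi.single m 1 - Pi.single i 1))) (by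
      rw [Fin.prod_univ_succ, Fin.prod_univ_succ]
      simp only [Matrix.cons_val_zero, Matrix.cons_val_succ, Pi.sub_apply]
      rw [← mul_assoc, e]
      have : ∏ k, us k ^ ((Pi.single m 1 : Fin (n + 1) → ℤ) k - (Pi.single i 1 : Fin (n + 1) → ℤ) k)
          = us m / us i := by
        simp only [zpow_sub₀ (hus _), Finset.prod_div_distrib]
        congr 1
        · rw [Finset.prod_eq_single m (fun k _ hk => by simp [hk]) (by simp)]; simp
        · rw [Finset.prod_eq_single i (fun k _ hk => by simp [hk]) (by simp)]; simp
      rw [this, mul_div_assoc', ← hxy, div_self (hus i)])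
    have a := congrFun this m.succ.succ
    simp [Ne.symm him] at a

namespace Separated

theorem q1_ne (H : Separated q₁ q₂ q₃ us) : q₁ ≠ 0 := ne_zero_left_of_prod H.prod_eq_one

theorem q3_ne (H : Separated q₁ q₂ q₃ us) : q₃ ≠ 0 := ne_zero_right_of_prod H.prod_eq_one

theorem pt_ne_zero (H : Separated q₁ q₂ q₃ us) (X : Row n → ℤ) (r : Row n) :
    pt q₁ (rowBase q₃ us) X r ≠ 0 :=
  QuantumGl.pt_ne_zero H.q1_ne (fun _ => mul_ne_zero (pow_ne_zero _ H.q3_ne) (H.ne_zero _)) X r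

theorem pt_ne (H : Separated q₁ q₂ q₃ us) (X : Row n → ℤ) {r : Row n} {x y : ℤ} {m : Fin (n + 1)}
    (h : r.1 = m → X r ≠ x ∨ (r.2 : ℤ) ≠ y) :
    pt q₁ (rowBase q₃ us) X r ≠ q₁ ^ x * q₃ ^ y * us m := by
  intro he
  have h1 := H.q1_ne
  have h3 := H.q3_ne
  rw [pt, rowBase, ← zpow_natCast, ← mul_assoc] at he
  have he' : us r.1 = q₁ ^ (x - X r) * q₃ ^ (y - r.2) * us m := by
    rw [zpow_sub₀ h1, zpow_sub₀ h3]
    field_simp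
    linear_combination he
  by_cases hm : r.1 = m
  · rw [hm] at he'
    have := H.indep _ _ (mul_right_cancel₀ (H.ne_zero m) (he'.symm.trans (one_mul _).symm))
    have := h hm
    omega
  · exact H.sep _ _ hm _ _ he'

end Separated

theorem IsAddBox.unique {i i' : Fin (n + 1)} {s s' : ℕ} (h : IsAddBox i s lam mu)
    (h' : IsAddBox i' s' lam mu) : i' = i ∧ s' = s := by
  have hi : i' = i := by
    by_contra hne
    have h1 := h.2 i' hne
    have h2 := h'.1
    rw [h1] at h2
    have := DFunLike.congr_fun h2 s'
    simp at this
  subst hi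
  refine ⟨rfl, ?_⟩
  have h2 := h'.1
  rw [h.1] at h2
  have h3 := add_left_cancel h2
  exact ((Finsupp.single_left_inj one_ne_zero).1 h3).symm

theorem finsum_isAddBox {i : Fin (n + 1)} {s : ℕ} (h : IsAddBox i s lam mu)
    (f : Fin (n + 1) → ℕ → ℂ) [∀ i s, Decidable (IsAddBox i s lam mu)] :
    (∑ᶠ (i : Fin (n + 1)) (s : ℕ), if IsAddBox i s lam mu then f i s else 0) = f i s := by
  rw [finsum_eq_single _ i, finsum_eq_single _ s, if_pos h]
  · intro s' hs'
    rw [if_neg fun h' => hs' (h.unique h').2]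
  · intro i' hi'
    simp only [if_neg fun h' => hi' (h.unique h').1, finsum_zero]

/-- The matrix coefficients of `e(z)` for generic parameters. -/
theorem tensorE_eq (H : Separated q₁ q₂ q₃ us) (hL : Room L (rawState lam)) {i : Fin (n + 1)}
    {s : ℕ} (h : IsAddBox i s lam mu) (hs : (i, s) ∈ rows n L) (k : ℤ) :
    tensorE q₁ q₂ q₃ us k mu lam = coefE q₁ q₂ q₃ us L (rawState lam) (i, s) *
      pt q₁ (rowBase q₃ us) (rawState lam) (i, s) ^ k := by
  classical
  have hv : boxSupport q₁ q₃ (us i) (lam i) s = pt q₁ (rowBase q₃ us) (rawState lam) (i, s) := by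
    rw [boxSupport, mul_assoc]; rfl
  have hv0 := H.pt_ne_zero (rawState lam) (i, s)
  have hs' : s < L := mem_rows.1 hs
  unfold tensorE
  rw [finsum_isAddBox h, hv]
  congr 1
  have h1 : ∀ m ∈ Finset.univ.filter (fun m => m < i), fockPsiMinus (RingHom.id ℂ) q₁ q₂ q₃ (lam m)
      (pt q₁ (rowBase q₃ us) (rawState lam) (i, s) / us m) = _ := fun m hm =>
    fockPsiMinus_eq (RingHom.id ℂ) H.prod_eq_one (l := lam m) (L := L)
      (fun j hj => hL.eq_zero m j (by omega)) (H.ne_zero m)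
      fun x y => H.pt_ne _ fun he => absurd he (Finset.mem_filter.1 hm).2.ne'
  -- The factors `ψ⁻` of the comultiplication supply the rows and tails of the earlier partitions,
  -- the Fock coefficient the earlier rows of partition `i`. Together these are the rows before `(i,
  -- s)`.
  rw [Finset.prod_congr rfl h1, fockE, hv, coefE, coef, extE, prod_filter_rowLt _ _ hs'.le,
    ← Finset.prod_filter, Finset.prod_mul_distrib]
  have h2 : ∀ j, rowPsiPlus (RingHom.id ℂ) q₁ q₂ q₃ (lam i) j
      (us i / pt q₁ (rowBase q₃ us) (rawState lam) (i, s)) = _ := fun j =>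
    rowPsiPlus_eq (RingHom.id ℂ) H.prod_eq_one (lam i) j (us i) hv0
  simp only [h2, RingHom.id_apply]
  simp only [pt, rowBase, rawState]
  ring

theorem tensorE_eq_zero (h : ∀ i s, ¬IsAddBox i s lam mu) (k : ℤ) :
    tensorE q₁ q₂ q₃ us k mu lam = 0 := by
  simp [tensorE, h]

theorem tensorF_eq_zero (h : ∀ i s, ¬IsAddBox i s lam mu) (k : ℤ) :
    tensorF q₁ q₂ q₃ us k lam mu = 0 := by
  simp [tensorF, h]

theorem partition_nonneg (l : Partition) (s : ℕ) : 0 ≤ l.1 s := by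
  by_contra h
  have : ∀ t, s ≤ t → t ∈ l.1.support := fun t ht => by
    have := l.2 ht
    rw [Finsupp.mem_support_iff]
    omega
  exact Set.infinite_of_forall_exists_gt
    (fun N => ⟨max s (N + 1), this _ (le_max_left _ _), by omega⟩) l.1.support.finite_toSet

/-- The coefficient of `f(z)` on a Fock module. -/
theorem fockF_eq (H : Separated q₁ q₂ q₃ us) {i : Fin (n + 1)}
    {s : ℕ} (hs : s < L) (hl : ∀ j, L ≤ j → (lam i).1 j = 0) :
    fockF q₁ q₂ q₃ (us i) (lam i) s = q₁ * (1 - q₁)⁻¹ *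
      (tailFactor q₂ (q₃ ^ L * us i) (pt q₁ (rowBase q₃ us) (rawState lam) (i, s)) *
      ∏ j ∈ Finset.Ico (s + 1) L, phi q₁ q₂ q₃ (pt q₁ (rowBase q₃ us) (rawState lam) (i, j))
        (pt q₁ (rowBase q₃ us) (rawState lam) (i, s))) := by
  have hv : boxSupport q₁ q₃ (us i) (lam i) s = pt q₁ (rowBase q₃ us) (rawState lam) (i, s) := by
    rw [boxSupport, mul_assoc]; rfl
  have hv0 := H.pt_ne_zero (rawState lam) (i, s)
  have hx : 0 ≤ rawState lam (i, s) := partition_nonneg (lam i) s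
  have hne : ∀ x y : ℤ, (rawState lam (i, s) ≠ x ∨ (s : ℤ) ≠ y) →
      pt q₁ (rowBase q₃ us) (rawState lam) (i, s) ≠ q₁ ^ x * q₃ ^ y * us i := fun x y h =>
    H.pt_ne _ fun _ => h
  rw [fockF, hv]
  set z := pt q₁ (rowBase q₃ us) (rawState lam) (i, s) with hz
  have g1 : ∀ j, s + 1 ≤ j → z ≠ q₃ ^ (j + 1) * us i := fun j hj => by
    have := hne 0 (j + 1 : ℕ) (by omega)
    rwa [zpow_zero, one_mul, zpow_natCast] at this
  have g2 : ∀ j, s + 1 ≤ j → z ≠ q₁⁻¹ * (q₃ ^ j * us i) := fun j hj => by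
    have := hne (-1) j (by omega)
    rwa [zpow_neg_one, zpow_natCast, mul_assoc] at this
  have g3 : ∀ j, s + 1 ≤ j → phi q₁ q₂ q₃ (q₃ ^ j * us i) z ≠ 0 := fun j hj => by
    refine phi_ne_zero_of_ne ?_ ?_ ?_ (g2 j hj)
    · rw [← mul_assoc, ← pow_succ']; exact g1 j hj
    · have := hne (-1) (-1 + j) (by omega)
      rwa [zpow_add₀ H.q3_ne, ← mul_assoc, ← q2_eq_of_prod H.prod_eq_one, mul_assoc,
        zpow_natCast] at this
    · have := hne 0 j (by omega)
      rwa [zpow_zero, one_mul, zpow_natCast] at this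
  have key := tailFactor_mul_prod (RingHom.id ℂ) H.prod_eq_one (us i) (z := z) (N := s + 1) (L := L)
    hs (fun j => phi q₁ q₂ q₃ (pt q₁ (rowBase q₃ us) (rawState lam) (i, j)) z) g1 g2 g3
  simp only [RingHom.id_apply] at key
  have h0 := psiEmptyPlus_eq (RingHom.id ℂ) (q₂ := q₂) (q₃ ^ (s + 1) * us i) hv0
  have h2 : ∀ l j, rowPsiPlus (RingHom.id ℂ) q₁ q₂ q₃ l j (us i / z) = _ := fun l j =>
    rowPsiPlus_eq (RingHom.id ℂ) H.prod_eq_one l j (us i) hv0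
  simp only [RingHom.id_apply] at h0 h2
  rw [mul_comm (us i), h0, ← key, ← mul_assoc]
  congr 1
  simp only [finprod_eq_if, h2]
  have he : ∀ j, (Partition.empty.1 j : ℤ) = 0 := fun j => rfl
  simp only [he, zpow_zero, one_mul]
  rw [finprod_eq_prod_of_mulSupport_subset (s := Finset.Ico (s + 1) L)]
  · refine Finset.prod_congr rfl fun j hj => ?_
    rw [if_pos (by simpa using (Finset.mem_Ico.1 hj).1)]
    rfl
  · intro j hj
    by_contra hj'
    refine hj ?_
    by_cases hsj : s < j
    · have hLj : L ≤ j := by simp at hj'; omega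
      simp only [if_pos hsj, hl j hLj, zpow_zero, one_mul]
      exact div_self (g3 j hsj)
    · simp only [if_neg hsj]

/-- The matrix coefficients of `f(z)` for generic parameters. -/
theorem tensorF_eq (H : Separated q₁ q₂ q₃ us) (hL : Room L (rawState lam)) {i : Fin (n + 1)}
    {s : ℕ} (h : IsAddBox i s lam mu) (hs : (i, s) ∈ rows n L) (k : ℤ) :
    tensorF q₁ q₂ q₃ us k lam mu = coefF q₁ q₂ q₃ us L (rawState lam) (i, s) *
      pt q₁ (rowBase q₃ us) (rawState lam) (i, s) ^ k := by
  classical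
  have hv : boxSupport q₁ q₃ (us i) (lam i) s = pt q₁ (rowBase q₃ us) (rawState lam) (i, s) := by
    rw [boxSupport, mul_assoc]; rfl
  have hv0 := H.pt_ne_zero (rawState lam) (i, s)
  have hs' : s < L := mem_rows.1 hs
  unfold tensorF
  rw [finsum_isAddBox h, hv]
  congr 1
  have h1 : ∀ m ∈ Finset.univ.filter (fun m => i < m), fockPsiPlus (RingHom.id ℂ) q₁ q₂ q₃ (lam m)
      (us m / pt q₁ (rowBase q₃ us) (rawState lam) (i, s)) = _ := fun m hm =>
    fockPsiPlus_eq (RingHom.id ℂ) H.prod_eq_one (l := lam m) (L := L)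
      (fun j hj => hL.eq_zero m j (by omega)) (us m) hv0
      fun x y => H.pt_ne _ fun he => absurd he (Finset.mem_filter.1 hm).2.ne
  -- For `f` the factors `ψ⁺` supply the later partitions. The partition `i` itself contributes its
  -- later rows and its tail, so that `extF` has the condition `r.1 ≤ m`.
  rw [Finset.prod_congr rfl h1, fockF_eq H hs' (fun j hj => hL.eq_zero i j (by omega)), coefF, coef,
    extF, prod_filter_rowGt, ← Finset.prod_filter, Finset.prod_mul_distrib]
  have h3 : Finset.univ.filter (fun m => i ≤ m) =
      insert i (Finset.univ.filter (fun m => i < m)) := by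
    ext m; simp [le_iff_eq_or_lt, eq_comm]
  rw [h3, Finset.prod_insert (by simp)]
  simp only [RingHom.id_apply]
  simp only [pt, rowBase, rawState]
  ring

end Coefficients

/-! ## Expansions of rational functions -/

section Expansion

open scoped PowerSeries.WithPiTopology

/-- The expansion of `(z - β)⁻¹` at infinity. -/
def invInf (β : ℂ) : PowerSeries ℂ := PowerSeries.mk fun k => if k = 0 then 0 else β ^ (k - 1)

/-- The expansion of `(z - β)⁻¹` at zero. -/
def invZero (β : ℂ) : PowerSeries ℂ := PowerSeries.mk fun k => -(β⁻¹ ^ (k + 1))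

theorem inv_zInf_sub (β : ℂ) :
    (zInf - HahnSeries.C β)⁻¹ = ((invInf β : PowerSeries ℂ) : LaurentSeries ℂ) := by
  have h0 : zInf - HahnSeries.C β ≠ 0 := sub_ne_zero.2 (zInf_ne_C β)
  have h1 : (1 - PowerSeries.C β * PowerSeries.X) * PowerSeries.mk (fun k => β ^ k) = 1 := by
    ext k
    rw [sub_mul, one_mul, map_sub, mul_assoc, PowerSeries.coeff_C_mul]
    cases k with
    | zero => simp
    | succ k =>
      rw [PowerSeries.coeff_succ_X_mul]
      simp [pow_succ', PowerSeries.coeff_one]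
  have h2 : invInf β = PowerSeries.X * PowerSeries.mk (fun k => β ^ k) := by
    ext k
    cases k with
    | zero => simp [invInf]
    | succ k => rw [PowerSeries.coeff_succ_X_mul]; simp [invInf]
  have hX : zInf * ((PowerSeries.X : PowerSeries ℂ) : LaurentSeries ℂ) = 1 := by
    simp [zInf]
  have hC : ((PowerSeries.C β : PowerSeries ℂ) : LaurentSeries ℂ) = HahnSeries.C β := by simp
  refine inv_eq_of_mul_eq_one_right ?_
  have h3 := congrArg (fun f : PowerSeries ℂ => (f : LaurentSeries ℂ)) h1
  simp only [PowerSeries.coe_mul, PowerSeries.coe_sub, PowerSeries.coe_one, hC] at h3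
  rw [h2, PowerSeries.coe_mul, ← h3]
  linear_combination ((PowerSeries.mk (fun k => β ^ k) : PowerSeries ℂ) : LaurentSeries ℂ) * hX

theorem inv_zZero_sub {β : ℂ} (hβ : β ≠ 0) :
    (zZero - HahnSeries.C β)⁻¹ = ((invZero β : PowerSeries ℂ) : LaurentSeries ℂ) := by
  have h1 : (PowerSeries.X - PowerSeries.C β) * invZero β = 1 := by
    ext k
    rw [sub_mul, map_sub, PowerSeries.coeff_C_mul]
    cases k with
    | zero => simp [invZero, hβ]
    | succ k =>
      rw [PowerSeries.coeff_succ_X_mul]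
      simp only [invZero, PowerSeries.coeff_mk, PowerSeries.coeff_one, pow_succ' β⁻¹ (k + 1)]
      rw [if_neg (by omega)]
      field_simp
      ring
  refine inv_eq_of_mul_eq_one_right ?_
  have h3 := congrArg (fun f : PowerSeries ℂ => (f : LaurentSeries ℂ)) h1
  simpa [zZero] using h3

/-- The expansion of `(z - α) / (z - β)` at infinity. -/
def facInf (α β : ℂ) : PowerSeries ℂ := 1 + PowerSeries.C (β - α) * invInf β

/-- The expansion of `(z - α) / (z - β)` at zero. -/
def facZero (α β : ℂ) : PowerSeries ℂ := 1 + PowerSeries.C (β - α) * invZero β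

theorem zInf_sub_div (α β : ℂ) : (zInf - HahnSeries.C α) / (zInf - HahnSeries.C β) =
    ((facInf α β : PowerSeries ℂ) : LaurentSeries ℂ) := by
  have h0 : zInf - HahnSeries.C β ≠ 0 := sub_ne_zero.2 (zInf_ne_C β)
  rw [facInf, PowerSeries.coe_add, PowerSeries.coe_mul, ← inv_zInf_sub, PowerSeries.coe_one,
    div_eq_iff h0, add_mul, mul_assoc, inv_mul_cancel₀ h0]
  simp

theorem zZero_sub_div (α : ℂ) {β : ℂ} (hβ : β ≠ 0) :
    (zZero - HahnSeries.C α) / (zZero - HahnSeries.C β) =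
    ((facZero α β : PowerSeries ℂ) : LaurentSeries ℂ) := by
  have h0 : zZero - HahnSeries.C β ≠ 0 := sub_ne_zero.2 (zZero_ne_C β)
  rw [facZero, PowerSeries.coe_add, PowerSeries.coe_mul, ← inv_zZero_sub hβ, PowerSeries.coe_one,
    div_eq_iff h0, add_mul, mul_assoc, inv_mul_cancel₀ h0]
  simp

theorem constantCoeff_facInf (α β : ℂ) : PowerSeries.constantCoeff (facInf α β) = 1 := by
  simp [facInf, invInf]

theorem constantCoeff_facZero (α : ℂ) {β : ℂ} (hβ : β ≠ 0) :
    PowerSeries.constantCoeff (facZero α β) = α / β := by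
  simp [facZero, invZero]
  field_simp
  ring

theorem tendsto_facInf {P : Type*} {l : Filter P} {α β : P → ℂ} {α₀ β₀ : ℂ}
    (hα : Tendsto α l (𝓝 α₀)) (hβ : Tendsto β l (𝓝 β₀)) :
    Tendsto (fun p => facInf (α p) (β p)) l (𝓝 (facInf α₀ β₀)) := by
  rw [PowerSeries.WithPiTopology.tendsto_iff_coeff_tendsto]
  intro k
  simp only [facInf, map_add, PowerSeries.coeff_C_mul, invInf, PowerSeries.coeff_mk]
  refine tendsto_const_nhds.add ((hβ.sub hα).mul ?_)
  split_ifs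
  · exact tendsto_const_nhds
  · exact hβ.pow _

theorem tendsto_facZero {P : Type*} {l : Filter P} {α β : P → ℂ} {α₀ β₀ : ℂ}
    (hα : Tendsto α l (𝓝 α₀)) (hβ : Tendsto β l (𝓝 β₀)) (h0 : β₀ ≠ 0) :
    Tendsto (fun p => facZero (α p) (β p)) l (𝓝 (facZero α₀ β₀)) := by
  rw [PowerSeries.WithPiTopology.tendsto_iff_coeff_tendsto]
  intro k
  simp only [facZero, map_add, PowerSeries.coeff_C_mul, invZero, PowerSeries.coeff_mk]
  exact tendsto_const_nhds.add ((hβ.sub hα).mul ((hβ.inv₀ h0).pow _).neg)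

/-- Multiplication of power series is continuous for coefficientwise convergence, so zeros and poles
may collide in the limit. -/
theorem tendsto_coeff_prod_facInf {J P : Type*} {l : Filter P} {I : Finset J} {α β : P → J → ℂ}
    {α₀ β₀ : J → ℂ} (hα : ∀ j ∈ I, Tendsto (fun p => α p j) l (𝓝 (α₀ j)))
    (hβ : ∀ j ∈ I, Tendsto (fun p => β p j) l (𝓝 (β₀ j))) (k : ℕ) :
    Tendsto (fun p => PowerSeries.coeff k (∏ j ∈ I, facInf (α p j) (β p j))) l
      (𝓝 (PowerSeries.coeff k (∏ j ∈ I, facInf (α₀ j) (β₀ j)))) :=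
  (PowerSeries.WithPiTopology.tendsto_iff_coeff_tendsto _ _ _ _).1
    (tendsto_finsetProd I fun j hj => tendsto_facInf (hα j hj) (hβ j hj)) k

theorem tendsto_coeff_prod_facZero {J P : Type*} {l : Filter P} {I : Finset J} {α β : P → J → ℂ}
    {α₀ β₀ : J → ℂ} (hα : ∀ j ∈ I, Tendsto (fun p => α p j) l (𝓝 (α₀ j)))
    (hβ : ∀ j ∈ I, Tendsto (fun p => β p j) l (𝓝 (β₀ j))) (h0 : ∀ j ∈ I, β₀ j ≠ 0) (k : ℕ) :
    Tendsto (fun p => PowerSeries.coeff k (∏ j ∈ I, facZero (α p j) (β p j))) l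
      (𝓝 (PowerSeries.coeff k (∏ j ∈ I, facZero (α₀ j) (β₀ j)))) :=
  (PowerSeries.WithPiTopology.tendsto_iff_coeff_tendsto _ _ _ _).1
    (tendsto_finsetProd I fun j hj => tendsto_facZero (hα j hj) (hβ j hj) (h0 j hj)) k

end Expansion

/-! ## Partial fractions -/

section PartialFractions

variable {J : Type*} [DecidableEq J]

/-- The residue at `β κ` of the product of the `(z - α l) / (z - β l)`. -/
def residue (I : Finset J) (α β : J → ℂ) (κ : J) : ℂ :=
  (∏ l ∈ I, (β κ - α l)) * ∏ l ∈ I.erase κ, (β κ - β l)⁻¹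

theorem residue_eq {I : Finset J} {α β : J → ℂ} {κ : J} (hκ : κ ∈ I) :
    residue I α β κ = (β κ - α κ) * ∏ l ∈ I.erase κ, (β κ - α l) / (β κ - β l) := by
  simp only [residue, ← Finset.mul_prod_erase I _ hκ, div_eq_mul_inv, Finset.prod_mul_distrib]
  ring

/-- Lagrange interpolation at the poles, applied to numerator minus denominator: both are monic of
the same degree, so the difference has smaller degree. -/
theorem prod_div_eq_one_add {K : Type*} [Field K] (ι : ℂ →+* K) {I : Finset J} {α β : J → ℂ}
    (hβ : Set.InjOn β I) {z : K} (hz : ∀ κ ∈ I, z ≠ ι (β κ)) :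
    ∏ κ ∈ I, (z - ι (α κ)) / (z - ι (β κ)) =
      1 + ∑ κ ∈ I, ι (residue I α β κ) * (z - ι (β κ))⁻¹ := by
  rcases I.eq_empty_or_nonempty with rfl | hI
  · simp
  have hinj : Set.InjOn (fun κ => ι (β κ)) I := fun x hx y hy h => hβ hx hy (ι.injective h)
  set Q := Lagrange.nodal I fun κ => ι (β κ) with hQ
  set R := Lagrange.nodal I fun κ => ι (α κ) with hR
  have hdeg : (R - Q).degree < I.card := by
    have h1 : R.degree = I.card := Lagrange.degree_nodal
    have h2 : Q.degree = I.card := Lagrange.degree_nodal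
    rw [← h1]
    refine Polynomial.degree_sub_lt_left (h1.trans h2.symm) (Lagrange.nodal_monic.ne_zero) ?_
    rw [Lagrange.nodal_monic.leadingCoeff, Lagrange.nodal_monic.leadingCoeff]
  have h := congrArg (Polynomial.eval z) (Lagrange.eq_interpolate hinj hdeg)
  rw [Lagrange.eval_interpolate_not_at_node _ hz] at h
  have hne : Q.eval z ≠ 0 := by
    rw [hQ, Lagrange.eval_nodal]
    exact Finset.prod_ne_zero_iff.2 fun κ hκ => sub_ne_zero.2 (hz κ hκ)
  rw [Finset.prod_div_distrib]
  have e1 : ∏ κ ∈ I, (z - ι (α κ)) = R.eval z := by rw [hR, Lagrange.eval_nodal]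
  have e2 : ∏ κ ∈ I, (z - ι (β κ)) = Q.eval z := by rw [hQ, Lagrange.eval_nodal]
  rw [Polynomial.eval_sub] at h
  rw [e1, e2, div_eq_iff hne, add_mul, one_mul, ← sub_eq_iff_eq_add', h, mul_comm]
  congr 1
  refine Finset.sum_congr rfl fun κ hκ => ?_
  rw [Polynomial.eval_sub, hQ, hR, Lagrange.eval_nodal_at_node (v := fun κ => ι (β κ)) hκ, sub_zero, Lagrange.eval_nodal,
    Lagrange.nodalWeight, residue, map_mul, map_prod, map_prod]
  simp only [map_sub, map_inv₀]
  ring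

/-- The difference of the expansions at infinity and at zero. -/
theorem coeff_zInf_sub_coeff_zZero {I : Finset J} {α β : J → ℂ} (hβ : Set.InjOn β I)
    (h0 : ∀ κ ∈ I, β κ ≠ 0) (m : ℤ) :
    (∏ κ ∈ I, (zInf - HahnSeries.C (α κ)) / (zInf - HahnSeries.C (β κ))).coeff m -
      (∏ κ ∈ I, (zZero - HahnSeries.C (α κ)) / (zZero - HahnSeries.C (β κ))).coeff (-m) =
      ∑ κ ∈ I, residue I α β κ * β κ ^ (m - 1) := by
  rw [prod_div_eq_one_add (HahnSeries.C : ℂ →+* LaurentSeries ℂ) hβ fun κ _ => zInf_ne_C _,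
    prod_div_eq_one_add (HahnSeries.C : ℂ →+* LaurentSeries ℂ) hβ fun κ _ => zZero_ne_C _, HahnSeries.coeff_add,
    HahnSeries.coeff_add,
    show (1 : LaurentSeries ℂ).coeff (-m) = (1 : LaurentSeries ℂ).coeff m by
      simp [HahnSeries.coeff_one], add_sub_add_left_eq_sub, HahnSeries.coeff_sum,
    HahnSeries.coeff_sum, ← Finset.sum_sub_distrib]
  refine Finset.sum_congr rfl fun κ hκ => ?_
  rw [inv_zInf_sub, inv_zZero_sub (h0 κ hκ), HahnSeries.C_mul_eq_smul, HahnSeries.C_mul_eq_smul,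
    HahnSeries.coeff_smul, HahnSeries.coeff_smul, smul_eq_mul, smul_eq_mul, ← mul_sub]
  congr 1
  rw [PowerSeries.coeff_coe, PowerSeries.coeff_coe]
  -- For `m ≤ 0` the coefficient comes from the expansion at zero, for `m > 0` from the one at
  -- infinity. In every case it is `β ^ (m - 1)`, so the difference is a delta function.
  rcases lt_trichotomy m 0 with hm | rfl | hm
  · obtain ⟨k, rfl⟩ : ∃ k : ℕ, m = -k := ⟨m.natAbs, by omega⟩
    rw [if_pos hm, if_neg (by omega)]
    simp only [neg_neg, Int.natAbs_natCast, invZero, PowerSeries.coeff_mk]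
    rw [show (-(k : ℤ) - 1) = -((k + 1 : ℕ) : ℤ) by push_cast; ring, zpow_neg, zpow_natCast]
    simp
  · simp [invZero, invInf]
  · obtain ⟨k, rfl⟩ : ∃ k : ℕ, m = (k + 1 : ℕ) := ⟨m.natAbs - 1, by omega⟩
    rw [if_neg (by omega), if_pos (by omega), show ((k + 1 : ℕ) : ℤ) - 1 = (k : ℕ) by push_cast; ring]
    simp only [Int.natAbs_natCast, invInf, PowerSeries.coeff_mk]
    simp

end PartialFractions

/-! ## The eigenvalues of `ψ(z)` as products over zeros and poles -/

section Poles

variable {n : ℕ} {q₁ q₂ q₃ : ℂ} {us : Fin (n + 1) → ℂ} {X : Row n → ℤ} {L : ℕ}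

/-- The indices of the poles of the eigenvalues of `ψ(z)`. -/
abbrev Pole (n : ℕ) : Type := (Row n × Bool) ⊕ Fin (n + 1)

/-- The indices of the poles with a cut-off `L`. -/
def poles (n L : ℕ) : Finset (Pole n) := (rows n L ×ˢ Finset.univ).disjSum Finset.univ

/-- The zeros of the eigenvalue of `ψ(z)`. -/
def zeroAt (q₁ q₂ q₃ : ℂ) (us : Fin (n + 1) → ℂ) (L : ℕ) (X : Row n → ℤ) : Pole n → ℂ
  | .inl (r, false) => q₃ * pt q₁ (rowBase q₃ us) X r
  | .inl (r, true) => q₂ * pt q₁ (rowBase q₃ us) X r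
  | .inr m => q₂ * (q₃ ^ L * us m)

/-- The poles of the eigenvalue of `ψ(z)`. -/
def poleAt (q₁ q₃ : ℂ) (us : Fin (n + 1) → ℂ) (L : ℕ) (X : Row n → ℤ) : Pole n → ℂ
  | .inl (r, false) => pt q₁ (rowBase q₃ us) X r
  | .inl (r, true) => q₁⁻¹ * pt q₁ (rowBase q₃ us) X r
  | .inr m => q₃ ^ L * us m

theorem prod_poles {M : Type*} [CommMonoid M] (g : Pole n → M) :
    ∏ κ ∈ poles n L, g κ = (∏ m, g (.inr m)) *
      ∏ r ∈ rows n L, g (.inl (r, false)) * g (.inl (r, true)) := by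
  rw [poles, Finset.prod_disjSum, Finset.prod_product, mul_comm]
  simp [mul_comm]

theorem psiRat_eq_prod {K : Type*} [Field K] (ι : ℂ →+* K) (z : K) :
    psiRat ι q₁ q₂ q₃ us L X z = ∏ κ ∈ poles n L,
      (z - ι (zeroAt q₁ q₂ q₃ us L X κ)) / (z - ι (poleAt q₁ q₃ us L X κ)) := by
  rw [prod_poles]
  simp only [psiRat, zeroAt, poleAt, tailFactor, phi, div_mul_div_comm, map_mul, map_inv₀]

theorem poleAt_ne_zero (h1 : q₁ ≠ 0) (h3 : q₃ ≠ 0) (hus : ∀ i, us i ≠ 0) (κ : Pole n) :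
    poleAt q₁ q₃ us L X κ ≠ 0 := by
  have hp : ∀ r, pt q₁ (rowBase q₃ us) X r ≠ 0 :=
    pt_ne_zero h1 (fun _ => mul_ne_zero (pow_ne_zero _ h3) (hus _)) X
  rcases κ with ⟨r, _ | _⟩ | m
  · exact hp r
  · exact mul_ne_zero (inv_ne_zero h1) (hp r)
  · exact mul_ne_zero (pow_ne_zero _ h3) (hus m)

theorem psiRat_zInf : psiRat HahnSeries.C q₁ q₂ q₃ us L X zInf =
    ((∏ κ ∈ poles n L, facInf (zeroAt q₁ q₂ q₃ us L X κ) (poleAt q₁ q₃ us L X κ) :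
      PowerSeries ℂ) : LaurentSeries ℂ) := by
  rw [psiRat_eq_prod]
  simp only [zInf_sub_div]
  exact (map_prod (HahnSeries.ofPowerSeries ℤ ℂ) _ _).symm

theorem psiRat_zZero (h1 : q₁ ≠ 0) (h3 : q₃ ≠ 0) (hus : ∀ i, us i ≠ 0) :
    psiRat HahnSeries.C q₁ q₂ q₃ us L X zZero =
    ((∏ κ ∈ poles n L, facZero (zeroAt q₁ q₂ q₃ us L X κ) (poleAt q₁ q₃ us L X κ) :
      PowerSeries ℂ) : LaurentSeries ℂ) := by
  rw [psiRat_eq_prod]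
  rw [Finset.prod_congr rfl fun κ _ =>
    zZero_sub_div (zeroAt q₁ q₂ q₃ us L X κ) (poleAt_ne_zero h1 h3 hus κ)]
  exact (map_prod (HahnSeries.ofPowerSeries ℤ ℂ) _ _).symm

end Poles

/-! ## Relations between `ψ(z)` and `e(z)`, `f(z)` -/

section LinearMaps

variable {A B : Type*} [Ring A] [Algebra ℂ A] [Ring B] [Algebra ℂ B]

theorem map_mulGzw {φ : A → B} (hsub : ∀ x y, φ (x - y) = φ x - φ y)
    (hsmul : ∀ (c : ℂ) x, φ (c • x) = c • φ x) (q₁ q₂ q₃ : ℂ) (Y : ℤ → ℤ → A) (i j : ℤ) :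
    φ (mulGzw q₁ q₂ q₃ Y i j) = mulGzw q₁ q₂ q₃ (fun i j => φ (Y i j)) i j := by
  simp [mulGzw, mulZsubW, hsub, hsmul]

theorem map_mulGwz {φ : A → B} (hsub : ∀ x y, φ (x - y) = φ x - φ y)
    (hsmul : ∀ (c : ℂ) x, φ (c • x) = c • φ x) (q₁ q₂ q₃ : ℂ) (Y : ℤ → ℤ → A) (i j : ℤ) :
    φ (mulGwz q₁ q₂ q₃ Y i j) = mulGwz q₁ q₂ q₃ (fun i j => φ (Y i j)) i j := by
  simp [mulGwz, mulWsubZ, hsub, hsmul]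

theorem mulGzw_zero (q₁ q₂ q₃ : ℂ) (i j : ℤ) :
    mulGzw q₁ q₂ q₃ (fun _ _ => (0 : A)) i j = 0 := by
  simp [mulGzw, mulZsubW]

theorem mulGwz_zero (q₁ q₂ q₃ : ℂ) (i j : ℤ) :
    mulGwz q₁ q₂ q₃ (fun _ _ => (0 : A)) i j = 0 := by
  simp [mulGwz, mulWsubZ]

end LinearMaps

/-- A point `z` of `ℂ((X))` with a linear family of coefficients, such that multiplication by `z`
shifts the coefficients. -/
structure Expansion where
  /-- the variable -/
  z : LaurentSeries ℂ
  /-- the coefficients -/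
  seq : LaurentSeries ℂ →ₗ[ℂ] (ℤ → ℂ)
  shift : ∀ F i, seq (z * F) i = seq F (i + 1)
  ne_C : ∀ c, z ≠ HahnSeries.C c

/-- Expansion at infinity. -/
def Expansion.inf : Expansion where
  z := zInf
  seq := { toFun := fun F i => F.coeff i, map_add' := fun _ _ => rfl, map_smul' := fun _ _ => rfl }
  shift F i := by
    have := HahnSeries.coeff_single_mul_add (r := (1 : ℂ)) (x := F) (a := i + 1) (b := (-1 : ℤ))
    simpa [zInf] using this
  ne_C := zInf_ne_C

/-- Expansion at zero. -/
def Expansion.zero : Expansion where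
  z := zZero
  seq := { toFun := fun F i => F.coeff (-i), map_add' := fun _ _ => rfl,
           map_smul' := fun _ _ => rfl }
  shift F i := by
    have := HahnSeries.coeff_single_mul_add (r := (1 : ℂ)) (x := F) (a := -(i + 1)) (b := (1 : ℤ))
    simpa [zZero] using this
  ne_C := zZero_ne_C

namespace Expansion

variable (ε : Expansion)

theorem seq_C_mul (c : ℂ) (F : LaurentSeries ℂ) (i : ℤ) :
    ε.seq (HahnSeries.C c * F) i = c * ε.seq F i := by
  rw [HahnSeries.C_mul_eq_smul, map_smul]
  rfl

theorem mulZsubW_seq (q c : ℂ) {p : ℂ} (hp : p ≠ 0) (F : LaurentSeries ℂ) :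
    mulZsubW q (fun i j => ε.seq F i * (c * p ^ j)) = fun i j =>
      ε.seq ((ε.z - HahnSeries.C q * HahnSeries.C p) * F) i * (c * p ^ j) := by
  funext i j
  rw [mulZsubW, sub_mul, map_sub, Pi.sub_apply, ε.shift, mul_assoc, ε.seq_C_mul, ε.seq_C_mul,
    zpow_add_one₀ hp, smul_eq_mul]
  ring

theorem mulWsubZ_seq (q c : ℂ) {p : ℂ} (hp : p ≠ 0) (F : LaurentSeries ℂ) :
    mulWsubZ q (fun i j => ε.seq F i * (c * p ^ j)) = fun i j =>
      ε.seq ((HahnSeries.C p - HahnSeries.C q * ε.z) * F) i * (c * p ^ j) := by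
  funext i j
  rw [mulWsubZ, sub_mul, map_sub, Pi.sub_apply, mul_assoc, ε.seq_C_mul, ε.seq_C_mul, ε.shift,
    zpow_add_one₀ hp, smul_eq_mul]
  ring

theorem mulGzw_seq (q₁ q₂ q₃ c : ℂ) {p : ℂ} (hp : p ≠ 0) (F : LaurentSeries ℂ) (i j : ℤ) :
    mulGzw q₁ q₂ q₃ (fun i j => ε.seq F i * (c * p ^ j)) i j =
      ε.seq (gfun (HahnSeries.C q₁) (HahnSeries.C q₂) (HahnSeries.C q₃) ε.z (HahnSeries.C p) * F) i
        * (c * p ^ j) := by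
  rw [mulGzw, ε.mulZsubW_seq _ _ hp, ε.mulZsubW_seq _ _ hp, ε.mulZsubW_seq _ _ hp, gfun]
  simp only [mul_assoc]

theorem mulGwz_seq (q₁ q₂ q₃ c : ℂ) {p : ℂ} (hp : p ≠ 0) (F : LaurentSeries ℂ) (i j : ℤ) :
    mulGwz q₁ q₂ q₃ (fun i j => ε.seq F i * (c * p ^ j)) i j =
      ε.seq (gfun (HahnSeries.C q₁) (HahnSeries.C q₂) (HahnSeries.C q₃) (HahnSeries.C p) ε.z * F) i
        * (c * p ^ j) := by
  rw [mulGwz, ε.mulWsubZ_seq _ _ hp, ε.mulWsubZ_seq _ _ hp, ε.mulWsubZ_seq _ _ hp, gfun]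
  simp only [mul_assoc]

end Expansion

/-- Only the factor of row `r` changes, as described by `gfun_mul_phi_mul_left`. In the applications
`z` is a variable, so it differs from all constants and no pole is met. -/
theorem gfun_mul_psiRat {n : ℕ} {K : Type*} [Field K] (ι : ℂ →+* K) {q₁ q₂ q₃ : ℂ}
    (hq : q₁ * q₂ * q₃ = 1) {us : Fin (n + 1) → ℂ} {L : ℕ} {X : Row n → ℤ} {r : Row n}
    (hr : r ∈ rows n L) {z : K} (hz : ∀ c, z ≠ ι c) :
    gfun (ι q₁) (ι q₂) (ι q₃) z (ι (pt q₁ (rowBase q₃ us) X r)) *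
        psiRat ι q₁ q₂ q₃ us L (X + Pi.single r 1) z =
      -(gfun (ι q₁) (ι q₂) (ι q₃) (ι (pt q₁ (rowBase q₃ us) X r)) z *
        psiRat ι q₁ q₂ q₃ us L X z) := by
  have h1 := ne_zero_left_of_prod hq
  have hq' : ι q₁ * ι q₂ * ι q₃ = 1 := by rw [← map_mul, ← map_mul, hq, map_one]
  unfold psiRat
  rw [← Finset.mul_prod_erase _ _ hr, ← Finset.mul_prod_erase _ _ hr,
    pt_add_single_self h1, map_mul]
  have key := gfun_mul_phi_mul_left hq' (p := ι (pt q₁ (rowBase q₃ us) X r)) (z := z)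
    (by rw [← map_mul]; exact hz _) (fun h => hz (q₁⁻¹ * pt q₁ (rowBase q₃ us) X r) (by
      rw [map_mul, map_inv₀, ← h, inv_mul_cancel_left₀ (by simpa using h1)]))
  have e : ∏ r' ∈ (rows n L).erase r,
      phi (ι q₁) (ι q₂) (ι q₃) (ι (pt q₁ (rowBase q₃ us) (X + Pi.single r 1) r')) z =
      ∏ r' ∈ (rows n L).erase r, phi (ι q₁) (ι q₂) (ι q₃) (ι (pt q₁ (rowBase q₃ us) X r')) z :=
    Finset.prod_congr rfl fun r' hr' => by
      rw [pt_add_single_of_ne _ _ _ (Finset.ne_of_mem_erase hr')]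
  rw [e]
  linear_combination (∏ m, tailFactor (ι q₂) (ι (q₃ ^ L * us m)) z) *
    (∏ r' ∈ (rows n L).erase r, phi (ι q₁) (ι q₂) (ι q₃) (ι (pt q₁ (rowBase q₃ us) X r')) z) * key

section Operators

variable {n : ℕ} {a b : Fin n → ℕ} {q₁ q₂ q₃ u : ℂ} {us : Fin (n + 1) → ℂ} {X : Row n → ℤ}
  {L : ℕ} {r : Row n} {lam mu : Label a b}

/-- The diagonal operator with given eigenvalues. -/
def opDiag (χ : Label a b → ℂ) : Module.End ℂ (MSpace a b) :=
  Finsupp.linearCombination ℂ fun lam => χ lam • ket lam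

theorem opDiag_ket (χ : Label a b → ℂ) (lam : Label a b) : opDiag χ (ket lam) = χ lam • ket lam :=
  linearCombination_ket _ _

theorem opDiag_apply (χ : Label a b → ℂ) (v : MSpace a b) (mu : Label a b) :
    opDiag χ v mu = χ mu * v mu := by
  classical
  induction v using Finsupp.induction_linear with
  | zero => simp
  | add f g hf hg => simp [hf, hg, mul_add]
  | single lam c =>
    rw [opDiag, Finsupp.linearCombination_single]
    by_cases h : lam = mu
    · subst h; simp [ket, mul_comm]
    · simp [ket, h]

theorem opDiag_mul (χ χ' : Label a b → ℂ) :
    opDiag χ * opDiag χ' = opDiag fun lam => χ lam * χ' lam := by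
  refine end_ext fun lam => ?_
  rw [Module.End.mul_apply, opDiag_ket, map_smul, opDiag_ket, opDiag_ket, smul_smul, mul_comm]

theorem opDiag_one : opDiag (fun _ : Label a b => 1) = 1 := by
  refine end_ext fun lam => ?_
  rw [opDiag_ket, one_smul, Module.End.one_apply]

theorem opDiag_zero : opDiag (fun _ : Label a b => 0) = 0 := by
  refine end_ext fun lam => ?_
  rw [opDiag_ket, zero_smul, LinearMap.zero_apply]

namespace Resonant

theorem opE_apply (H : Resonant a b q₁ q₂ q₃ u us) (hL : Room L lam.state)
    (h : mu.state = lam.state + Pi.single r 1) (k : ℤ) :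
    opE a b q₁ q₂ q₃ us k (ket lam) mu =
      coefE q₁ q₂ q₃ us L lam.state r * pt q₁ (rowBase q₃ us) lam.state r ^ k := by
  have hr : r ∈ rows n L := hL.mem_rows_of_isState_add (h ▸ mu.isState)
  rw [← ketOf_state, H.opE_ketOf lam.isState k hL, sumE, Finsupp.finsetSum_apply,
    Finset.sum_eq_single_of_mem r hr]
  · rw [Finsupp.smul_apply, ketOf_apply, if_pos h, smul_eq_mul, mul_one]
  · intro s _ hs
    rw [Finsupp.smul_apply, ketOf_apply, if_neg, smul_zero]
    intro h'
    have := congrFun (add_left_cancel (h.symm.trans h')) s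
    simp [hs] at this

theorem opE_apply_eq_zero (h : ∀ r, mu.state ≠ lam.state + Pi.single r 1) (k : ℤ) :
    opE a b q₁ q₂ q₃ us k (ket lam) mu = 0 := by
  rw [opE, linearCombination_ket, sumE, Finsupp.finsetSum_apply]
  refine Finset.sum_eq_zero fun r _ => ?_
  rw [Finsupp.smul_apply, ketOf_apply, if_neg (h r), smul_zero]

theorem opF_apply (H : Resonant a b q₁ q₂ q₃ u us) (hL : Room L lam.state)
    (h : lam.state = mu.state + Pi.single r 1) (k : ℤ) :
    opF a b q₁ q₂ q₃ us k (ket lam) mu =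
      coefF q₁ q₂ q₃ us L mu.state r * pt q₁ (rowBase q₃ us) mu.state r ^ k := by
  have h' : mu.state = lam.state - Pi.single r 1 := by rw [h, add_sub_cancel_right]
  have hr : r ∈ rows n L := hL.mem_rows_of_isState (h' ▸ mu.isState)
  rw [← ketOf_state, H.opF_ketOf lam.isState k hL, sumF, Finsupp.finsetSum_apply,
    Finset.sum_eq_single_of_mem r hr]
  · rw [Finsupp.smul_apply, ketOf_apply, if_pos h', smul_eq_mul, mul_one, ← h']
  · intro s _ hs
    rw [Finsupp.smul_apply, ketOf_apply, if_neg, smul_zero]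
    intro h2
    have := congrFun (sub_right_injective (h'.symm.trans h2)) s
    simp [hs] at this

theorem opF_apply_eq_zero (h : ∀ r, lam.state ≠ mu.state + Pi.single r 1) (k : ℤ) :
    opF a b q₁ q₂ q₃ us k (ket lam) mu = 0 := by
  rw [opF, linearCombination_ket, sumF, Finsupp.finsetSum_apply]
  refine Finset.sum_eq_zero fun r _ => ?_
  rw [Finsupp.smul_apply, ketOf_apply, if_neg, smul_zero]
  intro h'
  exact h r (by rw [h', sub_add_cancel])

end Resonant

theorem end_ext_apply {A B : Module.End ℂ (MSpace a b)}
    (h : ∀ mu lam, A (ket lam) mu = B (ket lam) mu) : A = B :=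
  end_ext fun lam => Finsupp.ext fun mu => h mu lam

/-- `χ` consists of the coefficients of the eigenvalues of `ψ(z)`. -/
def IsPsi (q₁ q₂ q₃ : ℂ) (us : Fin (n + 1) → ℂ) (ε : Expansion) (χ : ℤ → Label a b → ℂ) : Prop :=
  ∀ (lam : Label a b) (L : ℕ), Room L lam.state → ∀ i,
    χ i lam = ε.seq (psiRat HahnSeries.C q₁ q₂ q₃ us L lam.state ε.z) i

/-- The modes of a delta function supported at `p` are the powers of `p`. Multiplication by `g` thus
becomes multiplication of a Laurent series in `z`, and the claim is the expansion of
`gfun_mul_psiRat`. -/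
theorem IsPsi.gfun_mul {χ : ℤ → Label a b → ℂ} {ε : Expansion} (hχ : IsPsi q₁ q₂ q₃ us ε χ)
    (hq : q₁ * q₂ * q₃ = 1) (hus : ∀ i, us i ≠ 0) (h : mu.state = lam.state + Pi.single r 1)
    (c : ℂ) (i j : ℤ) :
    mulGzw q₁ q₂ q₃ (fun i j => χ i mu * (c * pt q₁ (rowBase q₃ us) lam.state r ^ j)) i j =
      -mulGwz q₁ q₂ q₃ (fun i j => χ i lam * (c * pt q₁ (rowBase q₃ us) lam.state r ^ j)) i j := by
  obtain ⟨L, hL⟩ := lam.isState.exists_room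
  have hmu : Room (L + 1) mu.state := by
    rw [h]; exact hL.add_of_isState (h ▸ mu.isState)
  have hL' := hL.mono (Nat.le_succ L)
  have hr : r ∈ rows n (L + 1) := hL'.mem_rows_of_isState_add (h ▸ mu.isState)
  have hp : pt q₁ (rowBase q₃ us) lam.state r ≠ 0 := pt_ne_zero (ne_zero_left_of_prod hq)
    (fun r => mul_ne_zero (pow_ne_zero _ (ne_zero_right_of_prod hq)) (hus _)) _ r
  simp only [hχ mu _ hmu, hχ lam _ hL']
  rw [ε.mulGzw_seq _ _ _ _ hp, ε.mulGwz_seq _ _ _ _ hp, h, gfun_mul_psiRat _ hq hr ε.ne_C, map_neg,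
    Pi.neg_apply, neg_mul]

namespace Resonant

theorem psi_opE (H : Resonant a b q₁ q₂ q₃ u us) {χ : ℤ → Label a b → ℂ} {ε : Expansion}
    (hχ : IsPsi q₁ q₂ q₃ us ε χ) (i j : ℤ) :
    mulGzw q₁ q₂ q₃ (prodZW (fun i => opDiag (χ i)) (opE a b q₁ q₂ q₃ us)) i j =
      -mulGwz q₁ q₂ q₃ (prodWZ (fun i => opDiag (χ i)) (opE a b q₁ q₂ q₃ us)) i j := by
  refine end_ext_apply fun mu lam => ?_
  refine (map_mulGzw (φ := fun A : Module.End ℂ (MSpace a b) => A (ket lam) mu) (fun _ _ => rfl)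
    (fun _ _ => rfl) _ _ _ _ _ _).trans ?_
  refine Eq.trans ?_ (congrArg Neg.neg (map_mulGwz (φ := fun A : Module.End ℂ (MSpace a b) =>
    A (ket lam) mu) (fun _ _ => rfl) (fun _ _ => rfl) _ _ _ _ _ _).symm)
  simp only [prodZW, prodWZ, Module.End.mul_apply, opDiag_apply, opDiag_ket,
    map_smul, Finsupp.smul_apply, smul_eq_mul]
  by_cases h : ∃ r, mu.state = lam.state + Pi.single r 1
  · obtain ⟨r, h⟩ := h
    obtain ⟨L, hL⟩ := lam.isState.exists_room
    simp only [H.opE_apply hL h]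
    exact hχ.gfun_mul H.prod_eq_one H.us_ne h _ i j
  · simp only [opE_apply_eq_zero (not_exists.1 h), mul_zero, mulGzw_zero, mulGwz_zero, neg_zero]

/-- The identity is that for `e`, with the two basis vectors exchanged. -/
theorem psi_opF (H : Resonant a b q₁ q₂ q₃ u us) {χ : ℤ → Label a b → ℂ} {ε : Expansion}
    (hχ : IsPsi q₁ q₂ q₃ us ε χ) (i j : ℤ) :
    mulGwz q₁ q₂ q₃ (prodZW (fun i => opDiag (χ i)) (opF a b q₁ q₂ q₃ us)) i j =
      -mulGzw q₁ q₂ q₃ (prodWZ (fun i => opDiag (χ i)) (opF a b q₁ q₂ q₃ us)) i j := by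
  refine end_ext_apply fun mu lam => ?_
  refine (map_mulGwz (φ := fun A : Module.End ℂ (MSpace a b) => A (ket lam) mu) (fun _ _ => rfl)
    (fun _ _ => rfl) _ _ _ _ _ _).trans ?_
  refine Eq.trans ?_ (congrArg Neg.neg (map_mulGzw (φ := fun A : Module.End ℂ (MSpace a b) =>
    A (ket lam) mu) (fun _ _ => rfl) (fun _ _ => rfl) _ _ _ _ _ _).symm)
  simp only [prodZW, prodWZ, Module.End.mul_apply, opDiag_apply, opDiag_ket,
    map_smul, Finsupp.smul_apply, smul_eq_mul]
  by_cases h : ∃ r, lam.state = mu.state + Pi.single r 1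
  · obtain ⟨r, h⟩ := h
    obtain ⟨L, hL⟩ := lam.isState.exists_room
    simp only [H.opF_apply hL h]
    rw [hχ.gfun_mul H.prod_eq_one H.us_ne h, neg_neg]
  · simp only [opF_apply_eq_zero (not_exists.1 h), mul_zero, mulGzw_zero, mulGwz_zero, neg_zero]

end Resonant

/-- The coefficient of `z^{-k}` of the eigenvalue of `ψ⁺(z)`. -/
def psiPlusEig (q₁ q₂ q₃ : ℂ) (us : Fin (n + 1) → ℂ) (k : ℤ) (lam : Label a b) : ℂ :=
  (∏ i, fockPsiPlus HahnSeries.C q₁ q₂ q₃ (lam.1 i)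
    (HahnSeries.single 1 (us i) : LaurentSeries ℂ)).coeff k

/-- The coefficient of `z^{-k}` of the eigenvalue of `ψ⁻(z)`. -/
def psiMinusEig (q₁ q₂ q₃ : ℂ) (us : Fin (n + 1) → ℂ) (k : ℤ) (lam : Label a b) : ℂ :=
  (∏ i, fockPsiMinus HahnSeries.C q₁ q₂ q₃ (lam.1 i)
    (HahnSeries.single 1 (us i)⁻¹ : LaurentSeries ℂ)).coeff (-k)

theorem isPsi_psiPlusEig (hq : q₁ * q₂ * q₃ = 1) :
    IsPsi q₁ q₂ q₃ us Expansion.inf (psiPlusEig (a := a) (b := b) q₁ q₂ q₃ us) := by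
  intro lam L hL i
  rw [psiPlusEig, prod_fockPsiPlus_eq hq hL]
  rfl

theorem isPsi_psiMinusEig (hq : q₁ * q₂ * q₃ = 1) (hus : ∀ i, us i ≠ 0) :
    IsPsi q₁ q₂ q₃ us Expansion.zero (psiMinusEig (a := a) (b := b) q₁ q₂ q₃ us) := by
  intro lam L hL i
  rw [psiMinusEig, prod_fockPsiMinus_eq hq hus hL]
  rfl

theorem psiPlusEig_eq (hq : q₁ * q₂ * q₃ = 1) (hL : Room L lam.state) (k : ℕ) :
    psiPlusEig q₁ q₂ q₃ us k lam = PowerSeries.coeff k (∏ κ ∈ poles n L,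
      facInf (zeroAt q₁ q₂ q₃ us L lam.state κ) (poleAt q₁ q₃ us L lam.state κ)) := by
  rw [psiPlusEig, prod_fockPsiPlus_eq hq hL]
  change (psiRat HahnSeries.C q₁ q₂ q₃ us L lam.state zInf).coeff k = _
  rw [psiRat_zInf, PowerSeries.coeff_coe]
  simp

theorem psiPlusEig_of_neg (hq : q₁ * q₂ * q₃ = 1) {k : ℤ} (hk : k < 0) (lam : Label a b) :
    psiPlusEig q₁ q₂ q₃ us k lam = 0 := by
  rw [psiPlusEig, prod_fockPsiPlus_eq hq lam.room_spec]
  change (psiRat HahnSeries.C q₁ q₂ q₃ us lam.room lam.state zInf).coeff k = _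
  rw [psiRat_zInf, PowerSeries.coeff_coe, if_pos hk]

theorem psiMinusEig_eq (hq : q₁ * q₂ * q₃ = 1) (hus : ∀ i, us i ≠ 0) (hL : Room L lam.state)
    (k : ℕ) :
    psiMinusEig q₁ q₂ q₃ us (-k) lam = PowerSeries.coeff k (∏ κ ∈ poles n L,
      facZero (zeroAt q₁ q₂ q₃ us L lam.state κ) (poleAt q₁ q₃ us L lam.state κ)) := by
  rw [psiMinusEig, prod_fockPsiMinus_eq hq hus hL]
  change (psiRat HahnSeries.C q₁ q₂ q₃ us L lam.state zZero).coeff _ = _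
  rw [psiRat_zZero (ne_zero_left_of_prod hq) (ne_zero_right_of_prod hq) hus, PowerSeries.coeff_coe]
  simp

theorem psiMinusEig_of_pos (hq : q₁ * q₂ * q₃ = 1) (hus : ∀ i, us i ≠ 0) {k : ℤ} (hk : 0 < k)
    (lam : Label a b) : psiMinusEig q₁ q₂ q₃ us k lam = 0 := by
  rw [psiMinusEig, prod_fockPsiMinus_eq hq hus lam.room_spec]
  change (psiRat HahnSeries.C q₁ q₂ q₃ us lam.room lam.state zZero).coeff _ = _
  rw [psiRat_zZero (ne_zero_left_of_prod hq) (ne_zero_right_of_prod hq) hus, PowerSeries.coeff_coe,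
    if_pos (by omega)]

theorem psiPlusEig_zero (hq : q₁ * q₂ * q₃ = 1) (lam : Label a b) :
    psiPlusEig q₁ q₂ q₃ us 0 lam = 1 := by
  have := psiPlusEig_eq (us := us) hq lam.room_spec 0
  rw [Nat.cast_zero] at this
  rw [this, PowerSeries.coeff_zero_eq_constantCoeff_apply, map_prod]
  simp only [constantCoeff_facInf, Finset.prod_const_one]

theorem psiMinusEig_zero_ne (hq : q₁ * q₂ * q₃ = 1) (hus : ∀ i, us i ≠ 0) (lam : Label a b) :
    psiMinusEig q₁ q₂ q₃ us 0 lam ≠ 0 := by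
  have h1 := ne_zero_left_of_prod hq
  have h2 := ne_zero_mid_of_prod hq
  have h3 := ne_zero_right_of_prod hq
  have := psiMinusEig_eq hq hus lam.room_spec 0
  rw [Nat.cast_zero, neg_zero] at this
  rw [this, PowerSeries.coeff_zero_eq_constantCoeff_apply, map_prod]
  refine Finset.prod_ne_zero_iff.2 fun κ _ => ?_
  rw [constantCoeff_facZero _ (poleAt_ne_zero h1 h3 hus κ)]
  refine div_ne_zero ?_ (poleAt_ne_zero h1 h3 hus κ)
  have hp : ∀ r, pt q₁ (rowBase q₃ us) lam.state r ≠ 0 :=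
    pt_ne_zero h1 (fun _ => mul_ne_zero (pow_ne_zero _ h3) (hus _)) _
  rcases κ with ⟨r, _ | _⟩ | m
  · exact mul_ne_zero h3 (hp r)
  · exact mul_ne_zero h2 (hp r)
  · exact mul_ne_zero h2 (mul_ne_zero (pow_ne_zero _ h3) (hus m))

end Operators

/-! ## The diagonal part of the commutator of `e(z)` and `f(z)` for generic parameters -/

section Diagonal

variable {n : ℕ} {q₁ q₂ q₃ : ℂ} {us : Fin (n + 1) → ℂ} {X : Row n → ℤ} {L : ℕ} {r : Row n}

/-- `e` sees the rows before `r` and the tails of earlier partitions, `f` sees the others. The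
product is, up to a constant, the eigenvalue of `ψ` without the factor of `r` itself. -/
theorem coefE_mul_coefF (r : Row n) :
    coefE q₁ q₂ q₃ us L X r * coefF q₁ q₂ q₃ us L X r =
      q₁ * (1 - q₁)⁻¹ ^ 2 * (∏ m, tailFactor q₂ (q₃ ^ L * us m) (pt q₁ (rowBase q₃ us) X r)) *
        ∏ r' ∈ (rows n L).erase r,
          phi q₁ q₂ q₃ (pt q₁ (rowBase q₃ us) X r') (pt q₁ (rowBase q₃ us) X r) := by
  have h1 : ∏ m, tailFactor q₂ (q₃ ^ L * us m) (pt q₁ (rowBase q₃ us) X r) =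
      (∏ m, if m < r.1 then tailFactor q₂ (q₃ ^ L * us m) (pt q₁ (rowBase q₃ us) X r) else 1) *
      ∏ m, if r.1 ≤ m then tailFactor q₂ (q₃ ^ L * us m) (pt q₁ (rowBase q₃ us) X r) else 1 := by
    rw [← Finset.prod_mul_distrib]
    refine Finset.prod_congr rfl fun m _ => ?_
    by_cases h : m < r.1
    · rw [if_pos h, if_neg (not_le.2 h), mul_one]
    · rw [if_neg h, if_pos (not_lt.1 h), one_mul]
  have h2 : ∏ r' ∈ (rows n L).erase r,
        phi q₁ q₂ q₃ (pt q₁ (rowBase q₃ us) X r') (pt q₁ (rowBase q₃ us) X r) =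
      (∏ r' ∈ rows n L with rowLt r' r,
        phi q₁ q₂ q₃ (pt q₁ (rowBase q₃ us) X r') (pt q₁ (rowBase q₃ us) X r)) *
      ∏ r' ∈ rows n L with rowLt r r',
        phi q₁ q₂ q₃ (pt q₁ (rowBase q₃ us) X r') (pt q₁ (rowBase q₃ us) X r) := by
    rw [← Finset.prod_union]
    · refine Finset.prod_congr ?_ fun _ _ => rfl
      ext r'
      have ho := isRowOrder_rowLt n
      simp only [Finset.mem_erase, Finset.mem_union, Finset.mem_filter]
      constructor
      · rintro ⟨hne, hm⟩
        exact (ho.total hne).imp (fun h => ⟨hm, h⟩) fun h => ⟨hm, h⟩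
      · rintro (⟨hm, h⟩ | ⟨hm, h⟩)
        · exact ⟨ho.ne h, hm⟩
        · exact ⟨(ho.ne h).symm, hm⟩
    · rw [Finset.disjoint_filter]
      exact fun _ _ h h' => (isRowOrder_rowLt n).asymm h h'
  rw [h1, h2]
  simp only [coefE, coefF, coef, extE, extF]
  simp only [pt]
  ring

theorem prod_erase_eq {J M : Type*} [DecidableEq J] [CommMonoid M] {I : Finset J} {κ : J}
    (hκ : κ ∈ I) (g : J → M) :
    ∏ l ∈ I.erase κ, g l = ∏ l ∈ I, if l = κ then 1 else g l := by
  rw [← Finset.mul_prod_erase _ _ hκ, if_pos rfl, one_mul]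
  exact Finset.prod_congr rfl fun l hl => (if_neg (Finset.ne_of_mem_erase hl)).symm

theorem inl_mem_poles {c : Bool} : (.inl (r, c) : Pole n) ∈ poles n L ↔ r ∈ rows n L := by
  simp [poles]

theorem prod_poles_erase {M : Type*} [CommMonoid M] (hr : r ∈ rows n L) (c : Bool)
    (g : Pole n → M) :
    ∏ κ ∈ (poles n L).erase (.inl (r, c)), g κ = (∏ m, g (.inr m)) * (g (.inl (r, !c)) *
      ∏ r' ∈ (rows n L).erase r, g (.inl (r', false)) * g (.inl (r', true))) := by
  rw [prod_erase_eq (inl_mem_poles.2 hr), prod_poles, ← Finset.mul_prod_erase _ _ hr]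
  congr 1
  congr 1
  · cases c <;> simp
  · refine Finset.prod_congr rfl fun r' hr' => ?_
    have := Finset.ne_of_mem_erase hr'
    simp [this]

theorem prod_phi_tail (r : Row n) (z : ℂ) :
    (∏ m, (z - zeroAt q₁ q₂ q₃ us L X (.inr m)) / (z - poleAt q₁ q₃ us L X (.inr m))) =
      ∏ m, tailFactor q₂ (q₃ ^ L * us m) z ∧
    (∏ r' ∈ (rows n L).erase r,
      (z - zeroAt q₁ q₂ q₃ us L X (.inl (r', false))) /
          (z - poleAt q₁ q₃ us L X (.inl (r', false))) *
        ((z - zeroAt q₁ q₂ q₃ us L X (.inl (r', true))) /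
          (z - poleAt q₁ q₃ us L X (.inl (r', true))))) =
      ∏ r' ∈ (rows n L).erase r, phi q₁ q₂ q₃ (pt q₁ (rowBase q₃ us) X r') z := by
  constructor
  · rfl
  · simp only [zeroAt, poleAt, phi, div_mul_div_comm]

namespace Separated

theorem one_sub_ne (H : Separated q₁ q₂ q₃ us) : 1 - q₁ ≠ 0 ∧ 1 - q₂ ≠ 0 ∧ 1 - q₃ ≠ 0 := by
  refine ⟨fun h => ?_, fun h => ?_, fun h => ?_⟩
  · have := (H.indep 1 0 (by rw [zpow_one, zpow_zero]; linear_combination -h)).1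
    omega
  · have := (H.indep (-1) (-1) (by
      rw [← q2_eq_of_prod H.prod_eq_one]; linear_combination -h)).1
    omega
  · have := (H.indep 0 1 (by rw [zpow_one, zpow_zero]; linear_combination -h)).2
    omega

/-- The other rows give `coefE_mul_coefF`, while row `r` leaves `(1 - q₂) (1 - q₃) / (1 - q₁⁻¹)`
times the weight. -/
theorem residue_add (H : Separated q₁ q₂ q₃ us) (hr : r ∈ rows n L) :
    residue (poles n L) (zeroAt q₁ q₂ q₃ us L X) (poleAt q₁ q₃ us L X) (.inl (r, false)) =
      -((1 - q₁) * (1 - q₂) * (1 - q₃) * (coefE q₁ q₂ q₃ us L X r * coefF q₁ q₂ q₃ us L X r) *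
        pt q₁ (rowBase q₃ us) X r) := by
  rw [residue_eq (inl_mem_poles.2 hr), prod_poles_erase hr, (prod_phi_tail r _).1,
    (prod_phi_tail r _).2, coefE_mul_coefF r]
  have hp := H.pt_ne_zero X r
  have h1 := H.q1_ne
  have h2 := H.one_sub_ne.1
  have h2' : q₁ - 1 ≠ 0 := fun h => h2 (by linear_combination -h)
  simp only [Bool.not_false, zeroAt, poleAt]
  have e : (pt q₁ (rowBase q₃ us) X r - q₂ * pt q₁ (rowBase q₃ us) X r) /
      (pt q₁ (rowBase q₃ us) X r - q₁⁻¹ * pt q₁ (rowBase q₃ us) X r) =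
      -(q₁ * (1 - q₂) * (1 - q₁)⁻¹) := by
    rw [show pt q₁ (rowBase q₃ us) X r - q₁⁻¹ * pt q₁ (rowBase q₃ us) X r =
      (q₁ - 1) * q₁⁻¹ * pt q₁ (rowBase q₃ us) X r by field_simp]
    rw [div_eq_iff (mul_ne_zero (mul_ne_zero h2' (inv_ne_zero h1)) hp)]
    field_simp
    ring
  rw [e]
  field_simp

/-- The pole `q₁⁻¹ p` is the weight of the last box of row `r`, so the coefficients are those of the
state with this box removed. -/
theorem residue_sub (H : Separated q₁ q₂ q₃ us) (hr : r ∈ rows n L) :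
    residue (poles n L) (zeroAt q₁ q₂ q₃ us L X) (poleAt q₁ q₃ us L X) (.inl (r, true)) =
      (1 - q₁) * (1 - q₂) * (1 - q₃) * (coefE q₁ q₂ q₃ us L (X - Pi.single r 1) r *
        coefF q₁ q₂ q₃ us L (X - Pi.single r 1) r) *
        pt q₁ (rowBase q₃ us) (X - Pi.single r 1) r := by
  have hp := H.pt_ne_zero X r
  have h1 := H.q1_ne
  have h2 := H.one_sub_ne.1
  have h2' : q₁ - 1 ≠ 0 := fun h => h2 (by linear_combination -h)
  have hpt : pt q₁ (rowBase q₃ us) (X - Pi.single r 1) r = q₁⁻¹ * pt q₁ (rowBase q₃ us) X r :=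
    pt_sub_single_self h1 _ _ _
  have hΦ : ∏ r' ∈ (rows n L).erase r, phi q₁ q₂ q₃
        (pt q₁ (rowBase q₃ us) (X - Pi.single r 1) r') (q₁⁻¹ * pt q₁ (rowBase q₃ us) X r) =
      ∏ r' ∈ (rows n L).erase r, phi q₁ q₂ q₃
        (pt q₁ (rowBase q₃ us) X r') (q₁⁻¹ * pt q₁ (rowBase q₃ us) X r) :=
    Finset.prod_congr rfl fun r' hr' => by
      rw [pt_sub_single_of_ne _ _ _ (Finset.ne_of_mem_erase hr')]
  rw [residue_eq (inl_mem_poles.2 hr), prod_poles_erase hr, (prod_phi_tail r _).1,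
    (prod_phi_tail r _).2, coefE_mul_coefF r, hpt, hΦ]
  simp only [Bool.not_true, zeroAt, poleAt]
  set p := pt q₁ (rowBase q₃ us) X r
  have e3 := H.prod_eq_one
  have e : (q₁⁻¹ * p - q₂ * p) * ((q₁⁻¹ * p - q₃ * p) / (q₁⁻¹ * p - p)) =
      q₁ * (1 - q₁)⁻¹ * (1 - q₂) * (1 - q₃) * (q₁⁻¹ * p) := by
    rw [show q₁⁻¹ * p - p = (1 - q₁) * q₁⁻¹ * p by field_simp, mul_div_assoc',
      div_eq_iff (mul_ne_zero (mul_ne_zero h2 (inv_ne_zero h1)) hp)]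
    field_simp
    linear_combination (q₁ - 1) * e3
  set T := ∏ m, tailFactor q₂ (q₃ ^ L * us m) (q₁⁻¹ * p)
  set Φ := ∏ r' ∈ (rows n L).erase r, phi q₁ q₂ q₃ (pt q₁ (rowBase q₃ us) X r') (q₁⁻¹ * p)
  rw [show (q₁⁻¹ * p - q₂ * p) * (T * ((q₁⁻¹ * p - q₃ * p) / (q₁⁻¹ * p - p) * Φ)) =
    (q₁⁻¹ * p - q₂ * p) * ((q₁⁻¹ * p - q₃ * p) / (q₁⁻¹ * p - p)) * (T * Φ) by ring, e]
  field_simp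

/-- The pole `q₃ ^ L u_m` of the tail is cancelled by the zero `q₃ p` of row `L - 1`. This is why
`Room L` requires row `L - 1` to be empty. -/
theorem residue_tail (hX : Room L X) (m : Fin (n + 1)) :
    residue (poles n L) (zeroAt q₁ q₂ q₃ us L X) (poleAt q₁ q₃ us L X) (.inr m) = 0 := by
  have hL := hX.pos
  refine mul_eq_zero_of_left (Finset.prod_eq_zero (i := .inl ((m, L - 1), false))
    (inl_mem_poles.2 (mem_rows.2 (by dsimp only; omega))) ?_) _
  simp only [zeroAt, poleAt]
  rw [pt_rowBase_of_eq_zero _ _ _ (hX.eq_zero m (L - 1) (by omega)), ← mul_assoc, ← pow_succ',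
    Nat.sub_add_cancel hL, sub_self]

/-- The exponent of `q₃` and the parameter `u_i` reveal the row, or a tail if the exponent is `L`;
the exponent of `q₁` then distinguishes the two poles of a row. -/
theorem injOn_poleAt (H : Separated q₁ q₂ q₃ us) : Set.InjOn (poleAt q₁ q₃ us L X) (poles n L) := by
  have h1 := H.q1_ne
  have h3 := H.q3_ne
  -- every pole is a monomial
  have hmon : ∀ κ ∈ poles n L, ∃ (x : ℤ) (y : ℕ) (i : Fin (n + 1)),
      poleAt q₁ q₃ us L X κ = q₁ ^ x * q₃ ^ (y : ℤ) * us i ∧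
      (∀ r c, κ = .inl (r, c) → i = r.1 ∧ y = r.2 ∧ y < L ∧ x = X r - if c then 1 else 0) ∧
      ∀ m, κ = .inr m → i = m ∧ y = L := by
    rintro (⟨r, _ | _⟩ | m) hκ
    · refine ⟨X r, r.2, r.1, ?_, ?_, by simp⟩
      · simp only [poleAt, pt, rowBase, zpow_natCast]; ring
      · rintro r' c h
        obtain ⟨rfl, rfl⟩ := Prod.mk.inj (Sum.inl.inj h)
        simpa using mem_rows.1 (inl_mem_poles.1 hκ)
    · refine ⟨X r - 1, r.2, r.1, ?_, ?_, by simp⟩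
      · simp only [poleAt, pt, rowBase, zpow_natCast, zpow_sub_one₀ h1]; ring
      · rintro r' c h
        obtain ⟨rfl, rfl⟩ := Prod.mk.inj (Sum.inl.inj h)
        simpa using mem_rows.1 (inl_mem_poles.1 hκ)
    · refine ⟨0, L, m, by simp [poleAt], by simp, ?_⟩
      rintro m' h
      exact ⟨Sum.inr.inj h, rfl⟩
  have hinj : ∀ {x y x' y' : ℤ} {i i' : Fin (n + 1)},
      q₁ ^ x * q₃ ^ y * us i = q₁ ^ x' * q₃ ^ y' * us i' → i = i' ∧ x = x' ∧ y = y' := by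
    intro x y x' y' i i' h
    have h' : us i = q₁ ^ (x' - x) * q₃ ^ (y' - y) * us i' := by
      rw [zpow_sub₀ h1, zpow_sub₀ h3]
      field_simp
      linear_combination h
    by_cases hi : i = i'
    · subst hi
      have := H.indep _ _ (mul_right_cancel₀ (H.ne_zero i) (h'.symm.trans (one_mul _).symm))
      omega
    · exact absurd h' (H.sep _ _ hi _ _)
  intro κ hκ κ' hκ' h
  obtain ⟨x, y, i, e, g1, g2⟩ := hmon κ hκ
  obtain ⟨x', y', i', e', g1', g2'⟩ := hmon κ' hκ'
  rw [e, e'] at h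
  obtain ⟨a1, a2, a3⟩ := hinj h
  rcases κ with ⟨r, c⟩ | m <;> rcases κ' with ⟨r', c'⟩ | m'
  · obtain ⟨b1, b2, b3, b4⟩ := g1 r c rfl
    obtain ⟨b1', b2', b3', b4'⟩ := g1' r' c' rfl
    obtain rfl : r = r' := Prod.ext (by rw [← b1, ← b1', a1]) (by omega)
    have : c = c' := by
      cases c <;> cases c' <;> simp at b4 b4' ⊢ <;> omega
    rw [this]
  · have := g1 r c rfl
    have := g2' m' rfl
    omega
  · have := g2 m rfl
    have := g1' r' c' rfl
    omega
  · rw [← (g2 m rfl).1, ← (g2' m' rfl).1, a1]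

/-- The diagonal part of the commutator for generic parameters. -/
theorem sum_coefE_mul_coefF (H : Separated q₁ q₂ q₃ us) (hX : Room L X) (m : ℤ) :
    ∑ r ∈ rows n L, (coefE q₁ q₂ q₃ us L (X - Pi.single r 1) r *
          coefF q₁ q₂ q₃ us L (X - Pi.single r 1) r *
          pt q₁ (rowBase q₃ us) (X - Pi.single r 1) r ^ m -
        coefE q₁ q₂ q₃ us L X r * coefF q₁ q₂ q₃ us L X r * pt q₁ (rowBase q₃ us) X r ^ m) =
      ((1 - q₁) * (1 - q₂) * (1 - q₃))⁻¹ *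
        ((psiRat HahnSeries.C q₁ q₂ q₃ us L X zInf).coeff m -
          (psiRat HahnSeries.C q₁ q₂ q₃ us L X zZero).coeff (-m)) := by
  obtain ⟨g1, g2, g3⟩ := H.one_sub_ne
  rw [psiRat_eq_prod, psiRat_eq_prod, coeff_zInf_sub_coeff_zZero H.injOn_poleAt
    (fun κ _ => poleAt_ne_zero H.q1_ne H.q3_ne H.ne_zero κ), poles, Finset.sum_disjSum,
    Finset.sum_product]
  have h0 : ∀ i ∈ Finset.univ, residue (poles n L) (zeroAt q₁ q₂ q₃ us L X) (poleAt q₁ q₃ us L X)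
      (.inr i) * poleAt q₁ q₃ us L X (.inr i) ^ (m - 1) = 0 := fun i _ => by
    rw [residue_tail hX, zero_mul]
  rw [← poles, Finset.sum_eq_zero h0, add_zero, Finset.mul_sum]
  refine Finset.sum_congr rfl fun r hr => ?_
  have hp := H.pt_ne_zero X r
  have hp' := H.pt_ne_zero (X - Pi.single r 1) r
  have hpt : poleAt q₁ q₃ us L X (.inl (r, true)) =
      pt q₁ (rowBase q₃ us) (X - Pi.single r 1) r := (pt_sub_single_self H.q1_ne _ _ _).symm
  rw [Fintype.sum_bool, H.residue_add hr, H.residue_sub hr, hpt]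
  change _ = _ * (_ + _ * pt q₁ (rowBase q₃ us) X r ^ (m - 1))
  rw [zpow_sub_one₀ hp, zpow_sub_one₀ hp']
  field_simp
  ring

end Separated

end Diagonal

/-! ## Generic parameters accumulate everywhere -/

section Density

theorem countable_exp_eq (c : ℂ) : {w : ℂ | Complex.exp w = c}.Countable := by
  by_cases h : ∃ w₀, Complex.exp w₀ = c
  · obtain ⟨w₀, rfl⟩ := h
    refine (Set.countable_range fun m : ℤ => w₀ + m * (2 * Real.pi * Complex.I)).mono ?_
    intro w hw
    obtain ⟨m, hm⟩ := Complex.exp_eq_exp_iff_exists_int.1 hw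
    exact ⟨m, hm.symm⟩
  · push Not at h
    refine Set.countable_empty.mono fun w hw => absurd hw (h w)

/-- On this curve a monomial relation prescribes `exp` of a polynomial in `t`. The powers `t ^ (k +
1)` are distinct and not constant, so the polynomial is not constant for `j ≠ 0`. There are
countably many `j` and logarithms, each with finitely many `t`. -/
theorem countable_not_generic {N : ℕ} {v : Fin N → ℂ} (hv : ∀ k, v k ≠ 0) :
    {t : ℂ | ¬Generic fun k => v k * Complex.exp (t ^ (k.1 + 1))}.Countable := by
  have hsub : {t : ℂ | ¬Generic fun k => v k * Complex.exp (t ^ (k.1 + 1))} ⊆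
      ⋃ j : {j : Fin N → ℤ // j ≠ 0}, ⋃ w ∈ {w : ℂ | Complex.exp w = (∏ k, v k ^ j.1 k)⁻¹},
        {t | ∑ k, (j.1 k : ℂ) * t ^ (k.1 + 1) = w} := by
    intro t ht
    have : ∃ j : Fin N → ℤ, (∏ k, (v k * Complex.exp (t ^ (k.1 + 1))) ^ j k = 1) ∧ j ≠ 0 := by
      by_contra hcon
      push Not at hcon
      exact ht ⟨fun k => mul_ne_zero (hv k) (Complex.exp_ne_zero _), hcon⟩
    obtain ⟨j, hj, hj0⟩ := this
    simp only [Set.mem_iUnion, Set.mem_ofPred_eq]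
    refine ⟨⟨j, hj0⟩, _, ?_, rfl⟩
    rw [Complex.exp_sum]
    simp only [mul_zpow, Finset.prod_mul_distrib, ← Complex.exp_int_mul] at hj
    exact eq_inv_of_mul_eq_one_right hj
  refine Set.Countable.mono hsub (Set.countable_iUnion fun j =>
    (countable_exp_eq _).biUnion fun w _ => Set.Finite.countable ?_)
  obtain ⟨k₀, hk₀⟩ : ∃ k, j.1 k ≠ 0 := by
    by_contra hcon
    push Not at hcon
    exact j.2 (funext hcon)
  set P : Polynomial ℂ := (∑ k, Polynomial.C (j.1 k : ℂ) * Polynomial.X ^ (k.1 + 1)) -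
    Polynomial.C w with hP
  have hP0 : P ≠ 0 := by
    intro h
    have := congrArg (fun Q => Polynomial.coeff Q (k₀.1 + 1)) h
    simp only [hP, Polynomial.coeff_sub, Polynomial.finsetSum_coeff, Polynomial.coeff_C_mul,
      Polynomial.coeff_X_pow, Polynomial.coeff_C_succ, sub_zero, Polynomial.coeff_zero] at this
    rw [Finset.sum_eq_single_of_mem k₀ (Finset.mem_univ _)] at this
    · simp [hk₀] at this
    · intro k _ hk
      rw [if_neg (by simpa [Fin.ext_iff] using Ne.symm hk), mul_zero]
  refine (P.roots.toFinset.finite_toSet).subset fun t ht => ?_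
  rw [Finset.mem_coe, Multiset.mem_toFinset, Polynomial.mem_roots hP0, Polynomial.IsRoot.def]
  simp [hP, Polynomial.eval_finsetSum, ht.out]

/-- The curve of `countable_not_generic` passes through the given point at `t = 0`, and the
complement of a countable set is dense in `ℂ`. -/
theorem neBot_genericNhds {N : ℕ} {q₁ q₂ : ℂ} {us : Fin N → ℂ} (h1 : q₁ ≠ 0) (h2 : q₂ ≠ 0)
    (hus : ∀ i, us i ≠ 0) : (genericNhds (q₁, q₂, us)).NeBot := by
  set v : Fin (N + 2) → ℂ := Matrix.vecCons q₁ (Matrix.vecCons q₂ us) with hv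
  have hv0 : ∀ k, v k ≠ 0 := by
    intro k
    refine Fin.cases h1 (fun k => Fin.cases h2 (fun k => hus k) k) k
  set γ : ℂ → Param N := fun t => (q₁ * Complex.exp (t ^ (0 + 1)),
    q₂ * Complex.exp (t ^ (1 + 1)), fun i => us i * Complex.exp (t ^ (i.1 + 2 + 1))) with hγ
  have hγv : ∀ t, (Matrix.vecCons (γ t).1 (Matrix.vecCons (γ t).2.1 (γ t).2.2) : Fin (N + 2) → ℂ) =
      fun k => v k * Complex.exp (t ^ (k.1 + 1)) := by
    intro t
    funext k
    refine Fin.cases rfl (fun k => Fin.cases rfl (fun k => rfl) k) k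
  set S : Set ℂ := {t : ℂ | Generic fun k => v k * Complex.exp (t ^ (k.1 + 1))} with hS
  have hdense : Dense S := by
    have := (countable_not_generic hv0).dense_compl ℂ
    have e : {t : ℂ | ¬Generic fun k => v k * Complex.exp (t ^ (k.1 + 1))}ᶜ = S := by
      ext t; simp [hS]
    rwa [e] at this
  have : (𝓝[S] (0 : ℂ)).NeBot := mem_closure_iff_nhdsWithin_neBot.1 (hdense 0)
  have hcont : Continuous γ := by
    rw [hγ]
    fun_prop
  have h0 : γ 0 = (q₁, q₂, us) := by simp [hγ]
  have ht : Tendsto γ (𝓝[S] 0) (genericNhds (q₁, q₂, us)) := by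
    refine tendsto_nhdsWithin_iff.2 ⟨?_, ?_⟩
    · rw [← h0]
      exact (hcont.tendsto 0).mono_left nhdsWithin_le_nhds
    · filter_upwards [self_mem_nhdsWithin] with t ht
      rw [hγv]
      exact ht
  exact ht.neBot

end Density

/-! ## Limits of the matrix coefficients -/

section Limits

variable {n : ℕ} {a b : Fin n → ℕ} {q₁ q₂ q₃ u : ℂ} {us : Fin (n + 1) → ℂ} {X : Row n → ℤ}
  {L : ℕ} {r : Row n} {lam mu : Label a b}

/-- The third parameter. -/
def Param.q3 {N : ℕ} (p : Param N) : ℂ := (p.1 * p.2.1)⁻¹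

theorem eventually_separated (p₀ : Param (n + 1)) :
    ∀ᶠ p in genericNhds p₀, Separated p.1 p.2.1 (Param.q3 p) p.2.2 := by
  filter_upwards [self_mem_nhdsWithin] with p hp
  exact Generic.separated hp

namespace Resonant

theorem tendsto_q1 (p₀ : Param (n + 1)) : Tendsto (fun p => p.1) (genericNhds p₀) (𝓝 p₀.1) :=
  (continuous_fst.tendsto p₀).mono_left nhdsWithin_le_nhds

theorem tendsto_q2 (p₀ : Param (n + 1)) : Tendsto (fun p => p.2.1) (genericNhds p₀) (𝓝 p₀.2.1) :=
  ((continuous_fst.comp continuous_snd).tendsto p₀).mono_left nhdsWithin_le_nhds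

theorem tendsto_us (p₀ : Param (n + 1)) (i : Fin (n + 1)) :
    Tendsto (fun p => p.2.2 i) (genericNhds p₀) (𝓝 (p₀.2.2 i)) :=
  (((continuous_apply i).comp (continuous_snd.comp continuous_snd)).tendsto p₀).mono_left
    nhdsWithin_le_nhds

theorem tendsto_q3 (H : Resonant a b q₁ q₂ q₃ u us) :
    Tendsto Param.q3 (genericNhds (q₁, q₂, us)) (𝓝 q₃) := by
  have := ((tendsto_q1 (q₁, q₂, us)).mul (tendsto_q2 (q₁, q₂, us))).inv₀
    (mul_ne_zero H.q1_ne H.q2_ne)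
  rwa [← eq_inv_of_mul_eq_one_right H.prod_eq_one] at this

theorem tendsto_pt (H : Resonant a b q₁ q₂ q₃ u us) (X : Row n → ℤ) (r : Row n) :
    Tendsto (fun p => pt p.1 (rowBase (Param.q3 p) p.2.2) X r) (genericNhds (q₁, q₂, us))
      (𝓝 (pt q₁ (rowBase q₃ us) X r)) :=
  ((tendsto_q1 (q₁, q₂, us)).zpow₀ _ (Or.inl H.q1_ne)).mul
    ((H.tendsto_q3.pow _).mul (tendsto_us (q₁, q₂, us) r.1))

theorem tendsto_phi (H : Resonant a b q₁ q₂ q₃ u us) {r' : Row n}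
    (h : level b r = level b r' → col a X r ≠ col a X r' ∧ col a X r + 1 ≠ col a X r') :
    Tendsto (fun p => phi p.1 p.2.1 (Param.q3 p) (pt p.1 (rowBase (Param.q3 p) p.2.2) X r')
        (pt p.1 (rowBase (Param.q3 p) p.2.2) X r)) (genericNhds (q₁, q₂, us))
      (𝓝 (phi q₁ q₂ q₃ (pt q₁ (rowBase q₃ us) X r') (pt q₁ (rowBase q₃ us) X r))) := by
  have hd := H.phi_den_ne_zero h
  have h1 := H.tendsto_pt X r
  have h2 := H.tendsto_pt X r'
  exact ((h1.sub (H.tendsto_q3.mul h2)).mul (h1.sub ((tendsto_q2 (q₁, q₂, us)).mul h2))).div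
    ((h1.sub h2).mul (h1.sub (((tendsto_q1 (q₁, q₂, us)).inv₀ H.q1_ne).mul h2)))
    (mul_ne_zero hd.1 hd.2)

theorem tendsto_tail (H : Resonant a b q₁ q₂ q₃ u us) (hr : r ∈ rows n L) (h0 : 0 ≤ X r)
    (m : Fin (n + 1)) :
    Tendsto (fun p => tailFactor p.2.1 (Param.q3 p ^ L * p.2.2 m)
        (pt p.1 (rowBase (Param.q3 p) p.2.2) X r)) (genericNhds (q₁, q₂, us))
      (𝓝 (tailFactor q₂ (q₃ ^ L * us m) (pt q₁ (rowBase q₃ us) X r))) := by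
  have h1 := H.tendsto_pt X r
  have h2 := (H.tendsto_q3.pow L).mul (tendsto_us (q₁, q₂, us) m)
  refine (h1.sub ((tendsto_q2 (q₁, q₂, us)).mul h2)).div (h1.sub h2) (sub_ne_zero.2 ?_)
  have := H.pt_ne_tail hr h0 (x := 0) (y := 0) (by omega) m
  rwa [zpow_zero, zpow_zero, one_mul, one_mul] at this

theorem tendsto_coefE (H : Resonant a b q₁ q₂ q₃ u us) (hr : r ∈ rows n L) (h0 : 0 ≤ X r)
    (h : ∀ r', rowLt r' r → level b r = level b r' →
      col a X r ≠ col a X r' ∧ col a X r + 1 ≠ col a X r') :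
    Tendsto (fun p => coefE p.1 p.2.1 (Param.q3 p) p.2.2 L X r) (genericNhds (q₁, q₂, us))
      (𝓝 (coefE q₁ q₂ q₃ us L X r)) := by
  refine (((tendsto_const_nhds.sub (tendsto_q1 (q₁, q₂, us))).inv₀ H.one_sub_q1_ne).mul
    (tendsto_finsetProd _ fun m _ => ?_)).mul (tendsto_finsetProd _ fun r' hr' =>
      H.tendsto_phi (h r' (Finset.mem_filter.1 hr').2))
  split_ifs
  · exact H.tendsto_tail hr h0 m
  · exact tendsto_const_nhds

theorem tendsto_coefF (H : Resonant a b q₁ q₂ q₃ u us) (hr : r ∈ rows n L) (h0 : 0 ≤ X r)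
    (h : ∀ r', rowLt r r' → level b r = level b r' →
      col a X r ≠ col a X r' ∧ col a X r + 1 ≠ col a X r') :
    Tendsto (fun p => coefF p.1 p.2.1 (Param.q3 p) p.2.2 L X r) (genericNhds (q₁, q₂, us))
      (𝓝 (coefF q₁ q₂ q₃ us L X r)) := by
  refine (((tendsto_q1 (q₁, q₂, us)).mul ((tendsto_const_nhds.sub
    (tendsto_q1 (q₁, q₂, us))).inv₀ H.one_sub_q1_ne)).mul
    (tendsto_finsetProd _ fun m _ => ?_)).mul (tendsto_finsetProd _ fun r' hr' =>
      H.tendsto_phi (h r' (Finset.mem_filter.1 hr').2))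
  split_ifs
  · exact H.tendsto_tail hr h0 m
  · exact tendsto_const_nhds

end Resonant

/-- A row touches a row of the same level above it only if it is as long as the previous row. -/
theorem IsState.row_eq_of_col_add_one_eq (h : IsState a b X) {r' : Row n} (hlt : rowLt r' r)
    (hl : level b r = level b r') (hc : col a X r + 1 = col a X r') :
    ∃ s, r.2 = s + 1 ∧ X (r.1, s) = X r := by
  obtain ⟨i, t⟩ := r
  obtain ⟨j, s⟩ := r'
  have hji : j < i := by
    rcases hlt with h' | ⟨h', h''⟩
    · exact h'
    · obtain rfl : j = i := h'
      simp only [level] at hl h''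
      omega
  have hB := offset_strictMono b hji
  simp only [level] at hl
  obtain ⟨t, rfl⟩ : ∃ t', t = t' + 1 := ⟨t - 1, by omega⟩
  refine ⟨t, rfl, ?_⟩
  have h1 := h.interlace i hji s t (by simp only [level]; push_cast at hl; omega)
  have h2 := h.succ_le i t
  simp only [col] at h1 hc
  dsimp only
  omega

/-- A row touches a row of the same level below it only if it is as long as the next row. -/
theorem IsState.row_eq_of_col_eq_add_one (h : IsState a b X) {r' : Row n} (hlt : rowLt r r')
    (hl : level b r = level b r') (hc : col a X r = col a X r' + 1) :
    X (r.1, r.2 + 1) = X r := by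
  obtain ⟨i, s⟩ := r
  obtain ⟨j, t⟩ := r'
  have hji : i < j := by
    rcases hlt with h' | ⟨h', h''⟩
    · exact h'
    · obtain rfl : i = j := h'
      simp only [level] at hl h''
      omega
  have h1 := h.interlace j hji (s + 1) t (by simp only [level] at hl ⊢; push_cast; omega)
  have h2 := h.succ_le i s
  simp only [col] at h1 hc
  dsimp only
  omega

namespace Resonant

/-- A pole can occur only if `r` touches an earlier row of its level. Then the previous row of its
partition has the same length, and `coefE` vanishes identically in the parameters. -/
theorem tendsto_diag_add (H : Resonant a b q₁ q₂ q₃ u us) (hX : IsState a b X)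
    (hr : r ∈ rows n L) :
    Tendsto (fun p => coefE p.1 p.2.1 (Param.q3 p) p.2.2 L X r *
        coefF p.1 p.2.1 (Param.q3 p) p.2.2 L X r) (genericNhds (q₁, q₂, us))
      (𝓝 (coefE q₁ q₂ q₃ us L X r * coefF q₁ q₂ q₃ us L X r)) := by
  by_cases h : ∃ s, r.2 = s + 1 ∧ X (r.1, s) = X r
  · obtain ⟨s, hs, hXs⟩ := h
    simp only [coefE_eq_zero_of_row_eq hr hs hXs, zero_mul]
    exact tendsto_const_nhds
  · refine (H.tendsto_coefE hr (hX.nonneg r) fun r' hlt hl => ?_).mul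
      (H.tendsto_coefF hr (hX.nonneg r) fun r' hlt hl => ?_)
    · have := hX.col_le_of_level_eq hlt hl.symm
      exact ⟨by omega, fun hc => h (hX.row_eq_of_col_add_one_eq hlt hl hc)⟩
    · have := hX.col_le_of_level_eq hlt hl
      omega

/-- A pole can occur only if `r` touches a later row of its level. Then the next row of its
partition has the same length, and `coefF` vanishes for generic parameters as well as in the limit.
-/
theorem tendsto_diag_sub (H : Resonant a b q₁ q₂ q₃ u us) (hX : IsState a b X) (hL : Room L X)
    (hr : r ∈ rows n L) :
    Tendsto (fun p => coefE p.1 p.2.1 (Param.q3 p) p.2.2 L (X - Pi.single r 1) r *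
        coefF p.1 p.2.1 (Param.q3 p) p.2.2 L (X - Pi.single r 1) r) (genericNhds (q₁, q₂, us))
      (𝓝 (coefE q₁ q₂ q₃ us L (X - Pi.single r 1) r *
        coefF q₁ q₂ q₃ us L (X - Pi.single r 1) r)) := by
  by_cases h : X (r.1, r.2 + 1) = X r
  · rw [coefF_eq_zero_of_row_eq H.prod_eq_one hL hr h, mul_zero]
    refine tendsto_const_nhds.congr' ?_
    filter_upwards [eventually_separated (q₁, q₂, us)] with p hp
    rw [coefF_eq_zero_of_row_eq hp.prod_eq_one hL hr h, mul_zero]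
  · have e1 : col a (X - Pi.single r 1) r = col a X r - 1 := by simp [col]; ring
    have e2 : ∀ r', r' ≠ r → col a (X - Pi.single r 1) r' = col a X r' := fun r' hne => by
      simp [col, hne]
    have h0 : 0 ≤ (X - Pi.single r 1 : Row n → ℤ) r := by
      have h1 := hX.succ_le r.1 r.2
      have h2 := hX.nonneg (r.1, r.2 + 1)
      simp only [Pi.sub_apply, Pi.single_eq_same]
      simp only [Prod.mk.eta] at h1
      omega
    have ho := isRowOrder_rowLt n
    refine (H.tendsto_coefE hr h0 fun r' hlt hl => ?_).mul
      (H.tendsto_coefF hr h0 fun r' hlt hl => ?_)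
    · have := hX.col_le_of_level_eq hlt hl.symm
      rw [e1, e2 r' (ho.ne hlt)]
      omega
    · have := hX.col_le_of_level_eq hlt hl
      rw [e1, e2 r' (ho.ne hlt).symm]
      exact ⟨fun hc => h (hX.row_eq_of_col_eq_add_one hlt hl (by omega)), by omega⟩

theorem tendsto_poleAt (H : Resonant a b q₁ q₂ q₃ u us) (X : Row n → ℤ) (κ : Pole n) :
    Tendsto (fun p => poleAt p.1 (Param.q3 p) p.2.2 L X κ) (genericNhds (q₁, q₂, us))
      (𝓝 (poleAt q₁ q₃ us L X κ)) := by
  rcases κ with ⟨r, _ | _⟩ | m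
  · exact H.tendsto_pt X r
  · exact ((tendsto_q1 (q₁, q₂, us)).inv₀ H.q1_ne).mul (H.tendsto_pt X r)
  · exact (H.tendsto_q3.pow L).mul (tendsto_us (q₁, q₂, us) m)

theorem tendsto_zeroAt (H : Resonant a b q₁ q₂ q₃ u us) (X : Row n → ℤ) (κ : Pole n) :
    Tendsto (fun p => zeroAt p.1 p.2.1 (Param.q3 p) p.2.2 L X κ) (genericNhds (q₁, q₂, us))
      (𝓝 (zeroAt q₁ q₂ q₃ us L X κ)) := by
  rcases κ with ⟨r, _ | _⟩ | m
  · exact H.tendsto_q3.mul (H.tendsto_pt X r)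
  · exact (tendsto_q2 (q₁, q₂, us)).mul (H.tendsto_pt X r)
  · exact (tendsto_q2 (q₁, q₂, us)).mul ((H.tendsto_q3.pow L).mul (tendsto_us (q₁, q₂, us) m))

theorem tendsto_psiPlusEig (H : Resonant a b q₁ q₂ q₃ u us) (lam : Label a b) (k : ℤ) :
    Tendsto (fun p => psiPlusEig p.1 p.2.1 (Param.q3 p) p.2.2 k lam) (genericNhds (q₁, q₂, us))
      (𝓝 (psiPlusEig q₁ q₂ q₃ us k lam)) := by
  rcases lt_or_ge k 0 with hk | hk
  · rw [psiPlusEig_of_neg H.prod_eq_one hk]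
    refine tendsto_const_nhds.congr' ?_
    filter_upwards [eventually_separated (q₁, q₂, us)] with p hp
    rw [psiPlusEig_of_neg hp.prod_eq_one hk]
  · obtain ⟨k, rfl⟩ := Int.eq_ofNat_of_zero_le hk
    rw [psiPlusEig_eq H.prod_eq_one lam.room_spec]
    refine (tendsto_coeff_prod_facInf (fun κ _ => H.tendsto_zeroAt lam.state κ)
      (fun κ _ => H.tendsto_poleAt lam.state κ) k).congr' ?_
    filter_upwards [eventually_separated (q₁, q₂, us)] with p hp
    rw [psiPlusEig_eq hp.prod_eq_one lam.room_spec]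

theorem tendsto_psiMinusEig (H : Resonant a b q₁ q₂ q₃ u us) (lam : Label a b) (k : ℤ) :
    Tendsto (fun p => psiMinusEig p.1 p.2.1 (Param.q3 p) p.2.2 k lam) (genericNhds (q₁, q₂, us))
      (𝓝 (psiMinusEig q₁ q₂ q₃ us k lam)) := by
  rcases lt_or_ge 0 k with hk | hk
  · rw [psiMinusEig_of_pos H.prod_eq_one H.us_ne hk]
    refine tendsto_const_nhds.congr' ?_
    filter_upwards [eventually_separated (q₁, q₂, us)] with p hp
    rw [psiMinusEig_of_pos hp.prod_eq_one hp.ne_zero hk]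
  · obtain ⟨k, rfl⟩ := Int.exists_eq_neg_ofNat hk
    rw [psiMinusEig_eq H.prod_eq_one H.us_ne lam.room_spec]
    refine (tendsto_coeff_prod_facZero (fun κ _ => H.tendsto_zeroAt lam.state κ)
      (fun κ _ => H.tendsto_poleAt lam.state κ)
      (fun κ _ => poleAt_ne_zero H.q1_ne H.q3_ne H.us_ne κ) k).congr' ?_
    filter_upwards [eventually_separated (q₁, q₂, us)] with p hp
    rw [psiMinusEig_eq hp.prod_eq_one hp.ne_zero lam.room_spec]

theorem one_sub_q2_ne (H : Resonant a b q₁ q₂ q₃ u us) : 1 - q₂ ≠ 0 := by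
  intro h
  have := (H.indep (-1) (-1) (by rw [← H.q2_eq]; linear_combination -h)).1
  omega

theorem one_sub_q3_ne (H : Resonant a b q₁ q₂ q₃ u us) : 1 - q₃ ≠ 0 := by
  intro h
  have := (H.indep 0 1 (by rw [zpow_one, zpow_zero]; linear_combination -h)).2
  omega

theorem neBot (H : Resonant a b q₁ q₂ q₃ u us) : (genericNhds (q₁, q₂, us)).NeBot :=
  neBot_genericNhds H.q1_ne H.q2_ne H.us_ne

/-- Both sides are limits of their values at generic parameters, where the identity is an expansion
into partial fractions. That expansion is not available here, since poles of touching rows collide.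
-/
theorem sum_coefE_mul_coefF (H : Resonant a b q₁ q₂ q₃ u us) (hL : Room L lam.state) (m : ℤ) :
    ∑ r ∈ rows n L, (coefE q₁ q₂ q₃ us L (lam.state - Pi.single r 1) r *
          coefF q₁ q₂ q₃ us L (lam.state - Pi.single r 1) r *
          pt q₁ (rowBase q₃ us) (lam.state - Pi.single r 1) r ^ m -
        coefE q₁ q₂ q₃ us L lam.state r * coefF q₁ q₂ q₃ us L lam.state r *
          pt q₁ (rowBase q₃ us) lam.state r ^ m) =
      ((1 - q₁) * (1 - q₂) * (1 - q₃))⁻¹ *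
        (psiPlusEig q₁ q₂ q₃ us m lam - psiMinusEig q₁ q₂ q₃ us m lam) := by
  have := H.neBot
  have hpt : ∀ X r, pt q₁ (rowBase q₃ us) X r ≠ 0 := pt_ne_zero H.q1_ne H.rowBase_ne
  have h1 := tendsto_finsetSum (rows n L) fun r hr =>
    ((H.tendsto_diag_sub lam.isState hL hr).mul
      ((H.tendsto_pt (lam.state - Pi.single r 1) r).zpow₀ m (Or.inl (hpt _ _)))).sub
    ((H.tendsto_diag_add lam.isState hr).mul
      ((H.tendsto_pt lam.state r).zpow₀ m (Or.inl (hpt _ _))))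
  have h2 := ((((tendsto_const_nhds (x := (1 : ℂ))).sub (tendsto_q1 (q₁, q₂, us))).mul
    ((tendsto_const_nhds (x := (1 : ℂ))).sub (tendsto_q2 (q₁, q₂, us)))).mul
    ((tendsto_const_nhds (x := (1 : ℂ))).sub H.tendsto_q3)).inv₀
    (mul_ne_zero (mul_ne_zero H.one_sub_q1_ne H.one_sub_q2_ne) H.one_sub_q3_ne) |>.mul
    ((H.tendsto_psiPlusEig lam m).sub (H.tendsto_psiMinusEig lam m))
  refine tendsto_nhds_unique (h1.congr' ?_) h2
  filter_upwards [eventually_separated (q₁, q₂, us)] with p hp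
  rw [hp.sum_coefE_mul_coefF hL, isPsi_psiPlusEig hp.prod_eq_one lam L hL,
    isPsi_psiMinusEig hp.prod_eq_one hp.ne_zero lam L hL]
  rfl

/-- The relation between `e(z)`, `f(z)` and `ψ(z)`. -/
theorem opE_opF (H : Resonant a b q₁ q₂ q₃ u us) (i j : ℤ) :
    opE a b q₁ q₂ q₃ us i * opF a b q₁ q₂ q₃ us j - opF a b q₁ q₂ q₃ us j * opE a b q₁ q₂ q₃ us i =
      ((1 - q₁) * (1 - q₂) * (1 - q₃))⁻¹ •
        (opDiag (psiPlusEig q₁ q₂ q₃ us (i + j)) - opDiag (psiMinusEig q₁ q₂ q₃ us (i + j))) := by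
  refine end_ext fun lam => ?_
  obtain ⟨L, hL⟩ := lam.isState.exists_room
  rw [← ketOf_state, H.commutator_opE_opF lam.isState hL,
    H.sum_coefE_mul_coefF (hL.mono (Nat.le_succ L)), ketOf_state, LinearMap.smul_apply,
    LinearMap.sub_apply, opDiag_ket, opDiag_ket, ← sub_smul, smul_smul]

end Resonant

end Limits

/-! ## The module structure -/

section Module

variable {n : ℕ} {a b : Fin n → ℕ} {q₁ q₂ q₃ u : ℂ} {us : Fin (n + 1) → ℂ} {r : Row n}
  {lam mu : Label a b}

/-- The action of the generators. -/
def genOp (a b : Fin n → ℕ) (q₁ q₂ q₃ : ℂ) (us : Fin (n + 1) → ℂ) : Gen → Module.End ℂ (MSpace a b)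
  | .e i => opE a b q₁ q₂ q₃ us i
  | .f i => opF a b q₁ q₂ q₃ us i
  | .psiPlus i => opDiag (psiPlusEig q₁ q₂ q₃ us i)
  | .psiMinus i => opDiag (psiMinusEig q₁ q₂ q₃ us (-i))
  | .psiPlusInv => opDiag fun lam => (psiPlusEig q₁ q₂ q₃ us 0 lam)⁻¹
  | .psiMinusInv => opDiag fun lam => (psiMinusEig q₁ q₂ q₃ us 0 lam)⁻¹

/-- The action of the free algebra. -/
def freeOp (a b : Fin n → ℕ) (q₁ q₂ q₃ : ℂ) (us : Fin (n + 1) → ℂ) :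
    FreeE →ₐ[ℂ] Module.End ℂ (MSpace a b) := FreeAlgebra.lift ℂ (genOp a b q₁ q₂ q₃ us)

theorem freeOp_ι (x : Gen) :
    freeOp a b q₁ q₂ q₃ us (FreeAlgebra.ι ℂ x) = genOp a b q₁ q₂ q₃ us x :=
  FreeAlgebra.lift_ι_apply _ _

theorem freeOp_eSer (i : ℤ) : freeOp a b q₁ q₂ q₃ us (eSer i) = opE a b q₁ q₂ q₃ us i :=
  freeOp_ι _

theorem freeOp_fSer (i : ℤ) : freeOp a b q₁ q₂ q₃ us (fSer i) = opF a b q₁ q₂ q₃ us i :=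
  freeOp_ι _

theorem freeOp_psiPlusSer (hq : q₁ * q₂ * q₃ = 1) (i : ℤ) :
    freeOp a b q₁ q₂ q₃ us (psiPlusSer i) = opDiag (psiPlusEig q₁ q₂ q₃ us i) := by
  rw [psiPlusSer]
  split_ifs with h
  · rw [freeOp_ι, genOp, Int.toNat_of_nonneg h]
  · rw [map_zero, ← opDiag_zero]
    congr 1
    funext lam
    exact (psiPlusEig_of_neg hq (not_le.1 h) lam).symm

theorem freeOp_psiMinusSer (hq : q₁ * q₂ * q₃ = 1) (hus : ∀ i, us i ≠ 0) (i : ℤ) :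
    freeOp a b q₁ q₂ q₃ us (psiMinusSer i) = opDiag (psiMinusEig q₁ q₂ q₃ us i) := by
  rw [psiMinusSer]
  split_ifs with h
  · rw [freeOp_ι, genOp, Int.toNat_of_nonneg (by omega), neg_neg]
  · rw [map_zero, ← opDiag_zero]
    congr 1
    funext lam
    exact (psiMinusEig_of_pos hq hus (not_le.1 h) lam).symm

theorem opDiag_comm (χ χ' : Label a b → ℂ) : opDiag χ * opDiag χ' = opDiag χ' * opDiag χ := by
  rw [opDiag_mul, opDiag_mul]
  congr 1
  funext lam
  exact mul_comm _ _

theorem opDiag_mul_inv {χ : Label a b → ℂ} (h : ∀ lam, χ lam ≠ 0) :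
    opDiag χ * opDiag (fun lam => (χ lam)⁻¹) = 1 := by
  rw [opDiag_mul, ← opDiag_one]
  congr 1
  funext lam
  exact mul_inv_cancel₀ (h lam)

theorem freeOp_mulGzw (Y : ℤ → ℤ → FreeE) (i j : ℤ) :
    freeOp a b q₁ q₂ q₃ us (mulGzw q₁ q₂ q₃ Y i j) =
      mulGzw q₁ q₂ q₃ (fun i j => freeOp a b q₁ q₂ q₃ us (Y i j)) i j :=
  map_mulGzw (fun x y => map_sub (freeOp a b q₁ q₂ q₃ us) x y)
    (fun c x => map_smul (freeOp a b q₁ q₂ q₃ us) c x) _ _ _ _ _ _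

theorem freeOp_mulGwz (Y : ℤ → ℤ → FreeE) (i j : ℤ) :
    freeOp a b q₁ q₂ q₃ us (mulGwz q₁ q₂ q₃ Y i j) =
      mulGwz q₁ q₂ q₃ (fun i j => freeOp a b q₁ q₂ q₃ us (Y i j)) i j :=
  map_mulGwz (fun x y => map_sub (freeOp a b q₁ q₂ q₃ us) x y)
    (fun c x => map_smul (freeOp a b q₁ q₂ q₃ us) c x) _ _ _ _ _ _

namespace Resonant

theorem freeOp_rel (H : Resonant a b q₁ q₂ q₃ u us) {x y : FreeE} (h : Rel q₁ q₂ q₃ x y) :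
    freeOp a b q₁ q₂ q₃ us x = freeOp a b q₁ q₂ q₃ us y := by
  have hp := isPsi_psiPlusEig (a := a) (b := b) (us := us) H.prod_eq_one
  have hm := isPsi_psiMinusEig (a := a) (b := b) H.prod_eq_one H.us_ne
  have ep := freeOp_psiPlusSer (a := a) (b := b) (us := us) H.prod_eq_one
  have em := freeOp_psiMinusSer (a := a) (b := b) H.prod_eq_one H.us_ne
  have hinv : ∀ χ : Label a b → ℂ, (∀ lam, χ lam ≠ 0) →
      opDiag χ * opDiag (fun lam => (χ lam)⁻¹) = 1 ∧
      opDiag (fun lam => (χ lam)⁻¹) * opDiag χ = 1 := fun χ hχ =>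
    ⟨opDiag_mul_inv hχ, by rw [opDiag_comm, opDiag_mul_inv hχ]⟩
  have hp0 := hinv (psiPlusEig q₁ q₂ q₃ us 0) fun lam => by
    rw [psiPlusEig_zero H.prod_eq_one]; exact one_ne_zero
  have hm0 := hinv (psiMinusEig q₁ q₂ q₃ us 0) (psiMinusEig_zero_ne H.prod_eq_one H.us_ne)
  cases h with
  | e_e i j =>
    rw [map_neg, freeOp_mulGzw, freeOp_mulGwz]
    simp only [prodZW, prodWZ, map_mul, freeOp_eSer]
    exact H.opE_quadratic i j
  | f_f i j =>
    rw [map_neg, freeOp_mulGzw, freeOp_mulGwz]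
    simp only [prodZW, prodWZ, map_mul, freeOp_fSer]
    exact H.opF_quadratic i j
  | psiPlus_e i j =>
    rw [map_neg, freeOp_mulGzw, freeOp_mulGwz]
    simp only [prodZW, prodWZ, map_mul, freeOp_eSer, ep]
    exact H.psi_opE hp i j
  | psiMinus_e i j =>
    rw [map_neg, freeOp_mulGzw, freeOp_mulGwz]
    simp only [prodZW, prodWZ, map_mul, freeOp_eSer, em]
    exact H.psi_opE hm i j
  | psiPlus_f i j =>
    rw [map_neg, freeOp_mulGzw, freeOp_mulGwz]
    simp only [prodZW, prodWZ, map_mul, freeOp_fSer, ep]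
    exact H.psi_opF hp i j
  | psiMinus_f i j =>
    rw [map_neg, freeOp_mulGzw, freeOp_mulGwz]
    simp only [prodZW, prodWZ, map_mul, freeOp_fSer, em]
    exact H.psi_opF hm i j
  | e_f i j =>
    simp only [map_sub, map_mul, map_smul, freeOp_eSer, freeOp_fSer, ep, em]
    exact H.opE_opF i j
  | psiPlus_psiPlus i j => simp only [map_mul, ep, opDiag_comm]
  | psiMinus_psiMinus i j => simp only [map_mul, em, opDiag_comm]
  | psiPlus_psiMinus i j => rw [map_mul, map_mul, ep, em, opDiag_comm]
  | psiPlus_mul_inv => rw [map_mul, map_one, ep, freeOp_ι]; exact hp0.1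
  | psiPlus_inv_mul => rw [map_mul, map_one, ep, freeOp_ι]; exact hp0.2
  | psiMinus_mul_inv => rw [map_mul, map_one, em, freeOp_ι]; exact hm0.1
  | psiMinus_inv_mul => rw [map_mul, map_one, em, freeOp_ι]; exact hm0.2
  | serre_e =>
    simp only [Ring.lie_def, map_sub, map_mul, map_zero, freeOp_eSer]
    exact H.opE_serre
  | serre_f =>
    simp only [Ring.lie_def, map_sub, map_mul, map_zero, freeOp_fSer]
    exact H.opF_serre

/-- The module structure on `M_{a,b}`. -/
def rep (H : Resonant a b q₁ q₂ q₃ u us) : EAlg q₁ q₂ q₃ →ₐ[ℂ] Module.End ℂ (MSpace a b) :=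
  RingQuot.liftAlgHom ℂ ⟨freeOp a b q₁ q₂ q₃ us, fun _ _ h => H.freeOp_rel h⟩

theorem rep_gen (H : Resonant a b q₁ q₂ q₃ u us) (x : Gen) :
    H.rep (EAlg.gen q₁ q₂ q₃ x) = genOp a b q₁ q₂ q₃ us x := by
  rw [rep, EAlg.gen, RingQuot.liftAlgHom_mkAlgHom_apply, freeOp_ι]

end Resonant

theorem isAddBox_iff : IsAddBox r.1 r.2 lam.1 mu.1 ↔ mu.state = lam.state + Pi.single r 1 := by
  constructor
  · rintro ⟨h1, h2⟩
    funext r'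
    by_cases hi : r'.1 = r.1
    · have := DFunLike.congr_fun h1 r'.2
      obtain ⟨i, s⟩ := r
      obtain ⟨j, t⟩ := r'
      obtain rfl : j = i := hi
      simp only [Label.state, Pi.add_apply]
      rw [this, Finsupp.add_apply]
      congr 1
      by_cases hs : t = s
      · subst hs; simp
      · rw [Finsupp.single_eq_of_ne hs, Pi.single_eq_of_ne (by simpa using hs)]
    · simp only [Label.state, Pi.add_apply]
      rw [h2 _ hi, Pi.single_eq_of_ne (fun h => hi (by rw [h])), add_zero]
  · intro h
    obtain ⟨i, s⟩ := r
    refine ⟨Finsupp.ext fun t => ?_, fun k hk => Subtype.ext (Finsupp.ext fun t => ?_)⟩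
    · refine (congrFun h (i, t)).trans ?_
      rw [Pi.add_apply, Finsupp.add_apply]
      refine congrArg _ ?_
      by_cases hs : t = s
      · subst hs; simp
      · rw [Finsupp.single_eq_of_ne hs, Pi.single_eq_of_ne (by simpa using hs)]
    · refine (congrFun h (k, t)).trans ?_
      rw [Pi.add_apply, Pi.single_eq_of_ne (fun h => hk (congrArg Prod.fst h)), add_zero]
      rfl

namespace Resonant

/-- For generic parameters the coefficient is `coefE` times a power of the weight; that `mu` is a
label keeps the limit away from poles. -/
theorem tendsto_tensorE (H : Resonant a b q₁ q₂ q₃ u us) (k : ℤ) (mu lam : Label a b) :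
    Tendsto (fun p : Param (n + 1) => tensorE p.1 p.2.1 (p.1 * p.2.1)⁻¹ p.2.2 k mu.1 lam.1)
      (genericNhds (q₁, q₂, us)) (𝓝 (opE a b q₁ q₂ q₃ us k (ket lam) mu)) := by
  by_cases h : ∃ r, mu.state = lam.state + Pi.single r 1
  · obtain ⟨r, h⟩ := h
    obtain ⟨L, hL⟩ := lam.isState.exists_room
    have hmu := mu.isState
    rw [h] at hmu
    have hr : r ∈ rows n L := hL.mem_rows_of_isState_add hmu
    rw [H.opE_apply hL h]
    refine ((H.tendsto_coefE hr (lam.isState.nonneg r) fun r' hlt hl => ?_).mul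
      ((H.tendsto_pt lam.state r).zpow₀ k
        (Or.inl (pt_ne_zero H.q1_ne H.rowBase_ne _ _)))).congr' ?_
    · have h1 := hmu.col_le_of_level_eq hlt hl.symm
      have h2 : col a (lam.state + Pi.single r 1) r = col a lam.state r + 1 := by simp [col]; ring
      have h3 : col a (lam.state + Pi.single r 1) r' = col a lam.state r' := by
        simp [col, (isRowOrder_rowLt n).ne hlt]
      omega
    · filter_upwards [eventually_separated (q₁, q₂, us)] with p hp
      exact (tensorE_eq hp hL (isAddBox_iff.2 h) hr k).symm
  · rw [opE_apply_eq_zero (not_exists.1 h)]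
    refine tendsto_const_nhds.congr fun p => (tensorE_eq_zero (fun i s hb => h ⟨(i, s), ?_⟩) k).symm
    exact isAddBox_iff.1 hb

theorem tendsto_tensorF (H : Resonant a b q₁ q₂ q₃ u us) (k : ℤ) (mu lam : Label a b) :
    Tendsto (fun p : Param (n + 1) => tensorF p.1 p.2.1 (p.1 * p.2.1)⁻¹ p.2.2 k mu.1 lam.1)
      (genericNhds (q₁, q₂, us)) (𝓝 (opF a b q₁ q₂ q₃ us k (ket lam) mu)) := by
  by_cases h : ∃ r, lam.state = mu.state + Pi.single r 1
  · obtain ⟨r, h⟩ := h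
    obtain ⟨L, hL⟩ := lam.isState.exists_room
    have h' : mu.state = lam.state - Pi.single r 1 := by rw [h, add_sub_cancel_right]
    have hr : r ∈ rows n L := hL.mem_rows_of_isState (h' ▸ mu.isState)
    have hL' : Room L mu.state := by
      rw [h']; exact hL.sub_of_isState (h' ▸ mu.isState)
    rw [H.opF_apply hL h]
    refine ((H.tendsto_coefF hr (mu.isState.nonneg r) fun r' hlt hl => ?_).mul
      ((H.tendsto_pt mu.state r).zpow₀ k
        (Or.inl (pt_ne_zero H.q1_ne H.rowBase_ne _ _)))).congr' ?_
    · have h1 := mu.isState.col_le_of_level_eq hlt hl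
      omega
    · filter_upwards [eventually_separated (q₁, q₂, us)] with p hp
      exact (tensorF_eq hp hL' (isAddBox_iff.2 h) hr k).symm
  · rw [opF_apply_eq_zero (not_exists.1 h)]
    refine tendsto_const_nhds.congr fun p => (tensorF_eq_zero (fun i s hb => h ⟨(i, s), ?_⟩) k).symm
    exact isAddBox_iff.1 hb

open Classical in
theorem opDiag_ket_apply (χ : Label a b → ℂ) (mu lam : Label a b) :
    opDiag χ (ket lam) mu = if mu = lam then χ lam else 0 := by
  rw [opDiag_ket, Finsupp.smul_apply, ket, Finsupp.single_apply]
  split_ifs with h1 h2 h2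
  · simp
  · exact absurd h1.symm h2
  · exact absurd h2.symm h1
  · simp

theorem isTensorAction_rep (H : Resonant a b q₁ q₂ q₃ u us) : IsTensorAction a b us H.rep where
  e k mu lam := by
    rw [H.rep_gen]
    exact H.tendsto_tensorE k mu lam
  f k mu lam := by
    rw [H.rep_gen]
    exact H.tendsto_tensorF k mu lam
  psiPlus k mu lam := by
    rw [H.rep_gen, genOp, opDiag_ket_apply]
    by_cases h : mu = lam
    · subst h
      simp only [tensorPsiPlus, if_pos]
      exact H.tendsto_psiPlusEig mu k
    · have h' : mu.1 ≠ lam.1 := fun e => h (Subtype.ext e)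
      simp only [tensorPsiPlus, if_neg h, if_neg h']
      exact tendsto_const_nhds
  psiMinus k mu lam := by
    rw [H.rep_gen, genOp, opDiag_ket_apply]
    by_cases h : mu = lam
    · subst h
      simp only [tensorPsiMinus, if_pos]
      have := H.tendsto_psiMinusEig mu (-k)
      simp only [psiMinusEig, neg_neg] at this ⊢
      exact this
    · have h' : mu.1 ≠ lam.1 := fun e => h (Subtype.ext e)
      simp only [tensorPsiMinus, if_neg h, if_neg h']
      exact tendsto_const_nhds

end Resonant

theorem gen_psiPlus_mul_inv :
    EAlg.gen q₁ q₂ q₃ (.psiPlus 0) * EAlg.gen q₁ q₂ q₃ .psiPlusInv = 1 ∧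
      EAlg.gen q₁ q₂ q₃ .psiPlusInv * EAlg.gen q₁ q₂ q₃ (.psiPlus 0) = 1 := by
  have h1 := RingQuot.mkAlgHom_rel ℂ (Rel.psiPlus_mul_inv (q₁ := q₁) (q₂ := q₂) (q₃ := q₃))
  have h2 := RingQuot.mkAlgHom_rel ℂ (Rel.psiPlus_inv_mul (q₁ := q₁) (q₂ := q₂) (q₃ := q₃))
  rw [map_mul, map_one] at h1 h2
  exact ⟨h1, h2⟩

theorem gen_psiMinus_mul_inv :
    EAlg.gen q₁ q₂ q₃ (.psiMinus 0) * EAlg.gen q₁ q₂ q₃ .psiMinusInv = 1 ∧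
      EAlg.gen q₁ q₂ q₃ .psiMinusInv * EAlg.gen q₁ q₂ q₃ (.psiMinus 0) = 1 := by
  have h1 := RingQuot.mkAlgHom_rel ℂ (Rel.psiMinus_mul_inv (q₁ := q₁) (q₂ := q₂) (q₃ := q₃))
  have h2 := RingQuot.mkAlgHom_rel ℂ (Rel.psiMinus_inv_mul (q₁ := q₁) (q₂ := q₂) (q₃ := q₃))
  rw [map_mul, map_one] at h1 h2
  exact ⟨h1, h2⟩

/-- Limits along a nontrivial filter are unique, which fixes all generators but the inverses of
`ψ^±_0`; those are determined as two-sided inverses. -/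
theorem IsTensorAction.unique {ρ ρ' : EAlg q₁ q₂ q₃ →ₐ[ℂ] Module.End ℂ (MSpace a b)}
    [(genericNhds (q₁, q₂, us)).NeBot] (h : IsTensorAction a b us ρ)
    (h' : IsTensorAction a b us ρ') : ρ' = ρ := by
  have hp : ∀ k, ρ' (EAlg.gen q₁ q₂ q₃ (.psiPlus k)) = ρ (EAlg.gen q₁ q₂ q₃ (.psiPlus k)) :=
    fun k => end_ext_apply fun mu lam => tendsto_nhds_unique (h'.psiPlus k mu lam) (h.psiPlus k mu lam)
  have hm : ∀ k, ρ' (EAlg.gen q₁ q₂ q₃ (.psiMinus k)) = ρ (EAlg.gen q₁ q₂ q₃ (.psiMinus k)) :=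
    fun k => end_ext_apply fun mu lam =>
      tendsto_nhds_unique (h'.psiMinus k mu lam) (h.psiMinus k mu lam)
  have key : ∀ {x y : EAlg q₁ q₂ q₃}, x * y = 1 → y * x = 1 → ρ' x = ρ x → ρ' y = ρ y := by
    intro x y hxy hyx hx
    refine left_inv_eq_right_inv (a := ρ x) ?_ ?_
    · rw [← hx, ← map_mul, hyx, map_one]
    · rw [← map_mul, hxy, map_one]
  refine RingQuot.ringQuot_ext' _ _ _ (FreeAlgebra.hom_ext (funext fun x => ?_))
  change ρ' (EAlg.gen q₁ q₂ q₃ x) = ρ (EAlg.gen q₁ q₂ q₃ x)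
  cases x with
  | e k => exact end_ext_apply fun mu lam => tendsto_nhds_unique (h'.e k mu lam) (h.e k mu lam)
  | f k => exact end_ext_apply fun mu lam => tendsto_nhds_unique (h'.f k mu lam) (h.f k mu lam)
  | psiPlus k => exact hp k
  | psiMinus k => exact hm k
  | psiPlusInv => exact key gen_psiPlus_mul_inv.1 gen_psiPlus_mul_inv.2 (hp 0)
  | psiMinusInv => exact key gen_psiMinus_mul_inv.1 gen_psiMinus_mul_inv.2 (hm 0)

end Module

/-! ## The joint spectrum of the `ψ^±_i` is simple -/

section Roots

theorem aeval_zInf_coeff (P : Polynomial ℂ) (k : ℕ) :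
    (Polynomial.eval₂ HahnSeries.C zInf P).coeff (-(k : ℤ)) = P.coeff k := by
  induction P using Polynomial.induction_on' with
  | add P Q hP hQ => rw [Polynomial.eval₂_add, HahnSeries.coeff_add, hP, hQ, Polynomial.coeff_add]
  | monomial m c =>
    rw [Polynomial.eval₂_monomial, zInf, HahnSeries.single_pow, one_pow, HahnSeries.C_apply,
      HahnSeries.single_mul_single, mul_one, zero_add, HahnSeries.coeff_single,
      Polynomial.coeff_monomial]
    congr 1
    simp [eq_comm]

/-- The variable `z` is transcendental over the constants: the coefficients of a polynomial can be
read off from the series. -/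
theorem eval₂_zInf_injective :
    Function.Injective (Polynomial.eval₂ (HahnSeries.C : ℂ →+* LaurentSeries ℂ) zInf) := by
  intro P Q h
  ext k
  rw [← aeval_zInf_coeff, ← aeval_zInf_coeff, h]

theorem count_roots_prod {J : Type*} (I : Finset J) (α : J → ℂ) (c : ℂ) :
    (∏ κ ∈ I, (Polynomial.X - Polynomial.C (α κ))).roots.count c =
      ∑ κ ∈ I, if α κ = c then 1 else 0 := by
  have : ∏ κ ∈ I, (Polynomial.X - Polynomial.C (α κ)) =
      ((I.val.map α).map fun x => Polynomial.X - Polynomial.C x).prod := by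
    rw [Multiset.map_map]; rfl
  rw [this, Polynomial.roots_multiset_prod_X_sub_C, Multiset.count_map, ← Finset.card_filter]
  simp only [eq_comm]
  rfl

/-- A rational function determines its zeros and poles. -/
theorem count_eq_of_prod_div_eq {J : Type*} {I : Finset J} {α β α' β' : J → ℂ}
    (h : ∏ κ ∈ I, (zInf - HahnSeries.C (α κ)) / (zInf - HahnSeries.C (β κ)) =
      ∏ κ ∈ I, (zInf - HahnSeries.C (α' κ)) / (zInf - HahnSeries.C (β' κ))) (c : ℂ) :
    ((∑ κ ∈ I, if α κ = c then 1 else 0) + ∑ κ ∈ I, if β' κ = c then 1 else 0 : ℕ) =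
      (∑ κ ∈ I, if α' κ = c then 1 else 0) + ∑ κ ∈ I, if β κ = c then 1 else 0 := by
  have hne : ∀ f : J → ℂ, ∏ κ ∈ I, (zInf - HahnSeries.C (f κ)) ≠ 0 := fun f =>
    Finset.prod_ne_zero_iff.2 fun κ _ => sub_ne_zero.2 (zInf_ne_C _)
  have hne' : ∀ f : J → ℂ, ∏ κ ∈ I, (Polynomial.X - Polynomial.C (f κ)) ≠ 0 := fun f =>
    Finset.prod_ne_zero_iff.2 fun κ _ => Polynomial.X_sub_C_ne_zero _
  have he : ∀ f : J → ℂ, ∏ κ ∈ I, (zInf - HahnSeries.C (f κ)) =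
      Polynomial.eval₂ HahnSeries.C zInf (∏ κ ∈ I, (Polynomial.X - Polynomial.C (f κ))) := by
    intro f
    simp [Polynomial.eval₂_finsetProd]
  rw [Finset.prod_div_distrib, Finset.prod_div_distrib, div_eq_div_iff (hne _) (hne _), he, he, he,
    he, ← Polynomial.eval₂_mul, ← Polynomial.eval₂_mul] at h
  have := congrArg (fun P => P.roots.count c) (eval₂_zInf_injective h)
  simpa only [Polynomial.roots_mul (mul_ne_zero (hne' _) (hne' _)), Multiset.count_add,
    count_roots_prod] using this

end Roots

/-! ### Reconstruction of a label from the eigenvalue of `ψ⁺(z)`. -/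

section Spectrum

variable {n : ℕ} {a b : Fin n → ℕ} {q₁ q₂ q₃ u : ℂ} {us : Fin (n + 1) → ℂ} {X Y : Row n → ℤ}
  {L : ℕ} {lam mu : Label a b}

/-- The number of rows with a given weight. -/
def weightCount (q₁ q₃ : ℂ) (us : Fin (n + 1) → ℂ) (L : ℕ) (X : Row n → ℤ) (c : ℂ) : ℕ :=
  ∑ r ∈ rows n L, if pt q₁ (rowBase q₃ us) X r = c then 1 else 0

theorem sum_poles (g : Pole n → ℕ) : ∑ κ ∈ poles n L, g κ =
    (∑ r ∈ rows n L, g (.inl (r, false))) + (∑ r ∈ rows n L, g (.inl (r, true))) +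
      ∑ m, g (.inr m) := by
  rw [poles, Finset.sum_disjSum, Finset.sum_product, ← Finset.sum_add_distrib]
  simp [add_comm]

/-- A row of weight `p` has zeros `q₃ p`, `q₂ p` and poles `p`, `q₁⁻¹ p`, and the tails are the same
for `X` and `Y`. Zeros may cancel poles, so zeros of one side plus poles of the other are counted at
`c`. -/
theorem weightCount_relation (hq : q₁ * q₂ * q₃ = 1)
    (h : psiRat HahnSeries.C q₁ q₂ q₃ us L X zInf = psiRat HahnSeries.C q₁ q₂ q₃ us L Y zInf)
    (c : ℂ) :
    weightCount q₁ q₃ us L X (q₃⁻¹ * c) + weightCount q₁ q₃ us L X (q₁ * q₃ * c) +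
        (weightCount q₁ q₃ us L Y c + weightCount q₁ q₃ us L Y (q₁ * c)) =
      weightCount q₁ q₃ us L Y (q₃⁻¹ * c) + weightCount q₁ q₃ us L Y (q₁ * q₃ * c) +
        (weightCount q₁ q₃ us L X c + weightCount q₁ q₃ us L X (q₁ * c)) := by
  have h1 := ne_zero_left_of_prod hq
  have h2 := ne_zero_mid_of_prod hq
  have h3 := ne_zero_right_of_prod hq
  rw [psiRat_eq_prod, psiRat_eq_prod] at h
  have key := count_eq_of_prod_div_eq h c
  rw [sum_poles, sum_poles, sum_poles, sum_poles] at key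
  have e3 : ∀ p : ℂ, q₃ * p = c ↔ p = q₃⁻¹ * c := fun p => by
    rw [eq_inv_mul_iff_mul_eq₀ h3]
  have e2 : ∀ p : ℂ, q₂ * p = c ↔ p = q₁ * q₃ * c := fun p => by
    have : q₁ * q₃ = q₂⁻¹ := eq_inv_of_mul_eq_one_left (by linear_combination hq)
    rw [this, eq_inv_mul_iff_mul_eq₀ h2]
  have e1 : ∀ p : ℂ, q₁⁻¹ * p = c ↔ p = q₁ * c := fun p => by
    rw [inv_mul_eq_iff_eq_mul₀ h1]
  have a1 : ∀ Z, (∑ r ∈ rows n L, if zeroAt q₁ q₂ q₃ us L Z (.inl (r, false)) = c then 1 else 0) =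
      weightCount q₁ q₃ us L Z (q₃⁻¹ * c) := fun Z =>
    Finset.sum_congr rfl fun r _ => if_congr (e3 _) rfl rfl
  have a2 : ∀ Z, (∑ r ∈ rows n L, if zeroAt q₁ q₂ q₃ us L Z (.inl (r, true)) = c then 1 else 0) =
      weightCount q₁ q₃ us L Z (q₁ * q₃ * c) := fun Z =>
    Finset.sum_congr rfl fun r _ => if_congr (e2 _) rfl rfl
  have a3 : ∀ Z, (∑ r ∈ rows n L, if poleAt q₁ q₃ us L Z (.inl (r, false)) = c then 1 else 0) =
      weightCount q₁ q₃ us L Z c := fun Z => rfl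
  have a4 : ∀ Z, (∑ r ∈ rows n L, if poleAt q₁ q₃ us L Z (.inl (r, true)) = c then 1 else 0) =
      weightCount q₁ q₃ us L Z (q₁ * c) := fun Z =>
    Finset.sum_congr rfl fun r _ => if_congr (e1 _) rfl rfl
  have a5 : (∑ m, if zeroAt q₁ q₂ q₃ us L X (.inr m) = c then 1 else 0) =
      ∑ m, if zeroAt q₁ q₂ q₃ us L Y (.inr m) = c then 1 else 0 := rfl
  have a6 : (∑ m, if poleAt q₁ q₃ us L X (.inr m) = c then 1 else 0) =
      ∑ m, if poleAt q₁ q₃ us L Y (.inr m) = c then 1 else 0 := rfl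
  rw [a1, a1, a2, a2, a3, a3, a4, a4, a5, a6] at key
  omega

/-- A function on the plane with bounded support that satisfies the relation of the weights
vanishes. -/
theorem eq_zero_of_relation {d : ℤ → ℤ → ℤ} {M : ℤ} (h0 : ∀ x y, M ≤ y ∨ y ≤ -M → d x y = 0)
    (h : ∀ x y, d x (y - 1) + d (x + 1) (y + 1) = d x y + d (x + 1) y) (x y : ℤ) : d x y = 0 := by
  -- By the relation, the difference in the direction of `y` is constant along diagonals. Far out on
  -- a diagonal it is zero, so `d` does not depend on `y`, and hence vanishes.
  have h1 : ∀ (t : ℕ) (x y : ℤ), d x y - d x (y - 1) = d (x + t) (y + t) - d (x + t) (y + t - 1) := by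
    intro t
    induction t with
    | zero => intro x y; simp
    | succ t ih =>
      intro x y
      rw [ih]
      have := h (x + t) (y + t)
      push_cast
      rw [show x + ((t : ℤ) + 1) = x + t + 1 by ring, show y + ((t : ℤ) + 1) = y + t + 1 by ring,
        show y + (t : ℤ) + 1 - 1 = y + t by ring]
      linarith
  have h2 : ∀ x y, d x y = d x (y - 1) := by
    intro x y
    have := h1 (M - y + 1).toNat x y
    rw [h0 _ (y + (M - y + 1).toNat) (by omega), h0 _ (y + (M - y + 1).toNat - 1) (by omega)] at this
    omega
  have h3 : ∀ t : ℕ, d x y = d x (y - t) := by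
    intro t
    induction t with
    | zero => simp
    | succ t ih => rw [ih, h2]; push_cast; ring_nf
  rw [h3 (y + M).toNat]
  exact h0 _ _ (by omega)

namespace Resonant

theorem weightCount_pos_iff (H : Resonant a b q₁ q₂ q₃ u us) {x y : ℤ} :
    0 < weightCount q₁ q₃ us L X (q₁ ^ x * q₃ ^ y * u) ↔
      ∃ r ∈ rows n L, col a X r = x ∧ level b r = y := by
  have e : ∀ r, pt q₁ (rowBase q₃ us) X r = q₁ ^ x * q₃ ^ y * u ↔
      col a X r = x ∧ level b r = y := fun r => by
    rw [H.pt_eq]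
    exact ⟨H.monomial_inj, fun h => by rw [h.1, h.2]⟩
  rw [weightCount, Finset.sum_pos_iff]
  refine exists_congr fun r => and_congr_right fun _ => ?_
  rw [← e]
  split_ifs with h <;> simp [h]

/-- The difference of the two counts satisfies the recurrence of `eq_zero_of_relation`, with support
in the finitely many levels of the rows below the cut-off. -/
theorem weightCount_eq (H : Resonant a b q₁ q₂ q₃ u us)
    (h : psiRat HahnSeries.C q₁ q₂ q₃ us L X zInf = psiRat HahnSeries.C q₁ q₂ q₃ us L Y zInf)
    (x y : ℤ) :
    weightCount q₁ q₃ us L X (q₁ ^ x * q₃ ^ y * u) =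
      weightCount q₁ q₃ us L Y (q₁ ^ x * q₃ ^ y * u) := by
  have h1 := H.q1_ne
  have h3 := H.q3_ne
  obtain ⟨M, hM⟩ : ∃ M : ℤ, ∀ r ∈ rows n L, -M < level b r ∧ level b r < M := by
    refine ⟨∑ r ∈ rows n L, |level b r| + 1, fun r hr => ?_⟩
    have := Finset.single_le_sum (f := fun r => |level b r|) (fun _ _ => abs_nonneg _) hr
    have := abs_lt.1 (lt_of_le_of_lt this (lt_add_one _))
    exact this
  have key := eq_zero_of_relation (M := M)
    (d := fun x y => (weightCount q₁ q₃ us L X (q₁ ^ x * q₃ ^ y * u) : ℤ) -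
      weightCount q₁ q₃ us L Y (q₁ ^ x * q₃ ^ y * u)) (fun x y hy => ?_) (fun x y => ?_) x y
  · omega
  · have hz : ∀ Z : Row n → ℤ, weightCount q₁ q₃ us L Z (q₁ ^ x * q₃ ^ y * u) = 0 := by
      intro Z
      by_contra hne
      obtain ⟨r, hr, -, h2⟩ := H.weightCount_pos_iff.1 (Nat.pos_of_ne_zero hne)
      have := hM r hr
      omega
    simp only [hz, sub_self]
  · have := weightCount_relation H.prod_eq_one h (q₁ ^ x * q₃ ^ y * u)
    have e1 : q₃⁻¹ * (q₁ ^ x * q₃ ^ y * u) = q₁ ^ x * q₃ ^ (y - 1) * u := by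
      rw [zpow_sub_one₀ h3]; ring
    have e2 : q₁ * q₃ * (q₁ ^ x * q₃ ^ y * u) = q₁ ^ (x + 1) * q₃ ^ (y + 1) * u := by
      rw [zpow_add_one₀ h3, zpow_add_one₀ h1]; ring
    have e3 : q₁ * (q₁ ^ x * q₃ ^ y * u) = q₁ ^ (x + 1) * q₃ ^ y * u := by
      rw [zpow_add_one₀ h1]; ring
    rw [e1, e2, e3] at this
    omega

end Resonant

/-- A state is determined by the set of weights of its rows. -/
theorem IsState.eq_of_forall_exists (hX : IsState a b X) (hY : IsState a b Y) (hLX : Room L X)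
    (hLY : Room L Y)
    (h : ∀ x y, (∃ r ∈ rows n L, col a X r = x ∧ level b r = y) ↔
      ∃ r ∈ rows n L, col a Y r = x ∧ level b r = y) : X = Y := by
  have step : ∀ {X Y : Row n → ℤ}, IsState a b X → IsState a b Y →
      (∀ x y, (∃ r ∈ rows n L, col a X r = x ∧ level b r = y) →
        ∃ r ∈ rows n L, col a Y r = x ∧ level b r = y) → ∀ (i : Fin (n + 1)) (s : ℕ),
      (i, s) ∈ rows n L → (∀ j < i, ∀ t, X (j, t) = Y (j, t)) → X (i, s) ≤ Y (i, s) := by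
    intro X Y hX hY h i s hr hlt
    obtain ⟨⟨j, t⟩, hr', hc, hl⟩ := h _ _ ⟨(i, s), hr, rfl, rfl⟩
    -- The row `(j, t)` has in `Y` the weight of `(i, s)` in `X`. In an earlier partition, where `X`
    -- and `Y` agree, it would collide with `(i, s)` inside `X`. In the same partition it is `(i,
    -- s)`. In a later one, the inequalities of `Y` make `(i, s)` longer in `Y`.
    rcases lt_trichotomy j i with hj | rfl | hj
    · have h1 := hX.col_le_of_level_eq (r := (i, s)) (r' := (j, t)) (Or.inl hj) hl
      simp only [col, hlt j hj t] at h1 hc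
      omega
    · simp only [level] at hl
      obtain rfl : t = s := by omega
      simp only [col] at hc
      omega
    · have h1 := hY.col_le_of_level_eq (r := (j, t)) (r' := (i, s)) (Or.inl hj) hl.symm
      simp only [col] at h1 hc
      omega
  have main : ∀ (i : Fin (n + 1)) (s : ℕ), X (i, s) = Y (i, s) := by
    intro i
    induction i using WellFoundedLT.induction with
    | ind i ih =>
      intro s
      by_cases hr : (i, s) ∈ rows n L
      · exact le_antisymm (step hX hY (fun x y => (h x y).1) i s hr ih)
          (step hY hX (fun x y => (h x y).2) i s hr fun j hj t => (ih j hj t).symm)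
      · rw [mem_rows] at hr
        rw [hLX.eq_zero i s (by dsimp only at hr; omega),
          hLY.eq_zero i s (by dsimp only at hr; omega)]
  funext r
  exact main r.1 r.2

namespace Resonant

/-- The eigenvalues of `ψ⁺(z)` separate the labels. -/
theorem eq_of_psiPlusEig_eq (H : Resonant a b q₁ q₂ q₃ u us)
    (h : ∀ k : ℕ, psiPlusEig q₁ q₂ q₃ us k lam = psiPlusEig q₁ q₂ q₃ us k mu) : lam = mu := by
  have hlam := lam.room_spec.mono (le_max_left lam.room mu.room)
  have hmu := mu.room_spec.mono (le_max_right lam.room mu.room)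
  set L := max lam.room mu.room
  have heq : psiRat HahnSeries.C q₁ q₂ q₃ us L lam.state zInf =
      psiRat HahnSeries.C q₁ q₂ q₃ us L mu.state zInf := by
    ext k
    have e1 := isPsi_psiPlusEig (us := us) H.prod_eq_one lam L hlam k
    have e2 := isPsi_psiPlusEig (us := us) H.prod_eq_one mu L hmu k
    refine e1.symm.trans (Eq.trans ?_ e2)
    rcases lt_or_ge k 0 with hk | hk
    · rw [psiPlusEig_of_neg H.prod_eq_one hk, psiPlusEig_of_neg H.prod_eq_one hk]
    · obtain ⟨k, rfl⟩ := Int.eq_ofNat_of_zero_le hk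
      exact h k
  refine Label.state_injective (lam.isState.eq_of_forall_exists mu.isState hlam hmu fun x y => ?_)
  rw [← H.weightCount_pos_iff, ← H.weightCount_pos_iff, H.weightCount_eq heq]

end Resonant

end Spectrum

section Properties

variable {n : ℕ} {a b : Fin n → ℕ} {q₁ q₂ q₃ u : ℂ} {us : Fin (n + 1) → ℂ} {r : Row n}
  {lam mu : Label a b}

/-! ## The grading -/

theorem Label.deg_of_state_eq_add (h : mu.state = lam.state + Pi.single r 1) :
    mu.deg = lam.deg + 1 := by
  obtain ⟨h1, h2⟩ := isAddBox_iff.2 h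
  rw [Label.deg, Label.deg, ← Finset.add_sum_erase _ _ (Finset.mem_univ r.1),
    ← Finset.add_sum_erase _ (fun i => (lam.1 i).size) (Finset.mem_univ r.1)]
  have e1 : (mu.1 r.1).size = (lam.1 r.1).size + 1 := by
    rw [Partition.size, h1, Finsupp.sum_add_index' (fun _ => rfl) (fun _ _ _ => rfl),
      Finsupp.sum_single_index rfl]
    rfl
  have e2 : ∑ i ∈ Finset.univ.erase r.1, (mu.1 i).size =
      ∑ i ∈ Finset.univ.erase r.1, (lam.1 i).size :=
    Finset.sum_congr rfl fun i hi => by rw [h2 i (Finset.ne_of_mem_erase hi)]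
  rw [e1, e2]
  ring

theorem Label.deg_nonneg (lam : Label a b) : 0 ≤ lam.deg :=
  Finset.sum_nonneg fun i _ => Finset.sum_nonneg fun s _ => partition_nonneg (lam.1 i) s

theorem sum_smul_ket (v : MSpace a b) : (v.sum fun lam c => c • ket lam) = v := by
  simp [ket]

theorem end_apply (A : Module.End ℂ (MSpace a b)) (v : MSpace a b) (mu : Label a b) :
    A v mu = v.sum fun lam c => c * A (ket lam) mu := by
  conv_lhs => rw [← sum_smul_ket v]
  rw [Finsupp.sum, map_sum, Finsupp.finsetSum_apply, Finsupp.sum]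
  simp

theorem apply_mem_piece {A : Module.End ℂ (MSpace a b)} {d k : ℤ}
    (hA : ∀ lam mu, A (ket lam) mu ≠ 0 → mu.deg = d + lam.deg) {v : MSpace a b}
    (hv : v ∈ MSpace.piece a b k) : A v ∈ MSpace.piece a b (d + k) := by
  rw [MSpace.piece, Finsupp.mem_supported'] at hv ⊢
  intro mu hmu
  rw [end_apply]
  refine Finset.sum_eq_zero fun lam _ => ?_
  change v lam * A (ket lam) mu = 0
  by_cases hlam : lam.deg = k
  · by_cases h : A (ket lam) mu = 0
    · rw [h, mul_zero]
    · exact absurd ((hA lam mu h).trans (by rw [hlam])) hmu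
  · rw [hv lam hlam, zero_mul]

theorem genOp_apply_deg (x : Gen) (lam mu : Label a b)
    (h : genOp a b q₁ q₂ q₃ us x (ket lam) mu ≠ 0) : mu.deg = x.deg + lam.deg := by
  have hdiag : ∀ χ : Label a b → ℂ, opDiag χ (ket lam) mu ≠ 0 → mu.deg = 0 + lam.deg := by
    intro χ hχ
    rw [Resonant.opDiag_ket_apply] at hχ
    by_cases hml : mu = lam
    · rw [hml, zero_add]
    · exact absurd (if_neg hml) hχ
  cases x with
  | e k =>
    by_cases hex : ∃ r, mu.state = lam.state + Pi.single r 1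
    · obtain ⟨r, hr⟩ := hex
      rw [Label.deg_of_state_eq_add hr]
      exact add_comm _ _
    · exact absurd (Resonant.opE_apply_eq_zero (not_exists.1 hex) k) h
  | f k =>
    by_cases hex : ∃ r, lam.state = mu.state + Pi.single r 1
    · obtain ⟨r, hr⟩ := hex
      rw [Label.deg_of_state_eq_add hr]
      change _ = -1 + _
      ring
    · exact absurd (Resonant.opF_apply_eq_zero (not_exists.1 hex) k) h
  | psiPlus k => exact hdiag _ h
  | psiMinus k => exact hdiag _ h
  | psiPlusInv => exact hdiag _ h
  | psiMinusInv => exact hdiag _ h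

theorem isInternal_piece (a b : Fin n → ℕ) : DirectSum.IsInternal (MSpace.piece a b) := by
  rw [DirectSum.isInternal_submodule_iff_iSupIndep_and_iSup_eq_top]
  constructor
  · intro k
    have h : (⨆ j, ⨆ _ : j ≠ k, MSpace.piece a b j) ≤
        Finsupp.supported ℂ ℂ {lam : Label a b | lam.deg ≠ k} :=
      iSup₂_le fun j hj => Finsupp.supported_mono fun lam (hlam : lam.deg = j) =>
        fun h => hj (hlam.symm.trans h)
    have hd : Disjoint {lam : Label a b | lam.deg = k} {lam : Label a b | lam.deg ≠ k} :=
      Set.disjoint_left.2 fun lam h1 h2 => h2 h1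
    exact (Finsupp.disjoint_supported_supported hd).mono_right h
  · have : (⨆ j, MSpace.piece a b j) =
        Finsupp.supported ℂ ℂ (⋃ j, {lam : Label a b | lam.deg = j}) := by
      rw [Finsupp.supported_iUnion]
      rfl
    rw [this, show (⋃ j, {lam : Label a b | lam.deg = j}) = Set.univ from
      Set.eq_univ_of_forall fun lam => Set.mem_iUnion.2 ⟨lam.deg, rfl⟩, Finsupp.supported_univ]

theorem Resonant.isGradedModule (H : Resonant a b q₁ q₂ q₃ u us) :
    IsGradedModule H.rep (MSpace.piece a b) := by
  refine ⟨isInternal_piece a b, fun d k x hx v hv => ?_⟩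
  rw [EAlg.homogeneous] at hx
  induction hx using Submodule.span_induction with
  | mem x hx =>
    obtain ⟨w, rfl, rfl⟩ := hx
    induction w with
    | nil => simpa using hv
    | cons g w ih =>
      rw [List.map_cons, List.map_cons, List.prod_cons, List.sum_cons, map_mul,
        Module.End.mul_apply, H.rep_gen, add_assoc]
      exact apply_mem_piece (genOp_apply_deg g) ih
  | zero => rw [map_zero, LinearMap.zero_apply]; exact zero_mem _
  | add x y _ _ hx hy => rw [map_add, LinearMap.add_apply]; exact add_mem hx hy
  | smul c x _ hx => rw [map_smul, LinearMap.smul_apply]; exact Submodule.smul_mem _ c hx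

/-! ## Tameness -/

theorem iSup_eq_top_of_ket_mem {ι : Type*} {p : ι → Submodule ℂ (MSpace a b)}
    (h : ∀ lam, ∃ i, ket lam ∈ p i) : ⨆ i, p i = ⊤ := by
  rw [eq_top_iff]
  intro v _
  rw [← sum_smul_ket v]
  refine Submodule.sum_mem _ fun lam _ => Submodule.smul_mem _ _ ?_
  obtain ⟨i, hi⟩ := h lam
  exact Submodule.mem_iSup_of_mem i hi

theorem Resonant.isTame (H : Resonant a b q₁ q₂ q₃ u us) : IsTame H.rep := by
  constructor
  · refine iSup_eq_top_of_ket_mem fun lam => ⟨(fun k => psiPlusEig q₁ q₂ q₃ us k lam,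
      fun k => psiMinusEig q₁ q₂ q₃ us (-k) lam), ?_⟩
    rw [jointEigenspace, Submodule.mem_iInf]
    intro k
    rw [Submodule.mem_inf, Module.End.mem_eigenspace_iff, Module.End.mem_eigenspace_iff, H.rep_gen,
      H.rep_gen]
    exact ⟨opDiag_ket _ lam, opDiag_ket _ lam⟩
  · intro χ
    suffices hspan : ∃ v₀, jointEigenspace H.rep χ ≤ Submodule.span ℂ {v₀} by
      obtain ⟨v₀, h⟩ := hspan
      exact (Submodule.rank_mono h).trans ((rank_span_le _).trans (Cardinal.mk_singleton v₀).le)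
    have key : ∀ v ∈ jointEigenspace H.rep χ, ∀ mu, v mu ≠ 0 →
        ∀ k : ℕ, psiPlusEig q₁ q₂ q₃ us k mu = χ.1 k := by
      intro v hv mu hmu k
      rw [jointEigenspace, Submodule.mem_iInf] at hv
      have := (hv k).1
      rw [SetLike.mem_coe, Module.End.mem_eigenspace_iff, H.rep_gen] at this
      have := DFunLike.congr_fun this mu
      rw [genOp, opDiag_apply, Finsupp.smul_apply, smul_eq_mul] at this
      exact mul_right_cancel₀ hmu this
    -- All labels in the supports of vectors of this eigenspace have the same eigenvalues of `ψ⁺`,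
    -- so there is at most one such label.
    by_cases hex : ∃ v ∈ jointEigenspace H.rep χ, ∃ mu, v mu ≠ 0
    · obtain ⟨v₀, hv₀, mu, hmu⟩ := hex
      classical
      refine ⟨ket mu, fun v hv => Submodule.mem_span_singleton.2 ⟨v mu, ?_⟩⟩
      ext lam
      rw [Finsupp.smul_apply, ket, Finsupp.single_apply]
      split_ifs with hml
      · rw [hml, smul_eq_mul, mul_one]
      · rw [smul_zero]
        by_contra hne
        exact hml (H.eq_of_psiPlusEig_eq fun k =>
          (key v₀ hv₀ mu hmu k).trans (key v hv lam (Ne.symm hne) k).symm)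
    · push Not at hex
      refine ⟨0, fun v hv => ?_⟩
      rw [show v = 0 from Finsupp.ext fun mu => hex v hv mu]
      exact zero_mem _

/-! ## Irreducibility -/

theorem Label.empty_state (r : Row n) : (Label.empty a b).state r = 0 := rfl

/-- A nonempty label has a removable box. -/
theorem Label.exists_removable (h : lam ≠ Label.empty a b) :
    ∃ (mu : Label a b) (r : Row n), lam.state = mu.state + Pi.single r 1 := by
  set X := lam.state with hX
  have hs : IsState a b X := lam.isState
  obtain ⟨L, hL⟩ := hs.exists_room
  have hne : ((rows n L).filter fun r => 0 < X r).Nonempty := by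
    rw [Finset.nonempty_iff_ne_empty]
    intro hempty
    refine h (Label.state_injective (funext fun r => ?_))
    rw [Label.empty_state]
    by_cases hr : r ∈ rows n L
    · have h1 := hs.nonneg r
      have h2 : r ∉ (rows n L).filter fun r => 0 < X r := by rw [hempty]; simp
      rw [Finset.mem_filter, not_and] at h2
      exact le_antisymm (not_lt.1 (h2 hr)) h1
    · rw [mem_rows] at hr
      exact hL.eq_zero r.1 r.2 (by omega)
  -- This function numbers the rows of index less than `L` lexicographically. The last nonempty row
  -- is removable, because a row is blocked only by later rows.
  obtain ⟨r, hr, hmax⟩ := Finset.exists_max_image _ (fun r : Row n => r.1.1 * L + r.2) hne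
  rw [Finset.mem_filter, mem_rows] at hr
  obtain ⟨hrL, hpos⟩ := hr
  have hz : ∀ r', rowLt r r' → X r' = 0 := by
    intro r' hlt
    by_contra hne'
    have h1 := hs.nonneg r'
    have hr' : r' ∈ rows n L := by
      rw [mem_rows]
      by_contra hcon
      exact hne' (hL.eq_zero r'.1 r'.2 (by omega))
    have h2 := hmax r' (Finset.mem_filter.2 ⟨hr', lt_of_le_of_ne h1 (Ne.symm hne')⟩)
    rw [mem_rows] at hr'
    rcases hlt with hlt | ⟨hlt, hlt'⟩
    · have h3 : (r.1.1 + 1) * L ≤ r'.1.1 * L := Nat.mul_le_mul_right _ hlt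
      rw [add_mul, one_mul] at h3
      omega
    · rw [hlt] at h2
      omega
  have hst : IsState a b (X - Pi.single r 1) := by
    by_contra hcon
    rcases hs.blocked_sub hcon with he | ⟨k, s, rfl, he⟩
    · have := hz (r.1, r.2 + 1) (Or.inr ⟨rfl, by simp⟩)
      omega
    · have := hz (k.succ, s + b k) (Or.inl (by simp [Fin.lt_def]))
      omega
  obtain ⟨mu, hmu⟩ := hst.exists_label
  exact ⟨mu, r, by rw [hmu, sub_add_cancel]⟩

theorem Label.induction_removable {P : Label a b → Prop} (h0 : P (Label.empty a b))
    (h : ∀ (lam mu : Label a b) (r : Row n), lam.state = mu.state + Pi.single r 1 → P mu → P lam)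
    (lam : Label a b) : P lam := by
  induction hd : lam.deg.toNat using Nat.strong_induction_on generalizing lam with
  | _ d ih =>
    by_cases he : lam = Label.empty a b
    · rw [he]; exact h0
    · obtain ⟨mu, r, hr⟩ := Label.exists_removable he
      have h1 := Label.deg_of_state_eq_add hr
      have h2 := mu.deg_nonneg
      exact h lam mu r hr (ih mu.deg.toNat (by omega) mu rfl)

/-- A subspace that is invariant under the `ψ⁺_i` is spanned by basis vectors. -/
theorem Resonant.ket_mem_of_apply_ne_zero (H : Resonant a b q₁ q₂ q₃ u us)
    {W : Submodule ℂ (MSpace a b)}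
    (hW : ∀ k : ℕ, ∀ v ∈ W, opDiag (psiPlusEig q₁ q₂ q₃ us k) v ∈ W) {v : MSpace a b}
    (hv : v ∈ W) (hlam : v lam ≠ 0) : ket lam ∈ W := by
  have hsep : ∀ mu, ∃ k : ℕ, mu ≠ lam →
      psiPlusEig q₁ q₂ q₃ us k lam - psiPlusEig q₁ q₂ q₃ us k mu ≠ 0 := by
    intro mu
    by_cases hml : mu = lam
    · exact ⟨0, fun h => absurd hml h⟩
    · by_contra hcon
      push Not at hcon
      exact hml (H.eq_of_psiPlusEig_eq fun k => (sub_eq_zero.1 (hcon k).2).symm)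
  choose κ hκ using hsep
  -- A product of factors `ψ⁺_k - c`, each vanishing on one label of `S`. With `S` the rest of the
  -- support, the resulting operator maps `v` to a nonzero multiple of `ket lam`.
  set g : Finset (Label a b) → Label a b → ℂ := fun S nu =>
    ∏ mu ∈ S, (psiPlusEig q₁ q₂ q₃ us (κ mu) nu - psiPlusEig q₁ q₂ q₃ us (κ mu) mu) with hg
  have hmem : ∀ S, opDiag (g S) v ∈ W := by
    classical
    intro S
    induction S using Finset.induction_on with
    | empty =>
      have : g ∅ = fun _ => 1 := by simp [hg]
      rw [this, opDiag_one]
      exact hv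
    | insert mu S hmu ih =>
      have : opDiag (g (insert mu S)) v =
          opDiag (psiPlusEig q₁ q₂ q₃ us (κ mu)) (opDiag (g S) v) -
            psiPlusEig q₁ q₂ q₃ us (κ mu) mu • opDiag (g S) v := by
        ext nu
        rw [Finsupp.sub_apply, Finsupp.smul_apply, opDiag_apply, opDiag_apply, opDiag_apply, hg]
        simp only [Finset.prod_insert hmu, smul_eq_mul]
        ring
      rw [this]
      exact W.sub_mem (hW _ _ ih) (W.smul_mem _ ih)
  classical
  have h1 := hmem (v.support.erase lam)
  have h2 : opDiag (g (v.support.erase lam)) v = (g (v.support.erase lam) lam * v lam) • ket lam := by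
    ext nu
    rw [opDiag_apply, Finsupp.smul_apply, ket, Finsupp.single_apply, smul_eq_mul]
    split_ifs with hnu
    · rw [← hnu, mul_one]
    · rw [mul_zero]
      by_cases h0 : v nu = 0
      · rw [h0, mul_zero]
      · rw [mul_eq_zero]
        refine Or.inl (Finset.prod_eq_zero (i := nu) ?_ (sub_self _))
        exact Finset.mem_erase.2 ⟨Ne.symm hnu, Finsupp.mem_support_iff.2 h0⟩
  rw [h2] at h1
  refine (W.smul_mem_iff (mul_ne_zero ?_ hlam)).1 h1
  exact Finset.prod_ne_zero_iff.2 fun mu hmu => hκ mu (Finset.ne_of_mem_erase hmu)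

/-- An invariant subspace that contains the vacuum is the whole space. -/
theorem Resonant.eq_top_of_ket_empty_mem (H : Resonant a b q₁ q₂ q₃ u us)
    {W : Submodule ℂ (MSpace a b)} (hW : ∀ x, ∀ v ∈ W, genOp a b q₁ q₂ q₃ us x v ∈ W)
    (h0 : ket (Label.empty a b) ∈ W) : W = ⊤ := by
  have h : ∀ lam : Label a b, ket lam ∈ W := by
    refine Label.induction_removable h0 fun lam mu r hr hmu => ?_
    refine H.ket_mem_of_apply_ne_zero (fun k => hW (.psiPlus k)) (hW (.e 0) _ hmu) ?_
    have hL := mu.room_spec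
    have hlam := lam.isState
    rw [hr] at hlam
    change opE a b q₁ q₂ q₃ us 0 (ket mu) lam ≠ 0
    rw [H.opE_apply hL hr, zpow_zero, mul_one]
    exact H.coefE_ne_zero mu.isState (hL.mem_rows_of_isState_add hlam) hlam
  rw [eq_top_iff]
  intro v _
  rw [← sum_smul_ket v]
  exact W.sum_mem fun lam _ => W.smul_mem _ (h lam)

/-- Applying `f_0` and projecting to a basis vector removes one box at a time, since the
coefficients of `f` between labels do not vanish. -/
theorem Resonant.ket_empty_mem (H : Resonant a b q₁ q₂ q₃ u us)
    {W : Submodule ℂ (MSpace a b)} (hW : ∀ x, ∀ v ∈ W, genOp a b q₁ q₂ q₃ us x v ∈ W)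
    (hne : W ≠ ⊥) : ket (Label.empty a b) ∈ W := by
  have h : ∀ lam : Label a b, ket lam ∈ W → ket (Label.empty a b) ∈ W := by
    refine Label.induction_removable id fun lam mu r hr ih hlam => ih ?_
    refine H.ket_mem_of_apply_ne_zero (fun k => hW (.psiPlus k)) (hW (.f 0) _ hlam) ?_
    have hL := lam.room_spec
    have hmu := mu.isState
    rw [eq_sub_of_add_eq hr.symm] at hmu
    change opF a b q₁ q₂ q₃ us 0 (ket lam) mu ≠ 0
    rw [H.opF_apply hL hr, zpow_zero, mul_one]
    exact H.coefF_ne_zero mu.isState (hL.mem_rows_of_isState hmu)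
  obtain ⟨v, hv, hv0⟩ := W.ne_bot_iff.1 hne
  obtain ⟨lam, hlam⟩ : ∃ lam, v lam ≠ 0 := by
    by_contra hcon
    push Not at hcon
    exact hv0 (Finsupp.ext hcon)
  exact h lam (H.ket_mem_of_apply_ne_zero (fun k => hW (.psiPlus k)) hv hlam)

theorem Resonant.isIrreducibleModule (H : Resonant a b q₁ q₂ q₃ u us) :
    IsIrreducibleModule H.rep := by
  unfold IsIrreducibleModule
  let _ : Module (EAlg q₁ q₂ q₃) (MSpace a b) := Module.compHom (MSpace a b) H.rep.toRingHom
  have hsmul : ∀ (x : EAlg q₁ q₂ q₃) (v : MSpace a b), x • v = H.rep x v := fun _ _ => rfl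
  have : Nontrivial (MSpace a b) := ⟨⟨ket (Label.empty a b), 0, ket_ne_zero _⟩⟩
  rw [isSimpleModule_iff]
  refine { exists_pair_ne := ⟨⊥, ⊤, bot_ne_top⟩, eq_bot_or_eq_top := fun N => ?_ }
  -- Submodules over the algebra are complex subspaces because scalars act through its unit.
  let W : Submodule ℂ (MSpace a b) :=
    { carrier := N
      add_mem' := N.add_mem
      zero_mem' := N.zero_mem
      smul_mem' := fun c v hv => by
        have := N.smul_mem (algebraMap ℂ _ c) hv
        rw [hsmul, AlgHom.commutes] at this
        exact this }
  have hW : ∀ x, ∀ v ∈ W, genOp a b q₁ q₂ q₃ us x v ∈ W := fun x v hv => by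
    have := N.smul_mem (EAlg.gen q₁ q₂ q₃ x) hv
    rw [hsmul, H.rep_gen] at this
    exact this
  by_cases hbot : W = ⊥
  · left
    rw [eq_bot_iff]
    intro v hv
    have : v ∈ W := hv
    rw [hbot] at this
    exact this
  · right
    rw [eq_top_iff]
    intro v _
    have : v ∈ W := by rw [H.eq_top_of_ket_empty_mem hW (H.ket_empty_mem hW hbot)]; trivial
    exact this

/-! ## The highest weight -/

theorem psiPlusEig_empty (hq : q₁ * q₂ * q₃ = 1) (k : ℤ) :
    psiPlusEig q₁ q₂ q₃ us k (Label.empty a b) = (highestWeightPlus q₂ us).coeff k := by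
  rw [psiPlusEig, highestWeightPlus]
  refine congrArg (fun F : LaurentSeries ℂ => F.coeff k) (Finset.prod_congr rfl fun i _ => ?_)
  rw [← C_div_zInf, psiEmptyPlus_eq _ _ zInf_ne_zero]
  refine (fockPsiPlus_eq (HahnSeries.C : ℂ →+* LaurentSeries ℂ) hq (L := 0) (fun _ _ => rfl) _
    zInf_ne_zero fun _ _ => zInf_ne_C _).trans ?_
  simp

theorem psiMinusEig_empty (hq : q₁ * q₂ * q₃ = 1) (hus : ∀ i, us i ≠ 0) (k : ℤ) :
    psiMinusEig q₁ q₂ q₃ us (-k) (Label.empty a b) = (highestWeightMinus q₂ us).coeff k := by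
  rw [psiMinusEig, highestWeightMinus, neg_neg]
  refine congrArg (fun F : LaurentSeries ℂ => F.coeff k) (Finset.prod_congr rfl fun i _ => ?_)
  rw [← zZero_div_C (hus i), psiEmptyMinus_eq _ (ne_zero_mid_of_prod hq) (hus i)]
  refine (fockPsiMinus_eq (HahnSeries.C : ℂ →+* LaurentSeries ℂ) hq (L := 0) (fun _ _ => rfl)
    (hus i) fun _ _ => zZero_ne_C _).trans ?_
  simp

theorem Resonant.isHighestWeight (H : Resonant a b q₁ q₂ q₃ u us) :
    IsHighestWeight H.rep (ket (Label.empty a b)) (highestWeightPlus q₂ us)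
      (highestWeightMinus q₂ us) where
  ne_zero := ket_ne_zero _
  generates := by
    let W : Submodule ℂ (MSpace a b) :=
      LinearMap.range ((LinearMap.applyₗ (ket (Label.empty a b))).comp H.rep.toLinearMap)
    have hW : W = ⊤ := by
      refine H.eq_top_of_ket_empty_mem (fun x v hv => ?_) ⟨1, ?_⟩
      · obtain ⟨y, rfl⟩ := hv
        refine ⟨EAlg.gen q₁ q₂ q₃ x * y, ?_⟩
        change H.rep (EAlg.gen q₁ q₂ q₃ x * y) _ = genOp a b q₁ q₂ q₃ us x (H.rep y _)
        rw [map_mul, H.rep_gen, Module.End.mul_apply]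
      · change H.rep 1 _ = _
        rw [map_one, Module.End.one_apply]
    intro v
    have : v ∈ W := by rw [hW]; trivial
    exact this
  f_zero k := by
    rw [H.rep_gen]
    ext mu
    refine opF_apply_eq_zero (fun r hr => ?_) k
    have h1 := congrFun hr r
    have h2 := mu.isState.nonneg r
    rw [Label.empty_state, Pi.add_apply, Pi.single_eq_same] at h1
    omega
  psiPlus k := by
    rw [H.rep_gen, genOp, opDiag_ket, psiPlusEig_empty H.prod_eq_one]
  psiMinus k := by
    rw [H.rep_gen, genOp, opDiag_ket, psiMinusEig_empty H.prod_eq_one H.us_ne]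

/-! ## The parameters of the theorem -/

/-- Iterating the resonance conditions from the first factor gives `u_i` as a monomial times `u`,
and independence of `q₁` and `q₂` gives that of `q₁` and `q₃ = (q₁ q₂)⁻¹`. -/
theorem Resonant.of_generic (hq : q₁ * q₂ * q₃ = 1) (hgen : Generic ![q₁, q₂, u]) (hu : us 0 = u)
    (hres : ∀ i : Fin n, us i.castSucc = us i.succ * q₁ ^ (a i + 1) * q₃ ^ (b i + 1)) :
    Resonant a b q₁ q₂ q₃ u us := by
  have h1 := ne_zero_left_of_prod hq
  have h2 := ne_zero_mid_of_prod hq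
  have h3 := ne_zero_right_of_prod hq
  refine ⟨hq, hgen.1 2, fun x y hxy => ?_, fun i => ?_⟩
  · have e3 : q₃ = (q₁ * q₂)⁻¹ := eq_inv_of_mul_eq_one_right hq
    have := hgen.2 ![x - y, -y, 0] (by
      rw [e3, inv_zpow', mul_zpow, ← mul_assoc, ← zpow_add₀ h1, ← sub_eq_add_neg] at hxy
      rw [Fin.prod_univ_three]
      simpa only [Matrix.cons_val_zero, Matrix.cons_val_one, Matrix.cons_val, zpow_zero, mul_one]
        using hxy)
    have a0 := congrFun this 0
    have a1 := congrFun this 1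
    simp at a0 a1
    omega
  · induction i using Fin.induction with
    | zero => simp [offset_zero, hu]
    | succ i ih =>
      have h := hres i
      rw [ih] at h
      rw [offset_succ, offset_succ,
        show -(offset a i.castSucc + a i + 1) = -offset a i.castSucc - ((a i + 1 : ℕ) : ℤ) by
          push_cast; ring,
        show -(offset b i.castSucc + b i + 1) = -offset b i.castSucc - ((b i + 1 : ℕ) : ℤ) by
          push_cast; ring, zpow_sub₀ h1, zpow_sub₀ h3, zpow_natCast, zpow_natCast]
      have n1 := pow_ne_zero (a i + 1) h1
      have n3 := pow_ne_zero (b i + 1) h3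
      rw [div_mul_div_comm, div_mul_eq_mul_div, h, eq_div_iff (mul_ne_zero n1 n3)]
      ring

end Properties

end QuantumGl

end

theorem mainTheorem4 (n : ℕ) (q₁ q₂ q₃ u : ℂ) (hq : q₁ * q₂ * q₃ = 1)
    (hgen : Generic ![q₁, q₂, u]) (a b : Fin n → ℕ) (us : Fin (n + 1) → ℂ) (hu : us 0 = u)
    (hres : ∀ i : Fin n,
      us i.castSucc = us i.succ * q₁ ^ (a i + 1) * q₃ ^ (b i + 1)) :
    ∃ ρ : EAlg q₁ q₂ q₃ →ₐ[ℂ] Module.End ℂ (MSpace a b),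
      IsTensorAction a b us ρ ∧
      (∀ ρ' : EAlg q₁ q₂ q₃ →ₐ[ℂ] Module.End ℂ (MSpace a b),
        IsTensorAction a b us ρ' → ρ' = ρ) ∧
      IsGradedModule ρ (MSpace.piece a b) ∧
      IsIrreducibleModule ρ ∧
      IsTame ρ ∧
      IsHighestWeight ρ (ket (Label.empty a b))
        (highestWeightPlus q₂ us) (highestWeightMinus q₂ us) := by
  have H : Resonant a b q₁ q₂ q₃ u us := Resonant.of_generic hq hgen hu hres
  have := H.neBot
  exact ⟨H.rep, H.isTensorAction_rep, fun _ h => H.isTensorAction_rep.unique h, H.isGradedModule,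
    H.isIrreducibleModule, H.isTame, H.isHighestWeight⟩
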